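/- For coprime integers $a,b$ let $T_{a,b}\subset S^3=\{(z,w)\in\mathbb{C}^2 : |z|^2+|w|^2=1\}$ be the torus knot, i.e. the image of $\theta\mapsto \frac{1}{\sqrt2}(e^{ia\theta},e^{ib\theta})$, and let $X=S^3\setminus T_{a,b}$ be its exterior. For a prime number $p$, a $\mathbb{Z}/p^n\mathbb{Z}$-cover of $X$ is a connected covering space of $X$ with an action of $\mathbb{Z}/p^n\mathbb{Z}$ by homeomorphisms that is simply transitive on every fibre, and a $\mathbb{Z}_p$-cover of $X$ is a system $(X_{p^n}\to X)_{n\ge 0}$ of $\mathbb{Z}/p^n\mathbb{Z}$-covers with continuous maps $X_{p^{n+1}}\to X_{p^n}$ over $X$ that are equivariant with respect to the reduction $\mathbb{Z}/p^{n+1}\mathbb{Z}\to\mathbb{Z}/p^n\mathbb{Z}$. Let $p$ be a prime number and let $a,b$ be coprime integers with $p\nmid b$; write $a=p^r a'$ with $r\in\mathbb{Z}_{\ge 0}$, $a'\in\mathbb{Z}$, $p\nmid a'$. Then $X$ has a $\mathbb{Z}_p$-cover, and for every $\mathbb{Z}_p$-cover $(X_{p^n}\to X)_n$ of $X$ the torsion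 subgroup $H_1(X_{p^n})_{\rm tor}$ of the first integral singular homology group of $X_{p^n}$ satisfies \[ |H_1(X_{p^n})_{\rm tor}| = |b|^{\,p^{\min\{n,r\}}-1}\qquad\text{for all } n\ge 0, \] and hence \[ \lim_{n\to\infty}|H_1(X_{p^n})_{\rm tor}| = |b|^{\,p^r-1}\quad\text{in } \mathbb{Z}_p . \] Here $|b|$ is the ordinary absolute value of the integer $b$. -/

import Mathlib

open scoped Topology

noncomputable section

/-- The unit sphere in `ℂ²`. -/
abbrev ThreeSphere : Type := Metric.sphere (0 : EuclideanSpace ℂ (Fin 2)) 1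

/-- The torus knot `T_{a,b}` (for coprime `a`, `b`): the image of the curve
`θ ↦ (e^{iaθ}, e^{ibθ}) / √2` on the Clifford torus in the 3-sphere. -/
def torusKnot (a b : ℤ) : Set ThreeSphere :=
  {x | ∃ θ : ℝ,
    x.1 0 = Complex.exp (a * θ * Complex.I) / (Real.sqrt 2 : ℂ) ∧
    x.1 1 = Complex.exp (b * θ * Complex.I) / (Real.sqrt 2 : ℂ)}

/-- The exterior `S³ - T_{a,b}`, with the subspace topology. -/
abbrev TorusKnotExterior (a b : ℤ) : Type := ↥(torusKnot a b)ᶜ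

/-- A `ℤ/m`-cover of `X`: a connected covering space of `X` with an action of `ℤ/m` by
homeomorphisms that is simply transitive on every fibre. As the total space is connected, the
action identifies `ℤ/m` with the group of deck transformations. -/
structure CyclicCover (m : ℕ) (X : Type) [TopologicalSpace X] where
  space : Type
  [topologicalSpace : TopologicalSpace space]
  [connectedSpace : ConnectedSpace space]
  [addAction : AddAction (ZMod m) space]
  proj : space → X
  isCoveringMap : IsCoveringMap proj
  surjective : Function.Surjective proj
  continuous_vadd : ∀ g : ZMod m, Continuous fun x : space => g +ᵥ x
  proj_eq_iff : ∀ x y : space, proj x = proj y ↔ ∃ g : ZMod m, g +ᵥ x = y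
  free : ∀ (g : ZMod m) (x : space), g +ᵥ x = x → g = 0

attribute [instance] CyclicCover.topologicalSpace CyclicCover.connectedSpace
  CyclicCover.addAction

/-- A `ℤ_p`-cover of `X`: a compatible system of `ℤ/pⁿ`-covers, that is, maps over `X` from each
layer to the one below, equivariant along the reduction `ℤ/pⁿ⁺¹ → ℤ/pⁿ`. -/
structure ZpCover (p : ℕ) (X : Type) [TopologicalSpace X] where
  layer : ∀ n : ℕ, CyclicCover (p ^ n) X
  trans : ∀ n : ℕ, (layer (n + 1)).space → (layer n).space
  continuous_trans : ∀ n, Continuous (trans n)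
  proj_trans : ∀ n x, (layer n).proj (trans n x) = (layer (n + 1)).proj x
  trans_vadd : ∀ (n : ℕ) (g : ZMod (p ^ (n + 1))) (x : (layer (n + 1)).space),
    trans n (g +ᵥ x) =
      ZMod.castHom (pow_dvd_pow p n.le_succ) (ZMod (p ^ n)) g +ᵥ trans n x

/-- The first singular homology group of `X` with integral coefficients. -/
abbrev H₁ (X : Type) [TopologicalSpace X] : AddCommGrpCat.{0} :=
  ((AlgebraicTopology.singularHomologyFunctor AddCommGrpCat.{0} 1).obj
    (AddCommGrpCat.of ℤ)).obj (TopCat.of X)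

/-- The order `|H₁(X)_tor|` of the torsion subgroup of the first homology group (the value is `0`
if that subgroup is infinite). -/
def cardTorsionH₁ (X : Type) [TopologicalSpace X] : ℕ :=
  Nat.card (AddCommGroup.torsion (H₁ X))

end

/-!
By the Hurewicz theorem, the first homology of a cyclic cover with group `ℤ/m` is the abelianization
of the kernel of a surjection `π₁(X) → ℤ/m`. The group `π₁(X)` is generated by elements `x`, `y`
with `x ^ a = y ^ b`, the cores of two path connected open sets that cover `X` and have path
connected intersection. The winding number of the defect `w ^ a - z ^ b` defines a weight on `π₁(X)`
with values `b` on `x` and `a` on `y`, so for `m` prime to `b` the kernel consists of the elements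
whose weight is divisible by `m`, whatever the cover.

Put `N = gcd a m` and write `a - k * b = m * e`. The abelianized kernel is generated by the classes
of `x ^ m` and of `x ^ i * y * x ^ (-k - i)` for `0 ≤ i < N`, and `b` times each of the latter is
`e` times the former; hence its torsion has order at most `b ^ (N - 1)`. To see that there are no
further relations, adjoin an `N`-th root `u` of the defect. Then `z ^ b = w ^ a - u ^ N` is
divisible by `w ^ (a / N) - u`, and the cover on which this factor and its cofactor become `b`-th
powers yields a character to `ℤ/b` that separates `y` from its conjugates by powers of `x`.
-/

noncomputable section

/-- The class of a group element in the abelianization, written additively. -/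
def abelianClass {G : Type*} [Group G] (g : G) : Additive (Abelianization G) :=
  Additive.ofMul (Abelianization.of g)

lemma abelianClass_mul {G : Type*} [Group G] (g h : G) :
    abelianClass (g * h) = abelianClass g + abelianClass h :=
  congrArg Additive.ofMul (map_mul Abelianization.of g h)

lemma exists_abelianClass_eq {G : Type*} [Group G] (t : Additive (Abelianization G)) :
    ∃ g, abelianClass g = t :=
  (QuotientGroup.mk_surjective (Additive.toMul t)).imp fun _ => congrArg Additive.ofMul

namespace BasedLoop

variable {X : Type*} [TopologicalSpace X] {x₀ : X} (τ : ∀ z : X, Path x₀ z)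

/-- The loop at `x₀` that runs out along the chosen path `τ z`, then along `γ` from `z` to `z'`, and
back along `τ z'`. -/
def closeUp {z z' : X} (γ : Path.Homotopic.Quotient z z') : FundamentalGroup X x₀ :=
  FundamentalGroup.fromPath (((Path.Homotopic.Quotient.mk (τ z)).trans γ).trans
    (Path.Homotopic.Quotient.mk (τ z')).symm)

lemma closeUp_refl (z : X) : closeUp τ (Path.Homotopic.Quotient.refl z) = 1 := by
  rw [closeUp, Path.Homotopic.Quotient.trans_refl, Path.Homotopic.Quotient.trans_symm]
  rfl

lemma closeUp_trans {z z' z'' : X} (γ : Path.Homotopic.Quotient z z')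
    (γ' : Path.Homotopic.Quotient z' z'') :
    closeUp τ (γ.trans γ') = closeUp τ γ' * closeUp τ γ := by
  rw [FundamentalGroup.mul_def]
  simp only [closeUp, Path.Homotopic.Quotient.trans_assoc]
  rw [← Path.Homotopic.Quotient.trans_assoc (Path.Homotopic.Quotient.symm _)]
  simp

lemma closeUp_cast {z z' y y' : X} (γ : Path z z') (h : y = z) (h' : y' = z') :
    closeUp τ (Path.Homotopic.Quotient.mk (γ.cast h h')) =
      closeUp τ (Path.Homotopic.Quotient.mk γ) := by
  subst h h'
  rfl

lemma closeUp_eq_conj (γ : Path.Homotopic.Quotient x₀ x₀) :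
    closeUp τ γ = (FundamentalGroup.fromPath (.mk (τ x₀)))⁻¹ *
      (FundamentalGroup.fromPath γ * FundamentalGroup.fromPath (.mk (τ x₀))) :=
  rfl

end BasedLoop

namespace Hurewicz

open CategoryTheory Simplicial AlgebraicTopology BasedLoop
open scoped unitInterval

variable {Y : Type} [TopologicalSpace Y]

/-! ### Singular chains in low degrees -/

/-- The element of the singular simplicial set of `Y` given by a continuous map. -/
def singularSimplex {n : ℕ} (τ : C(stdSimplex ℝ (Fin (n + 1)), Y)) :
    (TopCat.toSSet.obj (TopCat.of Y)) _⦋n⦌ :=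
  (TopCat.toSSetObjEquiv (TopCat.of Y) (.op ⦋n⦌)).symm τ

/-- The inclusion of the face opposite to the `i`-th vertex of the standard simplex. -/
def faceInclusion {n : ℕ} (i : Fin (n + 2)) :
    C(stdSimplex ℝ (Fin (n + 1)), stdSimplex ℝ (Fin (n + 2))) :=
  ⟨stdSimplex.map i.succAbove, stdSimplex.continuous_map _⟩

lemma δ_singularSimplex {n : ℕ} (τ : C(stdSimplex ℝ (Fin (n + 2)), Y)) (i : Fin (n + 2)) :
    (TopCat.toSSet.obj (TopCat.of Y)).δ i (singularSimplex τ) =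
      singularSimplex (τ.comp (faceInclusion i)) :=
  rfl

lemma singularSimplex_surjective (n : ℕ) : Function.Surjective
    (singularSimplex : C(stdSimplex ℝ (Fin (n + 1)), Y) → _) :=
  (TopCat.toSSetObjEquiv (TopCat.of Y) (.op ⦋n⦌)).symm.surjective

variable (Y) in
/-- The integral singular chain complex of `Y`. -/
abbrev singularChains : ChainComplex AddCommGrpCat.{0} ℕ :=
  (TopCat.toSSet.obj (TopCat.of Y)).chainComplex (AddCommGrpCat.of ℤ)

variable (Y) in
/-- The singular `1`-chains of `Y` modulo boundaries; `H₁ Y` is the kernel of the map it carries to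
`0`-chains. -/
abbrev ChainsModBoundaries : AddCommGrpCat.{0} := (singularChains Y).opcycles 1

/-- A singular simplex as an element of the chain group. -/
def simplexChain {n : ℕ} (τ : C(stdSimplex ℝ (Fin (n + 1)), Y)) : (singularChains Y).X n :=
  (SSet.ιChainComplex (R := AddCommGrpCat.of ℤ) _ (singularSimplex τ)).hom (1 : ℤ)

lemma d_simplexChain {n : ℕ} (τ : C(stdSimplex ℝ (Fin (n + 2)), Y)) :
    ((singularChains Y).d (n + 1) n).hom (simplexChain τ) =
      ∑ i : Fin (n + 2), (-1 : ℤ) ^ i.val • simplexChain (τ.comp (faceInclusion i)) := by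
  have h := congr($(SSet.ιChainComplex_d (R := AddCommGrpCat.of ℤ)
    (TopCat.toSSet.obj (TopCat.of Y)) (singularSimplex τ)).hom (1 : ℤ))
  refine h.trans ?_
  change AddCommGrpCat.homAddEquiv _ _ = _
  rw [map_sum, AddMonoidHom.finsetSum_apply]
  refine Finset.sum_congr rfl fun i _ => ?_
  rw [map_zsmul, AddMonoidHom.zsmul_apply, δ_singularSimplex]
  rfl

lemma d_simplexChain_two (T : C(stdSimplex ℝ (Fin 3), Y)) :
    ((singularChains Y).d 2 1).hom (simplexChain T) =
      simplexChain (T.comp (faceInclusion 0)) - simplexChain (T.comp (faceInclusion 1)) +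
        simplexChain (T.comp (faceInclusion 2)) := by
  rw [d_simplexChain, Fin.sum_univ_three]
  simp [sub_eq_add_neg]

lemma chains_hom_ext {n : ℕ} {T : AddCommGrpCat.{0}} {f g : (singularChains Y).X n ⟶ T}
    (h : ∀ τ, f.hom (simplexChain τ) = g.hom (simplexChain τ)) : f = g := by
  refine SSet.chainComplex_hom_ext fun ρ => ?_
  obtain ⟨τ, rfl⟩ := singularSimplex_surjective n ρ
  ext
  exact h τ

/-- The homomorphism on singular chains with prescribed values on the simplices. -/
def chainLift {n : ℕ} {T : AddCommGrpCat.{0}} (φ : C(stdSimplex ℝ (Fin (n + 1)), Y) → T) :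
    (singularChains Y).X n ⟶ T :=
  ((TopCat.toSSet.obj (TopCat.of Y)).isColimitChainComplexXCofan _ n).desc
    (Limits.Cofan.mk _ fun ρ => AddCommGrpCat.ofHom
      (zmultiplesHom _ (φ (TopCat.toSSetObjEquiv (TopCat.of Y) (.op ⦋n⦌) ρ))))

lemma chainLift_simplexChain {n : ℕ} {T : AddCommGrpCat.{0}}
    (φ : C(stdSimplex ℝ (Fin (n + 1)), Y) → T) (τ : C(stdSimplex ℝ (Fin (n + 1)), Y)) :
    (chainLift φ).hom (simplexChain τ) = φ τ := by
  have h := ((TopCat.toSSet.obj (TopCat.of Y)).isColimitChainComplexXCofan (AddCommGrpCat.of ℤ)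
    n).fac (Limits.Cofan.mk _ fun ρ => AddCommGrpCat.ofHom
      (zmultiplesHom T (φ (TopCat.toSSetObjEquiv (TopCat.of Y) (.op ⦋n⦌) ρ))))
    ⟨singularSimplex τ⟩
  exact congr($(h).hom (1 : ℤ)).trans (by simp [singularSimplex])

/-- The class of a singular `1`-simplex modulo boundaries. -/
def simplexClass (ρ : C(stdSimplex ℝ (Fin 2), Y)) : ChainsModBoundaries Y :=
  ((singularChains Y).pOpcycles 1).hom (simplexChain ρ)

lemma simplexClass_triangle (τ : C(stdSimplex ℝ (Fin 3), Y)) :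
    simplexClass (τ.comp (faceInclusion 2)) + simplexClass (τ.comp (faceInclusion 0)) =
      simplexClass (τ.comp (faceInclusion 1)) := by
  have boundary_eq_zero : ((singularChains Y).pOpcycles 1).hom
      (((singularChains Y).d 2 1).hom (simplexChain τ)) = 0 :=
    congr($((singularChains Y).d_pOpcycles 2 1).hom (simplexChain τ))
  rw [d_simplexChain_two, map_add, map_sub] at boundary_eq_zero
  simp only [simplexClass]
  rw [← sub_eq_zero, ← boundary_eq_zero]
  abel

/-! ### Paths as singular simplices -/

/-- The singular `1`-simplex given by a map from the unit interval. -/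
def edge (f : C(I, Y)) : C(stdSimplex ℝ (Fin 2), Y) :=
  f.comp ⟨stdSimplexHomeomorphUnitInterval, stdSimplexHomeomorphUnitInterval.continuous⟩

/-- The class of a path in `1`-chains modulo boundaries. -/
def pathClass {x y : Y} (γ : Path x y) : ChainsModBoundaries Y := simplexClass (edge γ)

lemma simplexClass_edge_const (x : Y) : simplexClass (edge (ContinuousMap.const I x)) = 0 := by
  have h := simplexClass_triangle (ContinuousMap.const (stdSimplex ℝ (Fin 3)) x)
  exact add_eq_left.mp h

lemma faceInclusion_zero_apply (s : stdSimplex ℝ (Fin 2)) :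
    (faceInclusion 0 s : Fin 3 → ℝ) = ![0, s 0, s 1] := by
  ext j
  fin_cases j <;> simp [faceInclusion, FunOnFinite.linearMap_apply_apply, Finset.sum_filter]

lemma faceInclusion_one_apply (s : stdSimplex ℝ (Fin 2)) :
    (faceInclusion 1 s : Fin 3 → ℝ) = ![s 0, 0, s 1] := by
  ext j
  fin_cases j <;> simp [faceInclusion, FunOnFinite.linearMap_apply_apply, Finset.sum_filter]

lemma faceInclusion_two_apply (s : stdSimplex ℝ (Fin 2)) :
    (faceInclusion 2 s : Fin 3 → ℝ) = ![s 0, s 1, 0] := by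
  have succAbove_two_one : Fin.succAbove (2 : Fin 3) 1 = 1 := rfl
  ext j
  fin_cases j <;>
    simp [faceInclusion, FunOnFinite.linearMap_apply_apply, Finset.sum_filter, succAbove_two_one]

/-- The affine map from the triangle to the unit interval that takes the values `0`, `l`, `m` at the
vertices. -/
def triangleToInterval (l m : I) : C(stdSimplex ℝ (Fin 3), I) where
  toFun t := ⟨l * t 1 + m * t 2, by
    have h0 := stdSimplex.zero_le t 0
    have h1 := stdSimplex.zero_le t 1
    have h2 := stdSimplex.zero_le t 2
    have hsum := stdSimplex.sum_eq_one t
    rw [Fin.sum_univ_three] at hsum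
    exact ⟨by have := l.2.1; have := m.2.1; positivity, by nlinarith [l.2.2, m.2.2]⟩⟩
  continuous_toFun := Continuous.subtype_mk
    ((continuous_const.mul ((continuous_apply 1).comp continuous_subtype_val)).add
      (continuous_const.mul ((continuous_apply 2).comp continuous_subtype_val))) _

lemma triangleToInterval_face_zero (l m : I) (s : stdSimplex ℝ (Fin 2)) :
    (triangleToInterval l m (faceInclusion 0 s) : ℝ) = l + (m - l) * s 1 := by
  have h : (triangleToInterval l m (faceInclusion 0 s) : ℝ) = l * s 0 + m * s 1 := by
    simp [triangleToInterval, faceInclusion_zero_apply]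
  linear_combination h + l * stdSimplex.add_eq_one s

lemma triangleToInterval_face_one (l m : I) (s : stdSimplex ℝ (Fin 2)) :
    (triangleToInterval l m (faceInclusion 1 s) : ℝ) = m * s 1 := by
  simp [triangleToInterval, faceInclusion_one_apply]

lemma triangleToInterval_face_two (l m : I) (s : stdSimplex ℝ (Fin 2)) :
    (triangleToInterval l m (faceInclusion 2 s) : ℝ) = l * s 1 := by
  simp [triangleToInterval, faceInclusion_two_apply]

lemma edge_apply {x y : Y} (γ : Path x y) (s : stdSimplex ℝ (Fin 2)) :
    edge γ s = γ.extend (s 1) :=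
  (γ.extend_apply _).symm

-- The triangle maps affinely onto the interval, its middle vertex going to the junction at `1 / 2`.
lemma pathClass_trans {x y z : Y} (γ : Path x y) (γ' : Path y z) :
    pathClass (γ.trans γ') = pathClass γ + pathClass γ' := by
  let T : C(stdSimplex ℝ (Fin 3), Y) := (γ.trans γ').toContinuousMap.comp
    (triangleToInterval ⟨1 / 2, by norm_num, by norm_num⟩ 1)
  have trans_apply (t : I) : (γ.trans γ').toContinuousMap t =
      if (t : ℝ) ≤ 1 / 2 then γ.extend (2 * t) else γ'.extend (2 * t - 1) := rfl
  have face_one : edge (γ.trans γ') = T.comp (faceInclusion 1) := by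
    ext s
    simp only [T, ContinuousMap.comp_apply, trans_apply, triangleToInterval_face_one, edge_apply]
    rw [Path.extend_apply _ ⟨stdSimplex.zero_le s 1, stdSimplex.le_one s 1⟩]
    simp [Path.trans]
  have face_two : edge γ = T.comp (faceInclusion 2) := by
    ext s
    have := stdSimplex.le_one s 1
    simp only [T, ContinuousMap.comp_apply, trans_apply, triangleToInterval_face_two, edge_apply]
    rw [if_pos (by linarith)]
    congr 1
    ring
  have face_zero : edge γ' = T.comp (faceInclusion 0) := by
    ext s
    have := stdSimplex.zero_le s 1
    simp only [T, ContinuousMap.comp_apply, trans_apply, triangleToInterval_face_zero, edge_apply]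
    split_ifs with h
    · have h1 : s 1 = 0 := by
        rw [Set.Icc.coe_one] at h
        linarith
      simp [h1]
    · congr 1
      rw [Set.Icc.coe_one]
      ring
  rw [pathClass, pathClass, pathClass, face_zero, face_one, face_two, simplexClass_triangle]

-- The diagonal cuts the square into two triangles.
lemma simplexClass_square (F : C(I × I, Y)) :
    simplexClass (edge (F.comp ((ContinuousMap.const I 0).prodMk (ContinuousMap.id I)))) +
        simplexClass (edge (F.comp ((ContinuousMap.id I).prodMk (ContinuousMap.const I 1)))) =
      simplexClass (edge (F.comp ((ContinuousMap.id I).prodMk (ContinuousMap.const I 0)))) +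
        simplexClass (edge (F.comp ((ContinuousMap.const I 1).prodMk (ContinuousMap.id I)))) := by
  let p : C(stdSimplex ℝ (Fin 3), I) := triangleToInterval 0 1
  let q : C(stdSimplex ℝ (Fin 3), I) := triangleToInterval 1 1
  have p0 (s) : p (faceInclusion 0 s) = stdSimplexHomeomorphUnitInterval s :=
    Subtype.ext ((triangleToInterval_face_zero _ _ s).trans (by simp; rfl))
  have p2 (s) : p (faceInclusion 2 s) = 0 :=
    Subtype.ext ((triangleToInterval_face_two _ _ s).trans (by simp))
  have q0 (s) : q (faceInclusion 0 s) = 1 :=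
    Subtype.ext ((triangleToInterval_face_zero _ _ s).trans (by simp))
  have q2 (s) : q (faceInclusion 2 s) = stdSimplexHomeomorphUnitInterval s :=
    Subtype.ext ((triangleToInterval_face_two _ _ s).trans (by simp; rfl))
  have pq1 (s) : p (faceInclusion 1 s) = q (faceInclusion 1 s) :=
    Subtype.ext ((triangleToInterval_face_one _ _ s).trans (triangleToInterval_face_one _ _ s).symm)
  have upper := simplexClass_triangle (F.comp (p.prodMk q))
  have lower := simplexClass_triangle (F.comp (q.prodMk p))
  have diagonal : (F.comp (p.prodMk q)).comp (faceInclusion 1) =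
      (F.comp (q.prodMk p)).comp (faceInclusion 1) :=
    ContinuousMap.ext fun s => congrArg F (Prod.ext (pq1 s) (pq1 s).symm)
  rw [diagonal, ← lower] at upper
  convert upper using 3
  · exact ContinuousMap.ext fun s => congrArg F (Prod.ext (p2 s).symm (q2 s).symm)
  · exact ContinuousMap.ext fun s => congrArg F (Prod.ext (p0 s).symm (q0 s).symm)
  · exact ContinuousMap.ext fun s => congrArg F (Prod.ext (q2 s).symm (p2 s).symm)
  · exact ContinuousMap.ext fun s => congrArg F (Prod.ext (q0 s).symm (p0 s).symm)

lemma pathClass_eq_of_homotopic {x y : Y} {γ γ' : Path x y} (h : γ.Homotopic γ') :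
    pathClass γ = pathClass γ' := by
  obtain ⟨F⟩ := h
  have left : F.toContinuousMap.comp ((ContinuousMap.const I 0).prodMk (ContinuousMap.id I)) = γ :=
    ContinuousMap.ext F.apply_zero
  have right : F.toContinuousMap.comp ((ContinuousMap.const I 1).prodMk (ContinuousMap.id I)) =
      γ' :=
    ContinuousMap.ext F.apply_one
  have bottom : F.toContinuousMap.comp ((ContinuousMap.id I).prodMk (ContinuousMap.const I 0)) =
      ContinuousMap.const I x :=
    ContinuousMap.ext F.source
  have top : F.toContinuousMap.comp ((ContinuousMap.id I).prodMk (ContinuousMap.const I 1)) =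
      ContinuousMap.const I y :=
    ContinuousMap.ext F.target
  have square := simplexClass_square F.toContinuousMap
  rwa [left, right, bottom, top, simplexClass_edge_const, simplexClass_edge_const, add_zero,
    zero_add] at square

lemma pathClass_refl (x : Y) : pathClass (Path.refl x) = 0 :=
  simplexClass_edge_const x

lemma pathClass_symm {x y : Y} (γ : Path x y) : pathClass γ.symm = -pathClass γ := by
  rw [eq_neg_iff_add_eq_zero, ← pathClass_trans, ← pathClass_refl y]
  exact pathClass_eq_of_homotopic ⟨(Path.Homotopy.reflSymmTrans γ).symm⟩

/-- The path underlying a singular `1`-simplex, inverse to `edge`. -/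
def edgePath (ρ : C(stdSimplex ℝ (Fin 2), Y)) :
    Path (ρ (stdSimplex.vertex 0)) (ρ (stdSimplex.vertex 1)) where
  toFun t := ρ (stdSimplexHomeomorphUnitInterval.symm t)
  continuous_toFun := by fun_prop
  source' := by
    rw [← stdSimplexHomeomorphUnitInterval_zero, Homeomorph.symm_apply_apply]
  target' := by
    rw [← stdSimplexHomeomorphUnitInterval_one, Homeomorph.symm_apply_apply]

lemma edge_edgePath (ρ : C(stdSimplex ℝ (Fin 2), Y)) : edge (edgePath ρ) = ρ :=
  ContinuousMap.ext fun s =>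
    congrArg ρ (stdSimplexHomeomorphUnitInterval.symm_apply_apply s)

lemma edgePath_edge {x y : Y} (γ : Path x y) :
    ∃ (h : edge (γ : C(I, Y)) (stdSimplex.vertex 0) = x)
      (h' : edge (γ : C(I, Y)) (stdSimplex.vertex 1) = y),
      edgePath (edge (γ : C(I, Y))) = γ.cast h h' := by
  have h : edge γ (stdSimplex.vertex 0) = x := by rw [edge_apply]; simp
  have h' : edge γ (stdSimplex.vertex 1) = y := by rw [edge_apply]; simp
  refine ⟨h, h', ?_⟩
  ext t
  exact congrArg γ (stdSimplexHomeomorphUnitInterval.apply_symm_apply t)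

/-- The class in `1`-chains modulo boundaries of a homotopy class of paths. -/
def homotopyPathClass {x y : Y} (γ : Path.Homotopic.Quotient x y) : ChainsModBoundaries Y :=
  Quotient.lift pathClass (fun _ _ h => pathClass_eq_of_homotopic h) γ

lemma homotopyPathClass_trans {x y z : Y} (γ : Path.Homotopic.Quotient x y)
    (γ' : Path.Homotopic.Quotient y z) :
    homotopyPathClass (γ.trans γ') = homotopyPathClass γ + homotopyPathClass γ' := by
  induction γ using Path.Homotopic.Quotient.ind
  induction γ' using Path.Homotopic.Quotient.ind
  exact pathClass_trans _ _

lemma homotopyPathClass_symm {x y : Y} (γ : Path.Homotopic.Quotient x y) :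
    homotopyPathClass γ.symm = -homotopyPathClass γ := by
  induction γ using Path.Homotopic.Quotient.ind
  exact pathClass_symm _

lemma edge_comp_faceInclusion {x y : Y} (γ : Path x y) (i j : Fin 2) (hij : i.succAbove 0 = j) :
    (edge (γ : C(I, Y))).comp (faceInclusion i) =
      ContinuousMap.const _ (edge (γ : C(I, Y)) (stdSimplex.vertex j)) := by
  ext s
  have face_eq_vertex : faceInclusion i s = stdSimplex.vertex j := by
    rw [Subsingleton.elim s (stdSimplex.vertex 0), ← hij]
    exact stdSimplex.map_vertex _ _
  rw [ContinuousMap.comp_apply, face_eq_vertex, ContinuousMap.const_apply]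

lemma fromOpcycles_pathClass {x y : Y} (γ : Path x y) :
    ((singularChains Y).fromOpcycles 1 0).hom (pathClass γ) =
      simplexChain (ContinuousMap.const _ y) - simplexChain (ContinuousMap.const _ x) := by
  have h : ((singularChains Y).fromOpcycles 1 0).hom (pathClass γ) =
      ((singularChains Y).d 1 0).hom (simplexChain (edge γ)) :=
    congr($((singularChains Y).p_fromOpcycles 1 0).hom (simplexChain (edge γ)))
  rw [h, d_simplexChain, Fin.sum_univ_two, edge_comp_faceInclusion γ 0 1 rfl,
    edge_comp_faceInclusion γ 1 0 rfl]
  simp [edge_apply, sub_eq_add_neg]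

/-! ### The Hurewicz isomorphism -/

variable (y₀ : Y)

/-- The abelianized fundamental group, written additively. -/
abbrev AbelianizedPi : AddCommGrpCat.{0} :=
  AddCommGrpCat.of (Additive (Abelianization (FundamentalGroup Y y₀)))

variable {y₀}

lemma exists_path_abelianClass_eq (c : AbelianizedPi y₀) :
    ∃ γ : Path y₀ y₀, abelianClass (FundamentalGroup.fromPath (.mk γ)) = c := by
  obtain ⟨g, rfl⟩ := exists_abelianClass_eq c
  obtain ⟨γ, hγ⟩ := Path.Homotopic.Quotient.mk_surjective g.toPath
  exact ⟨γ, congrArg abelianClass hγ⟩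

variable (y₀)

/-- The map from the abelianized fundamental group to `1`-chains modulo boundaries. -/
def abelianizedPiToChains : AbelianizedPi y₀ ⟶ ChainsModBoundaries Y :=
  AddCommGrpCat.ofHom (AddMonoidHom.toMultiplicativeRight.symm (Abelianization.lift
    { toFun := fun g => Multiplicative.ofAdd (homotopyPathClass g.toPath)
      map_one' := congrArg Multiplicative.ofAdd (simplexClass_edge_const y₀)
      map_mul' := fun g h => congrArg Multiplicative.ofAdd
        ((homotopyPathClass_trans h.toPath g.toPath).trans (add_comm _ _)) }))

variable {y₀} in
lemma abelianizedPiToChains_abelianClass (γ : Path.Homotopic.Quotient y₀ y₀) :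
    (abelianizedPiToChains y₀).hom (abelianClass (FundamentalGroup.fromPath γ)) =
      homotopyPathClass γ :=
  rfl

lemma abelianizedPiToChains_comp_fromOpcycles :
    abelianizedPiToChains y₀ ≫ (singularChains Y).fromOpcycles 1 0 = 0 := by
  refine AddCommGrpCat.hom_ext (AddMonoidHom.ext fun c => ?_)
  obtain ⟨γ, rfl⟩ := exists_path_abelianClass_eq c
  exact (fromOpcycles_pathClass γ).trans (sub_self _)

/-- The Hurewicz homomorphism in degree one. -/
def hurewiczHom : AbelianizedPi y₀ ⟶ (singularChains Y).homology 1 :=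
  ((singularChains Y).homologyIsKernel 1 0 (by simp)).lift
    (Limits.KernelFork.ofι (abelianizedPiToChains y₀) (abelianizedPiToChains_comp_fromOpcycles y₀))

lemma hurewiczHom_comp_homologyι :
    hurewiczHom y₀ ≫ (singularChains Y).homologyι 1 = abelianizedPiToChains y₀ :=
  ((singularChains Y).homologyIsKernel 1 0 (by simp)).fac
    (Limits.KernelFork.ofι (abelianizedPiToChains y₀) (abelianizedPiToChains_comp_fromOpcycles y₀))
    Limits.WalkingParallelPair.zero

variable {y₀} (τ : ∀ y : Y, Path y₀ y)

lemma abelianClass_closeUp_of_loop (γ : Path.Homotopic.Quotient y₀ y₀) :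
    abelianClass (closeUp τ γ) = abelianClass (FundamentalGroup.fromPath γ) := by
  rw [closeUp_eq_conj, abelianClass_mul, add_comm, ← abelianClass_mul, mul_inv_cancel_right]

lemma abelianizedPiToChains_closeUp {x y : Y} (γ : Path.Homotopic.Quotient x y) :
    (abelianizedPiToChains y₀).hom (abelianClass (closeUp τ γ)) =
      pathClass (τ x) + homotopyPathClass γ - pathClass (τ y) := by
  rw [closeUp, abelianizedPiToChains_abelianClass, homotopyPathClass_trans,
    homotopyPathClass_trans, homotopyPathClass_symm, sub_eq_add_neg]
  rfl

-- The triangle is simply connected, so its long edge is homotopic to the composite of the others.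
lemma closeUp_triangle (T : C(stdSimplex ℝ (Fin 3), Y)) :
    closeUp τ (.mk (edgePath (T.comp (faceInclusion 0)))) *
        closeUp τ (.mk (edgePath (T.comp (faceInclusion 2)))) =
      closeUp τ (.mk (edgePath (T.comp (faceInclusion 1)))) := by
  have : ContractibleSpace (stdSimplex ℝ (Fin 3)) :=
    (convex_stdSimplex ℝ (Fin 3)).contractibleSpace ⟨_, (stdSimplex.vertex 0).2⟩
  have vertex_eq (i : Fin 3) (j : Fin 2) : stdSimplex.vertex (S := ℝ) (i.succAbove j) =
      faceInclusion i (stdSimplex.vertex j) := (stdSimplex.map_vertex _ _).symm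
  let e (i : Fin 3) : Path (stdSimplex.vertex (S := ℝ) (i.succAbove 0))
      (stdSimplex.vertex (i.succAbove 1)) :=
    (edgePath (faceInclusion i)).cast (vertex_eq i 0) (vertex_eq i 1)
  have closeUp_edge (i : Fin 3) : closeUp τ (.mk ((e i).map T.continuous)) =
      closeUp τ (.mk (edgePath (T.comp (faceInclusion i)))) :=
    closeUp_cast τ (edgePath (T.comp (faceInclusion i))) (congrArg T (vertex_eq i 0))
      (congrArg T (vertex_eq i 1))
  let e01 : Path (stdSimplex.vertex (S := ℝ) (0 : Fin 3)) (stdSimplex.vertex 1) := e 2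
  let e12 : Path (stdSimplex.vertex (S := ℝ) (1 : Fin 3)) (stdSimplex.vertex 2) := e 0
  have edges_homotopic : (e01.trans e12).Homotopic (e 1) :=
    SimplyConnectedSpace.paths_homotopic _ _
  calc _ = closeUp τ (.mk (e12.map T.continuous)) * closeUp τ (.mk (e01.map T.continuous)) :=
        (congrArg₂ (· * ·) (closeUp_edge 0) (closeUp_edge 2)).symm
    _ = closeUp τ (.mk ((e01.trans e12).map T.continuous)) := by
        rw [← closeUp_trans, ← Path.Homotopic.Quotient.mk_trans, ← Path.map_trans]
    _ = closeUp τ (.mk ((e 1).map T.continuous)) :=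
        congrArg (closeUp τ) (Path.Homotopic.Quotient.eq.mpr (edges_homotopic.map T))
    _ = _ := closeUp_edge 1

/-- The homomorphism sending a singular `1`-simplex to the class of its closed-up path. -/
def closeUpChains : (singularChains Y).X 1 ⟶ AbelianizedPi y₀ :=
  chainLift fun ρ => abelianClass (closeUp τ (.mk (edgePath ρ)))

lemma d_comp_closeUpChains : (singularChains Y).d 2 1 ≫ closeUpChains τ = 0 := by
  refine chains_hom_ext fun T => ?_
  change (closeUpChains τ).hom (((singularChains Y).d 2 1).hom (simplexChain T)) = 0
  rw [d_simplexChain_two, map_add, map_sub, closeUpChains, chainLift_simplexChain,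
    chainLift_simplexChain, chainLift_simplexChain, ← closeUp_triangle τ T, abelianClass_mul]
  abel

/-- The map induced by `closeUpChains` on `1`-chains modulo boundaries; its restriction to `H₁` is
the inverse of the Hurewicz homomorphism. -/
def closeUpClasses : ChainsModBoundaries Y ⟶ AbelianizedPi y₀ :=
  (singularChains Y).descOpcycles (closeUpChains τ) 2 (by simp) (d_comp_closeUpChains τ)

lemma closeUpClasses_simplexClass (ρ : C(stdSimplex ℝ (Fin 2), Y)) :
    (closeUpClasses τ).hom (simplexClass ρ) = abelianClass (closeUp τ (.mk (edgePath ρ))) :=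
  congr($((singularChains Y).p_descOpcycles (closeUpChains τ) 2 (by simp)
    (d_comp_closeUpChains τ)).hom (simplexChain ρ)).trans (chainLift_simplexChain _ ρ)

lemma abelianizedPiToChains_comp_closeUpClasses :
    abelianizedPiToChains y₀ ≫ closeUpClasses τ = 𝟙 _ := by
  refine AddCommGrpCat.hom_ext (AddMonoidHom.ext fun c => ?_)
  obtain ⟨γ, rfl⟩ := exists_path_abelianClass_eq c
  obtain ⟨h, h', edgePath_eq⟩ := edgePath_edge γ
  refine (closeUpClasses_simplexClass τ (edge γ)).trans ?_
  rw [edgePath_eq, closeUp_cast, abelianClass_closeUp_of_loop]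
  rfl

/-- The homomorphism sending a point, viewed as a `0`-simplex, to the class of the chosen path to
it. -/
def tailClasses : (singularChains Y).X 0 ⟶ ChainsModBoundaries Y :=
  chainLift fun ρ => pathClass (τ (ρ (stdSimplex.vertex 0)))

lemma closeUpClasses_comp_abelianizedPiToChains :
    closeUpClasses τ ≫ abelianizedPiToChains y₀ =
      𝟙 _ - (singularChains Y).fromOpcycles 1 0 ≫ tailClasses τ := by
  rw [← cancel_epi ((singularChains Y).pOpcycles 1)]
  refine chains_hom_ext fun ρ => ?_
  change (abelianizedPiToChains y₀).hom ((closeUpClasses τ).hom (simplexClass ρ)) =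
    simplexClass ρ - (tailClasses τ).hom
      (((singularChains Y).fromOpcycles 1 0).hom (simplexClass ρ))
  have simplexClass_eq : simplexClass ρ = pathClass (edgePath ρ) :=
    (congrArg simplexClass (edge_edgePath ρ)).symm
  have homotopyPathClass_eq : homotopyPathClass (.mk (edgePath ρ)) = pathClass (edgePath ρ) := rfl
  rw [closeUpClasses_simplexClass, abelianizedPiToChains_closeUp, simplexClass_eq,
    fromOpcycles_pathClass, map_sub, tailClasses, chainLift_simplexChain, chainLift_simplexChain,
    homotopyPathClass_eq]
  simp only [ContinuousMap.const_apply]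
  abel

/-- The Hurewicz isomorphism in degree one. -/
def hurewiczEquiv [PathConnectedSpace Y] (y₀ : Y) :
    Additive (Abelianization (FundamentalGroup Y y₀)) ≃+ H₁ Y :=
  let τ (y : Y) : Path y₀ y := PathConnectedSpace.somePath y₀ y
  (Iso.mk (hurewiczHom y₀) ((singularChains Y).homologyι 1 ≫ closeUpClasses τ)
    (by rw [← Category.assoc, hurewiczHom_comp_homologyι,
      abelianizedPiToChains_comp_closeUpClasses])
    (by
      rw [← cancel_mono ((singularChains Y).homologyι 1), Category.assoc, Category.assoc,
        hurewiczHom_comp_homologyι, closeUpClasses_comp_abelianizedPiToChains]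
      simp)).addCommGroupIsoToAddEquiv

end Hurewicz

end

noncomputable section

section TorsionCount

variable {A : Type*} [AddCommGroup A] {b : ℕ}

/-- The homomorphism `(ℤ/b)^ι → A` given by a family of elements killed by `b`. -/
def zmodCombination {ι : Type*} [Fintype ι] (δ : ι → A) (hδ : ∀ j, b • δ j = 0) :
    (ι → ZMod b) →+ A :=
  ∑ j, (ZMod.lift b ⟨zmultiplesHom A (δ j), by simp [hδ]⟩).comp (Pi.evalAddMonoidHom _ j)

lemma zmodCombination_intCast {ι : Type*} [Fintype ι] (δ : ι → A) (hδ : ∀ j, b • δ j = 0)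
    (v : ι → ℤ) : zmodCombination δ hδ (fun j => (v j : ZMod b)) = ∑ j, v j • δ j := by
  simp [zmodCombination, AddMonoidHom.finsetSum_apply]

lemma zmodCombination_injective {ι : Type*} [Fintype ι] [DecidableEq ι] (δ : ι → A)
    (hδ : ∀ j, b • δ j = 0) (c : ι → A →+ ZMod b) {β : ZMod b} (hβ : IsUnit β)
    (hc : ∀ i j, c i (δ j) = if i = j then β else 0) :
    Function.Injective (zmodCombination δ hδ) := by
  refine (injective_iff_map_eq_zero _).mpr fun v hv => funext fun i => ?_
  choose u hu using fun j => ZMod.intCast_surjective (v j)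
  obtain rfl : (fun j => (u j : ZMod b)) = v := funext hu
  have h := congrArg (c i) hv
  rw [zmodCombination_intCast, map_sum] at h
  simpa [hc, hβ.mul_left_eq_zero] using h

lemma eq_sum_sub_of_weight_eq_zero {n : ℕ} (hb : b ≠ 0) {ξ : A} {η : Fin (n + 1) → A} {e m : ℤ}
    (hm : m ≠ 0) (he : IsCoprime e b) (hrel : b • η 0 = e • ξ) (w : A →+ ℤ) (hwξ : w ξ = m * b)
    (hwη : ∀ i, w (η i) = m * e) {u : ℤ} {v : Fin (n + 1) → ℤ}
    (hw : w (u • ξ + ∑ j, v j • η j) = 0) :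
    u • ξ + ∑ j, v j • η j = ∑ j : Fin n, v j.succ • (η j.succ - η 0) := by
  have balance : u * b + (∑ j, v j) * e = 0 := by
    rw [map_add, map_zsmul, map_sum, hwξ] at hw
    simp only [map_zsmul, hwη, smul_eq_mul, ← Finset.sum_mul] at hw
    exact mul_left_cancel₀ hm (by linear_combination hw)
  obtain ⟨s, hs⟩ : (b : ℤ) ∣ ∑ j, v j :=
    he.symm.dvd_of_dvd_mul_right ⟨-u, by linear_combination balance⟩
  have hu : u = -(s * e) :=
    mul_right_cancel₀ (Int.natCast_ne_zero.mpr hb)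
      (by rw [hs] at balance; linear_combination balance)
  rw [hu, neg_smul, mul_smul, ← hrel, ← natCast_zsmul, ← mul_smul, mul_comm s, ← hs,
    Fin.sum_univ_succ, Fin.sum_univ_succ]
  simp only [smul_sub, Finset.sum_sub_distrib, add_smul, Finset.sum_smul]
  abel

theorem card_torsion_of_generators {n : ℕ} (hb : b ≠ 0) {ξ : A} {η : Fin (n + 1) → A} {e m : ℤ}
    (hm : m ≠ 0) (he : IsCoprime e b) (hspan : Submodule.span ℤ (insert ξ (Set.range η)) = ⊤)
    (hrel : ∀ i, b • η i = e • ξ) (w : A →+ ℤ) (hwξ : w ξ = m * b) (hwη : ∀ i, w (η i) = m * e)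
    (c : Fin (n + 1) → A →+ ZMod b) {α β : ZMod b} (hβ : IsUnit β)
    (hcη : ∀ i j, c i (η j) = α - if i = j then β else 0) :
    Nat.card (AddCommGroup.torsion A) = b ^ n := by
  let δ (j : Fin n) : A := η j.succ - η 0
  have hδ (j : Fin n) : b • δ j = 0 := by rw [smul_sub, hrel, hrel, sub_self]
  have c_δ (i j : Fin n) : c i.succ (δ j) = if i = j then -β else 0 := by
    rw [map_sub, hcη, hcη]
    split_ifs <;> simp_all
  have injective := zmodCombination_injective δ hδ (fun i => c i.succ) hβ.neg c_δ
  have range_eq : (zmodCombination δ hδ).range = AddCommGroup.torsion A := by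
    refine le_antisymm ?_ fun t ht => ?_
    · rintro _ ⟨v, rfl⟩
      refine isOfFinAddOrder_iff_nsmul_eq_zero.mpr ⟨b, Nat.pos_of_ne_zero hb, ?_⟩
      rw [← map_nsmul, show b • v = 0 by ext; simp, map_zero]
    · obtain ⟨k, k_pos, hk⟩ :=
        isOfFinAddOrder_iff_nsmul_eq_zero.mp (w.isOfFinAddOrder ht)
      have weight_eq_zero : w t = 0 := (smul_eq_zero_iff_right k_pos.ne').mp hk
      obtain ⟨u, s, hs, rfl⟩ := Submodule.mem_span_insert.mp (hspan ▸ Submodule.mem_top (x := t))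
      obtain ⟨v, rfl⟩ := (Submodule.mem_span_range_iff_exists_fun ℤ).mp hs
      rw [eq_sum_sub_of_weight_eq_zero hb hm he (hrel 0) w hwξ hwη weight_eq_zero,
        ← zmodCombination_intCast δ hδ]
      exact ⟨_, rfl⟩
  rw [← range_eq, ← Nat.card_congr (AddMonoidHom.ofInjective injective).toEquiv]
  rw [Nat.card_fun, Nat.card_zmod, Nat.card_fin]

end TorsionCount

lemma abelianClass_one (G : Type*) [Group G] : abelianClass (1 : G) = 0 :=
  congrArg Additive.ofMul (map_one Abelianization.of)

lemma abelianClass_inv {G : Type*} [Group G] (g : G) : abelianClass g⁻¹ = -abelianClass g :=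
  congrArg Additive.ofMul (map_inv Abelianization.of g)

lemma abelianClass_zpow {G : Type*} [Group G] (g : G) (i : ℤ) :
    abelianClass (g ^ i) = i • abelianClass g :=
  congrArg Additive.ofMul (map_zpow Abelianization.of g i)

/-- The additive homomorphism on the abelianization induced by a character. -/
def abelianLift {G B : Type*} [Group G] [AddCommGroup B] (f : G →* Multiplicative B) :
    Additive (Abelianization G) →+ B :=
  AddMonoidHom.toMultiplicativeRight.symm (Abelianization.lift f)

lemma abelianLift_abelianClass {G B : Type*} [Group G] [AddCommGroup B] (f : G →* Multiplicative B)
    (g : G) : abelianLift f (abelianClass g) = (f g).toAdd :=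
  rfl

/-- Generators of a group like those of the `(a, b)`-torus knot group: two elements with
`x ^ a = y ^ b` and a homomorphism to `ℤ` of the weights forced, up to scaling, by that relation.
The relation is not required to be defining. -/
structure TorusGenerators (G : Type*) [Group G] (a b : ℕ) where
  x : G
  y : G
  closure_eq_top : Subgroup.closure {x, y} = ⊤
  pow_eq_pow : x ^ a = y ^ b
  weight : G →* Multiplicative ℤ
  weight_x : (weight x).toAdd = b
  weight_y : (weight y).toAdd = a

namespace TorusGenerators

variable {G : Type*} [Group G] {a b : ℕ} (S : TorusGenerators G a b)

/-- The subgroup of elements of weight divisible by `m`. -/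
def divKer (m : ℕ) : Subgroup G :=
  (AddSubgroup.zmultiples (m : ℤ)).toSubgroup.comap S.weight

variable {S} in
lemma mem_divKer {m : ℕ} {g : G} : g ∈ S.divKer m ↔ (m : ℤ) ∣ (S.weight g).toAdd :=
  Int.mem_zmultiples_iff

lemma hom_eq_mul_weight {m : ℕ} (hmb : m.Coprime b) (φ : G →* Multiplicative (ZMod m)) :
    ∃ μ : ZMod m, ∀ g, (φ g).toAdd = μ * ((S.weight g).toAdd : ℤ) := by
  obtain ⟨β, hβ⟩ := (ZMod.isUnit_iff_coprime b m).mpr hmb.symm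
  have b_mul_inv : (b : ZMod m) * ↑β⁻¹ = 1 := by rw [← hβ, Units.mul_inv]
  have relation : (a : ZMod m) * (φ S.x).toAdd = b * (φ S.y).toAdd := by
    simpa using congrArg (fun g => (φ g).toAdd) S.pow_eq_pow
  refine ⟨(φ S.x).toAdd * ↑β⁻¹, fun g => ?_⟩
  induction S.closure_eq_top ▸ Subgroup.mem_top g using Subgroup.closure_induction with
  | mem z hz =>
    rcases hz with rfl | rfl
    · rw [S.weight_x]
      push_cast
      linear_combination (-(φ S.x).toAdd) * b_mul_inv
    · rw [S.weight_y]
      push_cast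
      linear_combination (-(φ S.y).toAdd) * b_mul_inv - ↑β⁻¹ * relation
  | one => simp
  | mul g h _ _ hg hh =>
    rw [map_mul φ, map_mul S.weight, toAdd_mul, toAdd_mul, hg, hh]
    push_cast
    ring
  | inv g _ hg =>
    rw [map_inv φ, map_inv S.weight, toAdd_inv, toAdd_inv, hg]
    push_cast
    ring

lemma ker_eq_divKer {m : ℕ} (hmb : m.Coprime b) {φ : G →* Multiplicative (ZMod m)}
    (hφ : Function.Surjective φ) : φ.ker = S.divKer m := by
  obtain ⟨μ, hμ⟩ := S.hom_eq_mul_weight hmb φ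
  have isUnit_μ : IsUnit μ := by
    obtain ⟨g, hg⟩ := hφ (Multiplicative.ofAdd 1)
    exact IsUnit.of_mul_eq_one _ ((hμ g).symm.trans (congrArg Multiplicative.toAdd hg))
  ext g
  rw [MonoidHom.mem_ker, mem_divKer, ← ZMod.intCast_zmod_eq_zero_iff_dvd,
    ← isUnit_μ.mul_right_eq_zero, ← hμ]
  rfl

lemma weight_x_zpow (i : ℤ) : (S.weight (S.x ^ i)).toAdd = i * b := by
  rw [map_zpow, toAdd_zpow, S.weight_x, smul_eq_mul]

lemma weight_conj (g h : G) : S.weight (h * g * h⁻¹) = S.weight g := by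
  rw [map_mul, map_mul, map_inv, mul_right_comm, mul_inv_cancel, one_mul]

lemma commute_x_zpow_y : Commute (S.x ^ (a : ℤ)) S.y := by
  rw [zpow_natCast, S.pow_eq_pow]
  exact (Commute.refl S.y).pow_left b

section Shift

-- The shift `k` satisfies `b * k ≡ a` modulo `m`.
variable {m : ℕ} {k e : ℤ}

/-- The power `x ^ m` as an element of `divKer m`. -/
def xPow (m : ℕ) : S.divKer m :=
  ⟨S.x ^ (m : ℤ), by rw [mem_divKer, weight_x_zpow]; exact dvd_mul_right _ _⟩

lemma weight_shifted (hke : (a : ℤ) - k * b = m * e) (i : ℤ) :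
    (S.weight (S.x ^ i * S.y * S.x ^ (-k - i))).toAdd = m * e := by
  rw [map_mul S.weight, map_mul S.weight, toAdd_mul, toAdd_mul, weight_x_zpow, weight_x_zpow,
    S.weight_y]
  linear_combination hke

/-- The element `x ^ i * y * x ^ (-k - i)` of `divKer m`. -/
def shiftedY (hke : (a : ℤ) - k * b = m * e) (i : ℤ) : S.divKer m :=
  ⟨S.x ^ i * S.y * S.x ^ (-k - i), by
    rw [mem_divKer, S.weight_shifted hke]; exact dvd_mul_right _ _⟩

variable (hke : (a : ℤ) - k * b = m * e)

lemma shiftedY_add_a (i : ℤ) : S.shiftedY hke (i + a) = S.shiftedY hke i := by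
  refine Subtype.ext ?_
  change S.x ^ (i + a) * S.y * S.x ^ (-k - (i + a)) = S.x ^ i * S.y * S.x ^ (-k - i)
  have exponent : -k - (i + (a : ℤ)) = -a + (-k - i) := by ring
  rw [exponent, zpow_add, zpow_add S.x (-(a : ℤ)), mul_assoc (S.x ^ i), S.commute_x_zpow_y.eq,
    zpow_neg]
  group

lemma shiftedY_add_m (i : ℤ) :
    S.shiftedY hke (i + m) = S.xPow m * S.shiftedY hke i * (S.xPow m)⁻¹ := by
  refine Subtype.ext ?_
  change S.x ^ (i + m) * S.y * S.x ^ (-k - (i + m)) =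
    S.x ^ (m : ℤ) * (S.x ^ i * S.y * S.x ^ (-k - i)) * (S.x ^ (m : ℤ))⁻¹
  group

lemma abelianClass_shiftedY_congr {i j : ℤ} (h : (a.gcd m : ℤ) ∣ j - i) :
    abelianClass (S.shiftedY hke j) = abelianClass (S.shiftedY hke i) := by
  have periodic_a : Function.Periodic (fun i => abelianClass (S.shiftedY hke i)) (a : ℤ) :=
    fun i => congrArg abelianClass (S.shiftedY_add_a hke i)
  have periodic_m : Function.Periodic (fun i => abelianClass (S.shiftedY hke i)) (m : ℤ) :=
    fun i => by
      simp only [shiftedY_add_m, abelianClass_mul, abelianClass_inv]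
      abel
  obtain ⟨q, hq⟩ := h
  have shift : j = i + (q * a.gcdA m * a + q * a.gcdB m * m) := by
    rw [Nat.gcd_eq_gcd_ab] at hq
    linear_combination hq
  rw [shift, ← Int.cast_id (n := q * a.gcdA m), ← Int.cast_id (n := q * a.gcdB m)]
  exact (periodic_a.int_mul _).add_period (periodic_m.int_mul _) i

lemma gcd_dvd_shift (hke : (a : ℤ) - k * b = m * e) (hmb : IsCoprime (m : ℤ) b) :
    (a.gcd m : ℤ) ∣ k := by
  have gcd_dvd_a : (a.gcd m : ℤ) ∣ a := Int.natCast_dvd_natCast.mpr (Nat.gcd_dvd_left a m)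
  have gcd_dvd_m : (a.gcd m : ℤ) ∣ m := Int.natCast_dvd_natCast.mpr (Nat.gcd_dvd_right a m)
  have gcd_dvd_mul : (a.gcd m : ℤ) ∣ k * b := by
    rw [show k * b = a - m * e by linear_combination -hke]
    exact dvd_sub gcd_dvd_a (gcd_dvd_m.mul_right e)
  exact (hmb.of_isCoprime_of_dvd_left gcd_dvd_m).dvd_of_dvd_mul_right gcd_dvd_mul

-- `x ^ i * y ^ t * x ^ (-k * t - i)` is the product of the elements `shiftedY` at
-- `i`, `i + k`, …, `i + (t - 1) * k`.
lemma abelianClass_shifted_pow (hmb : IsCoprime (m : ℤ) b) (t : ℕ) (i : ℤ) (g : S.divKer m)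
    (hg : g.1 = S.x ^ i * S.y ^ t * S.x ^ (-(k * t) - i)) :
    abelianClass g = t • abelianClass (S.shiftedY hke i) := by
  induction t generalizing i g with
  | zero =>
    obtain rfl : g = 1 := Subtype.ext (by rw [hg]; simp)
    rw [zero_smul, abelianClass_one]
  | succ t ih =>
    have tail := ih (i + k) ((S.shiftedY hke i)⁻¹ * g) (by
      change (S.x ^ i * S.y * S.x ^ (-k - i))⁻¹ * g.1 = _
      rw [hg, pow_succ']
      push_cast
      group)
    rw [S.abelianClass_shiftedY_congr hke (i := i) (by simpa using gcd_dvd_shift hke hmb)] at tail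
    rw [succ_nsmul', ← tail, ← abelianClass_mul, mul_inv_cancel_left]

lemma nsmul_abelianClass_shiftedY (hmb : IsCoprime (m : ℤ) b) (i : ℤ) :
    b • abelianClass (S.shiftedY hke i) = e • abelianClass (S.xPow m) := by
  rw [← abelianClass_zpow, ← S.abelianClass_shifted_pow hke hmb b i (S.xPow m ^ e)]
  change (S.x ^ (m : ℤ)) ^ e = _
  rw [← zpow_mul, ← hke, ← S.pow_eq_pow]
  group

lemma exists_eq_mul_zpow (g : G) :
    ∃ κ : S.divKer m, abelianClass κ ∈
      Submodule.span ℤ (Set.range fun i => abelianClass (S.shiftedY hke i)) ∧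
      ∃ i : ℤ, g = κ * S.x ^ i := by
  have mem_span (i : ℤ) : abelianClass (S.shiftedY hke i) ∈
      Submodule.span ℤ (Set.range fun i => abelianClass (S.shiftedY hke i)) :=
    Submodule.subset_span ⟨i, rfl⟩
  induction S.closure_eq_top ▸ Subgroup.mem_top g using Subgroup.closure_induction_right with
  | one => exact ⟨1, by rw [abelianClass_one]; exact zero_mem _, 0, by simp⟩
  | mul_right g _ z hz ih =>
    obtain ⟨κ, hκ, i, rfl⟩ := ih
    rcases hz with rfl | rfl
    · exact ⟨κ, hκ, i + 1, by rw [zpow_add_one, mul_assoc]⟩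
    · refine ⟨κ * S.shiftedY hke i, ?_, i + k, ?_⟩
      · rw [abelianClass_mul]
        exact add_mem hκ (mem_span i)
      · change κ.1 * S.x ^ i * S.y = κ.1 * (S.x ^ i * S.y * S.x ^ (-k - i)) * S.x ^ (i + k)
        group
  | mul_inv_cancel g _ z hz ih =>
    obtain ⟨κ, hκ, i, rfl⟩ := ih
    rcases hz with rfl | rfl
    · exact ⟨κ, hκ, i - 1, by rw [zpow_sub_one, mul_assoc]⟩
    · refine ⟨κ * (S.shiftedY hke (i - k))⁻¹, ?_, i - k, ?_⟩
      · rw [abelianClass_mul, abelianClass_inv]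
        exact add_mem hκ (neg_mem (mem_span _))
      · change κ.1 * S.x ^ i * S.y⁻¹ =
          κ.1 * (S.x ^ (i - k) * S.y * S.x ^ (-k - (i - k)))⁻¹ * S.x ^ (i - k)
        group

lemma range_abelianClass_shiftedY {n : ℕ} (hn : a.gcd m = n + 1) :
    (Set.range fun i => abelianClass (S.shiftedY hke i)) =
      Set.range fun j : Fin (n + 1) => abelianClass (S.shiftedY hke j) := by
  refine subset_antisymm ?_ (Set.range_subset_iff.mpr fun j => ⟨j, rfl⟩)
  rintro _ ⟨i, rfl⟩
  have gcd_pos : (0 : ℤ) < a.gcd m := by omega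
  have emod_nonneg := Int.emod_nonneg i gcd_pos.ne'
  have emod_lt := Int.emod_lt_of_pos i gcd_pos
  refine ⟨⟨(i % a.gcd m).toNat, by omega⟩, S.abelianClass_shiftedY_congr hke ?_⟩
  simp only [Int.toNat_of_nonneg emod_nonneg]
  exact (dvd_sub_comm).mp Int.dvd_self_sub_emod

lemma span_abelianClass_eq_top (hmb : IsCoprime (m : ℤ) b) {n : ℕ} (hn : a.gcd m = n + 1) :
    Submodule.span ℤ (insert (abelianClass (S.xPow m))
      (Set.range fun j : Fin (n + 1) => abelianClass (S.shiftedY hke j))) = ⊤ := by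
  rw [← S.range_abelianClass_shiftedY hke hn]
  refine eq_top_iff.mpr fun t _ => ?_
  obtain ⟨g, rfl⟩ := exists_abelianClass_eq t
  obtain ⟨κ, hκ, i, hi⟩ := S.exists_eq_mul_zpow hke g.1
  obtain ⟨q, rfl⟩ : (m : ℤ) ∣ i := by
    have dvd_weight := dvd_sub (mem_divKer.mp g.2) (mem_divKer.mp κ.2)
    rw [hi, map_mul, toAdd_mul, weight_x_zpow, add_sub_cancel_left] at dvd_weight
    exact hmb.dvd_of_dvd_mul_right dvd_weight
  obtain rfl : g = κ * S.xPow m ^ q := Subtype.ext (by rw [hi, zpow_mul]; rfl)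
  rw [abelianClass_mul, abelianClass_zpow]
  exact add_mem (Submodule.span_mono (Set.subset_insert _ _) hκ)
    (Submodule.smul_mem _ q (Submodule.subset_span (Set.mem_insert _ _)))

end Shift

/-- A character of `divKer N` that is trivial on `x ^ N` and singles out `y` among its conjugates by
powers of `x`: it is `α - β` on `x ^ i * y * x ^ (-i)` if `N ∣ i` and `α` otherwise. -/
structure SeparatingCharacter (N : ℕ) where
  character : S.divKer N →* Multiplicative (ZMod b)
  α : ZMod b
  β : ZMod b
  isUnit_β : IsUnit β
  map_x_pow : ∀ g : S.divKer N, g.1 = S.x ^ N → character g = 1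
  map_conj_y : ∀ (i : ℤ) (g : S.divKer N), g.1 = S.x ^ i * S.y * S.x ^ (-i) →
    (character g).toAdd = α - if (N : ℤ) ∣ i then β else 0

namespace SeparatingCharacter

variable {S} {N m : ℕ} (c : S.SeparatingCharacter N)

/-- The restriction to `divKer m` of the separating character precomposed with conjugation by
`x ^ (-j)`. -/
def conj (hNm : (N : ℤ) ∣ m) (j : ℤ) : S.divKer m →* Multiplicative (ZMod b) :=
  c.character.comp (((MulAut.conj (S.x ^ (-j))).toMonoidHom.comp (S.divKer m).subtype).codRestrict
    (S.divKer N) fun g => mem_divKer.mpr <| by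
      change (N : ℤ) ∣ (S.weight (S.x ^ (-j) * g.1 * (S.x ^ (-j))⁻¹)).toAdd
      rw [S.weight_conj]
      exact hNm.trans (mem_divKer.mp g.2))

lemma conj_shiftedY (hNm : (N : ℤ) ∣ m) (hNa : (N : ℤ) ∣ a) {k e : ℤ} (hNk : (N : ℤ) ∣ k)
    (hke : (a : ℤ) - k * b = m * e) (i j : ℤ) :
    (c.conj hNm j (S.shiftedY hke i)).toAdd = c.α - if (N : ℤ) ∣ i - j then c.β else 0 := by
  obtain ⟨q, rfl⟩ := hNk
  let conjY : S.divKer N := ⟨S.x ^ (i - j) * S.y * S.x ^ (-(i - j)), by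
    rwa [mem_divKer, zpow_neg, S.weight_conj, S.weight_y]⟩
  have eq_mul : c.conj hNm j (S.shiftedY hke i) = c.character (conjY * S.xPow N ^ (-q)) := by
    refine congrArg c.character (Subtype.ext ?_)
    change S.x ^ (-j) * (S.x ^ i * S.y * S.x ^ (-(N * q) - i)) * (S.x ^ (-j))⁻¹ =
      S.x ^ (i - j) * S.y * S.x ^ (-(i - j)) * (S.x ^ (N : ℤ)) ^ (-q)
    rw [← zpow_mul]
    group
  rw [eq_mul, map_mul, map_zpow, c.map_x_pow (S.xPow N) (zpow_natCast _ _), one_zpow, mul_one,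
    c.map_conj_y (i - j) conjY rfl]

end SeparatingCharacter

theorem card_torsion_abelianization_divKer (hb : b ≠ 0) (hab : a.Coprime b) {m : ℕ} (hm : m ≠ 0)
    (hmb : m.Coprime b) (c : S.SeparatingCharacter (a.gcd m)) :
    Nat.card (AddCommGroup.torsion (Additive (Abelianization (S.divKer m)))) =
      b ^ (a.gcd m - 1) := by
  have isCoprime_mb : IsCoprime (m : ℤ) b := Nat.isCoprime_iff_coprime.mpr hmb
  obtain ⟨k, e, hke⟩ : ∃ k e : ℤ, (a : ℤ) - k * b = m * e := by
    obtain ⟨u, v, huv⟩ := isCoprime_mb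
    exact ⟨a * v, a * u, by linear_combination (-(a : ℤ)) * huv⟩
  have isCoprime_eb : IsCoprime e (b : ℤ) := by
    obtain ⟨u, v, huv⟩ := Nat.isCoprime_iff_coprime.mpr hab
    exact ⟨m * u, v + u * k, by linear_combination huv - u * hke⟩
  have gcd_dvd_a : (a.gcd m : ℤ) ∣ a := Int.natCast_dvd_natCast.mpr (Nat.gcd_dvd_left a m)
  have gcd_dvd_m : (a.gcd m : ℤ) ∣ m := Int.natCast_dvd_natCast.mpr (Nat.gcd_dvd_right a m)
  obtain ⟨n, hn⟩ := Nat.exists_eq_succ_of_ne_zero (Nat.gcd_ne_zero_right (m := a) hm)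
  have dvd_sub_iff (i j : Fin (n + 1)) : (a.gcd m : ℤ) ∣ (j : ℕ) - (i : ℕ) ↔ i = j := by
    refine ⟨fun h => ?_, by rintro rfl; simp⟩
    have := Int.eq_zero_of_abs_lt_dvd h (by rw [abs_lt]; omega)
    exact Fin.ext (by omega)
  rw [show a.gcd m - 1 = n by omega]
  refine card_torsion_of_generators hb (Int.natCast_ne_zero.mpr hm) isCoprime_eb
    (S.span_abelianClass_eq_top hke isCoprime_mb hn)
    (fun i => S.nsmul_abelianClass_shiftedY hke isCoprime_mb i)
    (abelianLift (S.weight.comp (S.divKer m).subtype)) (S.weight_x_zpow m)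
    (fun i => S.weight_shifted hke i) (fun j => abelianLift (c.conj gcd_dvd_m j))
    (α := c.α) c.isUnit_β (fun i j => ?_)
  rw [abelianLift_abelianClass,
    c.conj_shiftedY gcd_dvd_m gcd_dvd_a (gcd_dvd_shift hke isCoprime_mb) hke]
  simp only [dvd_sub_iff]

end TorusGenerators

end

noncomputable section

/-! ### Generation of the fundamental group by the pieces of an open cover -/

namespace BasedLoop

variable {X : Type*} [TopologicalSpace X] {x₀ : X} {H : Subgroup (FundamentalGroup X x₀)}

lemma closeUp_mem_of_forall_mem {τ : ∀ z : X, Path x₀ z} {W : Set X}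
    (hτ : ∀ z ∈ W, ∀ t, τ z t ∈ W)
    (hH : ∀ γ : Path x₀ x₀, (∀ t, γ t ∈ W) → FundamentalGroup.fromPath (.mk γ) ∈ H)
    {z z' : X} (γ : Path z z') (hγ : ∀ t, γ t ∈ W) : closeUp τ (.mk γ) ∈ H := by
  have hz : z ∈ W := by simpa using hγ 0
  have hz' : z' ∈ W := by simpa using hγ 1
  refine hH (((τ z).trans γ).trans (τ z').symm) (Set.range_subset_iff.mp ?_)
  rw [Path.trans_range, Path.trans_range, Path.symm_range]
  exact Set.union_subset (Set.union_subset (Set.range_subset_iff.mpr (hτ z hz))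
    (Set.range_subset_iff.mpr hγ)) (Set.range_subset_iff.mpr (hτ z' hz'))

lemma closeUp_subpath_zero_succ (τ : ∀ z : X, Path x₀ z) {z z' : X} (γ : Path z z')
    (t : ℕ → unitInterval) (k : ℕ) :
    closeUp τ (.mk (γ.subpath 0 (t (k + 1)))) =
      closeUp τ (.mk (γ.subpath (t k) (t (k + 1)))) * closeUp τ (.mk (γ.subpath 0 (t k))) := by
  rw [← closeUp_trans, ← Path.Homotopic.Quotient.mk_trans,
    Path.Homotopic.Quotient.eq.mpr ⟨Path.Homotopy.subpathTransSubpath γ _ _ _⟩]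

lemma closeUp_mem_of_open_cover {ι : Type*} {U : ι → Set X} (hU : ∀ i, IsOpen (U i))
    (hcover : ∀ z, ∃ i, z ∈ U i) {τ : ∀ z : X, Path x₀ z}
    (hτ : ∀ i, ∀ z ∈ U i, ∀ t, τ z t ∈ U i)
    (hH : ∀ i, ∀ γ : Path x₀ x₀, (∀ t, γ t ∈ U i) → FundamentalGroup.fromPath (.mk γ) ∈ H)
    {z z' : X} (γ : Path z z') : closeUp τ (.mk γ) ∈ H := by
  obtain ⟨t, t_zero, t_mono, ⟨n, t_eventually⟩, ht⟩ :=
    exists_monotone_Icc_subset_open_cover_unitInterval (c := fun i => γ ⁻¹' U i)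
      (fun i => (hU i).preimage γ.continuous) (fun s _ => Set.mem_iUnion.mpr (hcover (γ s)))
  have mem_of_subpath (k : ℕ) : closeUp τ (.mk (γ.subpath 0 (t k))) ∈ H := by
    induction k with
    | zero =>
      rw [t_zero, Path.subpath_self, Path.Homotopic.Quotient.mk_refl, closeUp_refl]
      exact H.one_mem
    | succ k ih =>
      obtain ⟨i, hi⟩ := ht k
      rw [closeUp_subpath_zero_succ]
      refine H.mul_mem (closeUp_mem_of_forall_mem (hτ i) (hH i) _ (Set.range_subset_iff.mp ?_)) ih
      rwa [Path.range_subpath_of_le _ _ _ (t_mono k.le_succ), Set.image_subset_iff]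
  have := mem_of_subpath n
  rwa [t_eventually n le_rfl, Path.subpath_zero_one, closeUp_cast] at this

lemma exists_path_forall_mem {U V : Set X} (hU : IsPathConnected U) (hV : IsPathConnected V)
    (hUV : IsPathConnected (U ∩ V)) (hx : x₀ ∈ U ∩ V) {z : X} (hz : z ∈ U ∪ V) :
    ∃ τ : Path x₀ z, (z ∈ U → ∀ t, τ t ∈ U) ∧ (z ∈ V → ∀ t, τ t ∈ V) := by
  by_cases hzU : z ∈ U
  · by_cases hzV : z ∈ V
    · obtain ⟨τ, hτ⟩ := hUV.joinedIn x₀ hx z ⟨hzU, hzV⟩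
      exact ⟨τ, fun _ t => (hτ t).1, fun _ t => (hτ t).2⟩
    · obtain ⟨τ, hτ⟩ := hU.joinedIn x₀ hx.1 z hzU
      exact ⟨τ, fun _ => hτ, fun h => absurd h hzV⟩
  · obtain ⟨τ, hτ⟩ := hV.joinedIn x₀ hx.2 z (hz.resolve_left hzU)
    exact ⟨τ, fun h => absurd h hzU, fun _ => hτ⟩

theorem subgroup_eq_top_of_open_cover {U V : Set X} (hU : IsOpen U) (hV : IsOpen V)
    (hcover : U ∪ V = Set.univ) (hU' : IsPathConnected U) (hV' : IsPathConnected V)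
    (hUV' : IsPathConnected (U ∩ V)) (hx : x₀ ∈ U ∩ V)
    (hHU : ∀ γ : Path x₀ x₀, (∀ t, γ t ∈ U) → FundamentalGroup.fromPath (.mk γ) ∈ H)
    (hHV : ∀ γ : Path x₀ x₀, (∀ t, γ t ∈ V) → FundamentalGroup.fromPath (.mk γ) ∈ H) : H = ⊤ := by
  have mem_union (z : X) : z ∈ U ∪ V := hcover ▸ Set.mem_univ z
  choose τ hτU hτV using fun z => exists_path_forall_mem hU' hV' hUV' hx (mem_union z)
  refine (Subgroup.eq_top_iff' H).mpr fun g => ?_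
  obtain ⟨γ, rfl⟩ := Path.Homotopic.Quotient.mk_surjective g
  have tail_mem : FundamentalGroup.fromPath (.mk (τ x₀)) ∈ H := hHU _ (hτU x₀ hx.1)
  have closeUp_mem : closeUp τ (.mk γ) ∈ H :=
    closeUp_mem_of_open_cover (U := fun i : Bool => cond i U V) (Bool.forall_bool.mpr ⟨hV, hU⟩)
      (fun z => Bool.exists_bool.mpr (mem_union z).symm) (Bool.forall_bool.mpr ⟨hτV, hτU⟩)
      (Bool.forall_bool.mpr ⟨hHV, hHU⟩) γ
  rw [closeUp_eq_conj] at closeUp_mem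
  exact (H.mul_mem_cancel_right tail_mem).mp
    ((H.mul_mem_cancel_left (H.inv_mem tail_mem)).mp closeUp_mem)

end BasedLoop

/-! ### Covering spaces and their fundamental groups -/

lemma card_torsion_congr {A B : Type*} [AddCommGroup A] [AddCommGroup B] (e : A ≃+ B) :
    Nat.card (AddCommGroup.torsion A) = Nat.card (AddCommGroup.torsion B) :=
  Nat.card_congr (e.toEquiv.subtypeEquiv fun _ =>
    (Function.Injective.isOfFinAddOrder_iff (f := e.toAddMonoidHom) e.injective).symm)

lemma cardTorsionH₁_eq_card_torsion_abelianization {Y : Type} [TopologicalSpace Y]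
    [PathConnectedSpace Y] (y : Y) :
    cardTorsionH₁ Y =
      Nat.card (AddCommGroup.torsion (Additive (Abelianization (FundamentalGroup Y y)))) :=
  card_torsion_congr (Hurewicz.hurewiczEquiv y).symm

namespace CoveringSpace

open scoped unitInterval

section Basic

variable {E X S : Type*} [TopologicalSpace E] [TopologicalSpace X] [TopologicalSpace S] {p : E → X}

lemma locallyPathConnectedSpace_of_isLocalHomeomorph [LocallyPathConnectedSpace X]
    (hp : IsLocalHomeomorph p) : LocallyPathConnectedSpace E := by
  choose e he _ using hp
  let : ChartedSpace X E :=
    { atlas := Set.range e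
      chartAt := e
      mem_chart_source := he
      chart_mem_atlas := fun y => ⟨y, rfl⟩ }
  exact ChartedSpace.locallyPathConnectedSpace X E

lemma mapOfEq_injective (cov : IsCoveringMap p) {x : X} {e : E} (he : p e = x) :
    Function.Injective (FundamentalGroup.mapOfEq ⟨p, cov.continuous⟩ he) := by
  intro g g' h
  simp only [FundamentalGroup.mapOfEq_apply] at h
  refine cov.injective_path_homotopic_map _ _ ?_
  simpa using congrArg (fun q => Path.Homotopic.Quotient.cast q he he) h

lemma monodromy_mk (cov : IsCoveringMap p) {x y : X} (γ : Path x y) (e : p ⁻¹' {x}) (Γ : C(I, E))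
    (hΓ : ∀ t, p (Γ t) = γ t) (h0 : Γ 0 = e) : (cov.monodromy (.mk γ) e).1 = Γ 1 := by
  have eq_liftPath := (cov.eq_liftPath_iff' (γ := γ) (e := e.1) (γ.source.trans e.2.symm)
    (Γ := Γ)).mpr ⟨funext hΓ, h0⟩
  rw [eq_liftPath]
  rfl

lemma map_liftPath (cov : IsCoveringMap p) (γ : C(I, X)) (e : E) (h0 : γ 0 = p e) (t : I) :
    p (cov.liftPath γ e h0 t) = γ t :=
  congrFun (cov.liftPath_lifts γ e h0) t

lemma monodromyPerm_map (cov : IsCoveringMap p) {x₀ : X} (A : C(E, E)) (hA : ∀ e, p (A e) = p e)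
    (g : FundamentalGroup X x₀) (ε ε' : p ⁻¹' {x₀}) (h : ε'.1 = A ε.1) :
    (cov.monodromyPerm x₀ g ε').1 = A (cov.monodromyPerm x₀ g ε).1 := by
  obtain ⟨γ, rfl⟩ := Path.Homotopic.Quotient.mk_surjective g
  have h0 : γ 0 = p ε.1 := γ.source.trans ε.2.symm
  refine monodromy_mk cov γ ε' (A.comp (cov.liftPath γ ε.1 h0)) (fun t => ?_) ?_
  · rw [ContinuousMap.comp_apply, hA, map_liftPath cov]
    rfl
  · simp [h, cov.liftPath_zero]

lemma joined_monodromyPerm (cov : IsCoveringMap p) {x₀ : X} (g : FundamentalGroup X x₀)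
    (ε : p ⁻¹' {x₀}) : Joined ε.1 (cov.monodromyPerm x₀ g ε).1 :=
  let ⟨γ, _⟩ := Path.Homotopic.Quotient.mk_surjective (cov.liftPathQuotient g ε)
  ⟨γ⟩

lemma pathConnectedSpace_of_monodromyPerm [PathConnectedSpace X] (cov : IsCoveringMap p) (x₀ : X)
    (ε : p ⁻¹' {x₀}) (h : ∀ ε' : p ⁻¹' {x₀}, ∃ g, cov.monodromyPerm x₀ g ε = ε') :
    PathConnectedSpace E := by
  have joined (e : E) : Joined e ε.1 := by
    let γ := PathConnectedSpace.somePath (p e) x₀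
    let Γ := cov.liftPath γ e γ.source
    have joined_end : Joined e (Γ 1) := ⟨⟨Γ, cov.liftPath_zero .., rfl⟩⟩
    obtain ⟨g, hg⟩ := h ⟨Γ 1, (map_liftPath cov γ e γ.source 1).trans γ.target⟩
    have := joined_monodromyPerm cov g ε
    rw [hg] at this
    exact joined_end.trans this.symm
  exact ⟨⟨ε.1⟩, fun e e' => (joined e).trans (joined e').symm⟩

end Basic

section FiniteQuotient

variable {E Y : Type*} [TopologicalSpace E] [TopologicalSpace Y]

lemma isQuotientCoveringMap_of_finite {G : Type*} [Group G] [Finite G] [MulAction G E] [T2Space E]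
    [ContinuousConstSMul G E] {f : E → Y} (hfree : ∀ (g : G) (e : E), g • e = e → g = 1)
    (hc : Continuous f) (hs : Function.Surjective f) (hcl : IsClosedMap f)
    (horb : ∀ {e e' : E}, f e = f e' ↔ e ∈ MulAction.orbit G e') : IsQuotientCoveringMap f G where
  toIsQuotientMap := hcl.isQuotientMap hc hs
  continuous_const_smul := continuous_const_smul
  apply_eq_iff_mem_orbit := horb
  disjoint e := by
    have exists_moved_nhds (g : G) : ∃ U ∈ 𝓝 e, g ≠ 1 → ∀ y ∈ U, g • y ∉ U := by
      by_cases hg : g = 1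
      · exact ⟨Set.univ, Filter.univ_mem, fun h => absurd hg h⟩
      · obtain ⟨A, B, hA, hB, heA, heB, hAB⟩ := t2_separation (fun h => hg (hfree g e h))
        refine ⟨(g • ·) ⁻¹' A ∩ B, (((hA.preimage (continuous_const_smul g)).inter hB)).mem_nhds
          ⟨heA, heB⟩, fun _ y hy hy' => ?_⟩
        exact Set.disjoint_left.mp hAB hy.1 hy'.2
    choose U hU hU' using exists_moved_nhds
    refine ⟨⋂ g, U g, Filter.iInter_mem.mpr hU, fun g => ?_⟩
    rintro ⟨_, ⟨y, hy, rfl⟩, hy'⟩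
    by_contra hg
    exact hU' g hg y (Set.mem_iInter.mp hy g) (Set.mem_iInter.mp hy' g)

lemma isClosedMap_fst_of_isProperMap {A B : Type*} [TopologicalSpace A] [TopologicalSpace B]
    [T2Space B] {q : A → B} (hq : IsProperMap q) {r : Y → B} (hr : Continuous r) {C : Set (Y × A)}
    (hC : IsClosed C) (h : ∀ c ∈ C, q c.2 = r c.1) : IsClosedMap fun c : C => c.1.1 := by
  intro K hK
  have isClosed_image : IsClosed (Prod.map id q '' (Subtype.val '' K)) :=
    (isProperMap_id.prodMap hq).isClosedMap _ (hC.isClosedMap_subtype_val _ hK)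
  convert isClosed_image.preimage (continuous_id.prodMk hr) using 1
  ext y
  constructor
  · rintro ⟨c, hc, rfl⟩
    exact ⟨c.1, ⟨c, hc, rfl⟩, Prod.ext rfl (h _ c.2)⟩
  · rintro ⟨_, ⟨c, hc, rfl⟩, hy⟩
    exact ⟨c, hc, congrArg Prod.fst hy⟩

lemma isCoveringMap_comp {Z : Type*} [TopologicalSpace Z] [T2Space E] {f : E → Y} {g : Y → Z}
    (hf : IsLocalHomeomorph f) (hg : IsLocalHomeomorph g) (hfc : IsClosedMap f)
    (hgc : IsClosedMap g) (hff : ∀ y, (f ⁻¹' {y}).Finite) (hgf : ∀ z, (g ⁻¹' {z}).Finite) :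
    IsCoveringMap (g ∘ f) := by
  rw [isCoveringMap_iff_isCoveringMapOn_univ]
  refine (hgc.comp hfc).isCoveringMapOn_of_isLocalHomeomorphOn (fun z _ => ?_)
    fun e _ => (hg.comp hf) e
  rw [Set.preimage_comp]
  exact (hgf z).preimage' fun y _ => hff y

lemma finite_fiber_of_isQuotientCoveringMap {G : Type*} [Group G] [Finite G] [MulAction G E]
    {f : E → Y} (hf : IsQuotientCoveringMap f G) (y : Y) : (f ⁻¹' {y}).Finite := by
  obtain ⟨e, he⟩ := hf.surjective y
  exact Finite.of_equiv _ (hf.fiberEquivGroup ⟨e, he⟩).symm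

end FiniteQuotient

section ImageLoop

variable {X S : Type*} [TopologicalSpace X] [TopologicalSpace S] (θ : C(S, X)) {x₀ : X} {e₀ e : S}

/-- The class of the loop in `X` that is the image under `θ` of some path from `e₀` to `e`, two
points over `x₀`; it does not depend on the path when `S` is simply connected. -/
def imageLoop [PathConnectedSpace S] (h₀ : θ e₀ = x₀) (h : θ e = x₀) : FundamentalGroup X x₀ :=
  FundamentalGroup.fromPath
    (.mk (((PathConnectedSpace.somePath e₀ e).map θ.continuous).cast h₀.symm h.symm))

lemma monodromy_imageLoop [PathConnectedSpace S] {E : Type*} [TopologicalSpace E] {p : E → X}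
    (cov : IsCoveringMap p) (h₀ : θ e₀ = x₀) (h : θ e = x₀) (Θ : C(S, E))
    (hΘ : ∀ s, p (Θ s) = θ s) (ε : p ⁻¹' {x₀}) (hε : Θ e₀ = ε) :
    (cov.monodromyPerm x₀ (imageLoop θ h₀ h) ε).1 = Θ e := by
  refine (monodromy_mk cov _ ε (Θ.comp (PathConnectedSpace.somePath e₀ e)) (fun t => ?_)
    ?_).trans ?_
  · simp [hΘ]
  · simpa using hε
  · simp

lemma monodromyPerm_imageLoop_deck [PathConnectedSpace S] {E : Type*} [TopologicalSpace E]
    {p : E → X} (cov : IsCoveringMap p) (h₀ : θ e₀ = x₀) (T : C(S, S)) (hT : ∀ s, θ (T s) = θ s)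
    (A : C(E, E)) (hA : ∀ e, p (A e) = p e) (Θ : C(S, E)) (hΘ : ∀ s, p (Θ s) = θ s) {ε : p ⁻¹' {x₀}}
    (hε : Θ e₀ = ε.1) {q : S} (hq : Θ (T q) = A (Θ q)) :
    (cov.monodromyPerm x₀ (imageLoop θ h₀ ((hT e₀).trans h₀)) ε).1 = A ε.1 := by
  have lift_deck := cov.eq_of_comp_eq (Θ.comp T).continuous (A.comp Θ).continuous
    (funext fun s => by simp [hΘ, hT, hA]) q hq
  rw [← hε]
  exact (monodromy_imageLoop θ cov h₀ _ Θ hΘ ε hε).trans (congrFun lift_deck e₀)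

variable [SimplyConnectedSpace S]

lemma imageLoop_eq (h₀ : θ e₀ = x₀) (h : θ e = x₀) (γ : Path x₀ x₀) (Γ : Path e₀ e)
    (hΓ : ∀ t, θ (Γ t) = γ t) : imageLoop θ h₀ h = FundamentalGroup.fromPath (.mk γ) := by
  have γ_eq : γ = (Γ.map θ.continuous).cast h₀.symm h.symm := by
    ext t
    exact (hΓ t).symm
  rw [γ_eq]
  subst h₀
  obtain ⟨F⟩ := (SimplyConnectedSpace.paths_homotopic (PathConnectedSpace.somePath e₀ e) Γ).map θ
  exact congrArg FundamentalGroup.fromPath (Path.Homotopic.Quotient.eq.mpr ⟨F.cast rfl rfl⟩)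

lemma imageLoop_self (h₀ : θ e₀ = x₀) : imageLoop θ h₀ h₀ = 1 :=
  imageLoop_eq θ h₀ h₀ (Path.refl x₀) (Path.refl e₀) fun _ => h₀

lemma imageLoop_mul (h₀ : θ e₀ = x₀) (h : θ e = x₀) (T : C(S, S)) (hT : ∀ s, θ (T s) = θ s) :
    imageLoop θ h₀ ((hT e).trans h) =
      imageLoop θ h₀ h * imageLoop θ h₀ ((hT e₀).trans h₀) := by
  refine imageLoop_eq θ h₀ ((hT e).trans h)
    ((((PathConnectedSpace.somePath e₀ (T e₀)).map θ.continuous).cast h₀.symm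
        ((hT e₀).trans h₀).symm).trans
      (((PathConnectedSpace.somePath e₀ e).map θ.continuous).cast h₀.symm h.symm))
    ((PathConnectedSpace.somePath e₀ (T e₀)).trans
      ((PathConnectedSpace.somePath e₀ e).map T.continuous)) fun t => ?_
  simp only [Path.trans_apply]
  split_ifs <;> simp [hT]

lemma imageLoop_zpow (h₀ : θ e₀ = x₀) (T : ℤ → C(S, S)) (hT : ∀ k s, θ (T k s) = θ s)
    (hadd : ∀ k l s, T (k + l) s = T k (T l s)) (hzero : ∀ s, T 0 s = s) (k : ℤ) :
    imageLoop θ h₀ ((hT k e₀).trans h₀) = imageLoop θ h₀ ((hT 1 e₀).trans h₀) ^ k := by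
  let loopHom : Multiplicative ℤ →* FundamentalGroup X x₀ :=
    { toFun := fun k => imageLoop θ h₀ ((hT k.toAdd e₀).trans h₀)
      map_one' := by
        refine Eq.trans ?_ (imageLoop_self θ h₀)
        simp [hzero]
      map_mul' := fun k l => by
        rw [← imageLoop_mul θ h₀ _ (T l.toAdd) (hT _)]
        congr 1
        rw [toAdd_mul, add_comm, hadd] }
  have := loopHom.map_zpow (Multiplicative.ofAdd 1) k
  rwa [← ofAdd_zsmul, smul_eq_mul, mul_one] at this

end ImageLoop

end CoveringSpace

namespace CyclicCover

variable {X : Type} [TopologicalSpace X] {m : ℕ} (C : CyclicCover m X)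

lemma isQuotientCoveringMap : IsQuotientCoveringMap C.proj (Multiplicative (ZMod m)) := by
  refine (isQuotientCoveringMap_iff_isCoveringMap_and _ _).mpr ⟨C.isCoveringMap, C.surjective,
    ⟨fun g => C.continuous_vadd g.toAdd⟩, ?_, ?_⟩
  · exact isCancelSMul_iff_eq_one_of_smul_eq.mpr fun g x h =>
      congrArg Multiplicative.ofAdd (C.free g.toAdd x h)
  · intro y z
    rw [eq_comm, C.proj_eq_iff]
    rfl

theorem exists_surjective_cardTorsionH₁_eq [LocallyPathConnectedSpace X] (x₀ : X) :
    ∃ φ : FundamentalGroup X x₀ →* Multiplicative (ZMod m), Function.Surjective φ ∧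
      cardTorsionH₁ C.space =
        Nat.card (AddCommGroup.torsion (Additive (Abelianization φ.ker))) := by
  have hq := C.isQuotientCoveringMap
  have := CoveringSpace.locallyPathConnectedSpace_of_isLocalHomeomorph
    C.isCoveringMap.isLocalHomeomorph
  have : PathConnectedSpace C.space := pathConnectedSpace_iff_connectedSpace.mpr inferInstance
  obtain ⟨y, hy⟩ := C.surjective x₀
  let e : C.proj ⁻¹' {x₀} := ⟨y, hy⟩
  let φ : FundamentalGroup X x₀ →* Multiplicative (ZMod m) :=
    MulOpposite.opMulEquiv.symm.toMonoidHom.comp (hq.fundamentalGroupToMulOpposite e)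
  have ker_eq_range : φ.ker = (FundamentalGroup.mapOfEq ⟨C.proj, hq.continuous⟩ e.2).range := by
    rw [← hq.ker_monodromyPerm, ← hq.ker_fundamentalGroupToMulOpposite e]
    ext g
    simp [φ, MonoidHom.mem_ker]
  refine ⟨φ, MulOpposite.opMulEquiv.symm.surjective.comp
    (hq.fundamentalGroupToMulOpposite_surjective e), ?_⟩
  rw [ker_eq_range, cardTorsionH₁_eq_card_torsion_abelianization y]
  exact card_torsion_congr (MulEquiv.toAdditive (MulEquiv.abelianizationCongr
    (MonoidHom.ofInjective (CoveringSpace.mapOfEq_injective C.isCoveringMap hy))))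

end CyclicCover

/-! ### Winding numbers -/

namespace Winding

open Complex (I)

lemma exists_continuous_log (f : C(unitInterval, {z : ℂ // z ≠ 0})) (l : ℂ)
    (hl : Complex.exp l = f 0) :
    ∃ F : C(unitInterval, ℂ), F 0 = l ∧ ∀ t, Complex.exp (F t) = f t := by
  have h0 : f 0 = (⟨_, Complex.exp_ne_zero l⟩ : {z : ℂ // z ≠ 0}) := Subtype.ext hl.symm
  exact ⟨Complex.isCoveringMap_exp.liftPath f l h0, Complex.isCoveringMap_exp.liftPath_zero ..,
    fun t => congrArg Subtype.val (CoveringSpace.map_liftPath Complex.isCoveringMap_exp f l h0 t)⟩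

/-- The identification of `2πiℤ`, the deck group of the exponential covering, with `ℤ`. -/
def expPeriodEquiv : AddSubgroup.zmultiples (2 * Real.pi * I) ≃+ ℤ :=
  ((AddMonoidHom.ofInjective (f := zmultiplesHom ℂ (2 * Real.pi * I)) 
    (smul_left_injective ℤ Complex.two_pi_I_ne_zero)).trans
      (AddEquiv.addSubgroupCongr (AddSubgroup.range_zmultiplesHom _))).symm

lemma coe_eq_mul_expPeriodEquiv (δ : AddSubgroup.zmultiples (2 * Real.pi * I)) :
    (δ : ℂ) = 2 * Real.pi * I * expPeriodEquiv δ := by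
  obtain ⟨n, rfl⟩ := expPeriodEquiv.symm.surjective δ
  rw [AddEquiv.apply_symm_apply]
  exact (zsmul_eq_mul (2 * Real.pi * I) n).trans (mul_comm _ _)

variable {X S : Type*} [TopologicalSpace X] [TopologicalSpace S] (f : C(X, {z : ℂ // z ≠ 0}))
  {x₀ : X}

variable (x₀) in
/-- The point over `f x₀` in the exponential covering given by the principal branch. -/
def logFiberPoint :
    (fun z : ℂ => (⟨_, z.exp_ne_zero⟩ : {z : ℂ // z ≠ 0})) ⁻¹' {f x₀} :=
  ⟨Complex.log (f x₀), Subtype.ext (Complex.exp_log (f x₀).2)⟩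

variable (x₀) in
/-- The winding number about zero of the image of a loop under a nowhere vanishing function, read
off from the monodromy of the exponential covering. -/
def winding : FundamentalGroup X x₀ →* Multiplicative ℤ :=
  expPeriodEquiv.toMultiplicative.toMonoidHom.comp (MulOpposite.opMulEquiv.symm.toMonoidHom.comp
    ((Complex.isAddQuotientCoveringMap_exp.fundamentalGroupToMulOpposite
      (logFiberPoint f x₀)).comp (FundamentalGroup.map f x₀)))

lemma lift_one_eq (γ : Path x₀ x₀) (F : C(unitInterval, ℂ))
    (hF : ∀ t, Complex.exp (F t) = f (γ t)) :
    F 1 = F 0 + 2 * Real.pi * I * (winding f x₀ (FundamentalGroup.fromPath (.mk γ))).toAdd := by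
  have hq := Complex.isAddQuotientCoveringMap_exp
  let δ := (hq.fundamentalGroupToMulOpposite (logFiberPoint f x₀)
    (FundamentalGroup.map f x₀ (FundamentalGroup.fromPath (.mk γ)))).unop.toAdd
  have exp_start : Complex.exp (F 0) = Complex.exp (Complex.log (f x₀)) := by
    rw [hF, γ.source, Complex.exp_log (f x₀).2]
  obtain ⟨m, hm⟩ := Complex.exp_eq_exp_iff_exists_int.mp exp_start
  have deck : (δ : ℂ) + Complex.log (f x₀) = F 1 - m * (2 * Real.pi * I) :=
    hq.unop_fundamentalGroupToMulOpposite_smul.trans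
      (CoveringSpace.monodromy_mk hq.isCoveringMap (γ.map f.continuous) (logFiberPoint f x₀)
        ⟨fun t => F t - m * (2 * Real.pi * I), by fun_prop⟩
        (fun t => Subtype.ext (by simp [Complex.exp_sub, hF, Complex.exp_int_mul_two_pi_mul_I]))
        (by simp [hm, logFiberPoint]))
  have : (δ : ℂ) = 2 * Real.pi * I *
      (winding f x₀ (FundamentalGroup.fromPath (.mk γ))).toAdd := coe_eq_mul_expPeriodEquiv δ
  linear_combination this - deck - hm

lemma winding_imageLoop [PathConnectedSpace S] (θ : C(S, X)) {e₀ e : S} (h₀ : θ e₀ = x₀)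
    (h : θ e = x₀) (F : C(S, ℂ)) (hF : ∀ s, Complex.exp (F s) = f (θ s)) (n : ℤ)
    (hn : F e = F e₀ + 2 * Real.pi * I * n) :
    (winding f x₀ (CoveringSpace.imageLoop θ h₀ h)).toAdd = n := by
  have := lift_one_eq f
    (((PathConnectedSpace.somePath e₀ e).map θ.continuous).cast h₀.symm h.symm)
    (F.comp (PathConnectedSpace.somePath e₀ e)) (fun t => by simp [hF])
  simp only [ContinuousMap.comp_apply, ContinuousMap.coe_coe, Path.target, Path.source, hn,
    add_right_inj] at this
  exact_mod_cast (mul_left_cancel₀ Complex.two_pi_I_ne_zero this).symm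

lemma isProperMap_pow {d : ℕ} (hd : d ≠ 0) : IsProperMap fun v : ℂ => v ^ d := by
  refine isProperMap_iff_tendsto_cocompact.mpr ⟨continuous_pow d, ?_⟩
  rw [← Metric.cobounded_eq_cocompact]
  exact tendsto_pow_cobounded_cobounded hd

lemma eq_of_pow_eq_one [PreconnectedSpace S] {N : ℕ} (hN : N ≠ 0) {h : S → ℂ} (hc : Continuous h)
    (h1 : ∀ s, h s ^ N = 1) (s s' : S) : h s = h s' := by
  have finite_range : (Set.range h).Finite := by
    refine ((Polynomial.nthRoots N (1 : ℂ)).toFinset.finite_toSet).subset ?_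
    rintro _ ⟨s, rfl⟩
    simpa [Polynomial.mem_nthRoots (Nat.pos_of_ne_zero hN)] using h1 s
  by_contra hne
  exact (isPreconnected_range hc).infinite_of_nontrivial ⟨_, ⟨s, rfl⟩, _, ⟨s', rfl⟩, hne⟩
    finite_range

lemma root_monodromyPerm {E : Type*} [TopologicalSpace E] {p : E → X} (cov : IsCoveringMap p)
    {N : ℕ} (hN : N ≠ 0) (u : C(E, ℂ)) (hu : ∀ e, u e ^ N = f (p e))
    (g : FundamentalGroup X x₀) (ε : p ⁻¹' {x₀}) :
    u (cov.monodromyPerm x₀ g ε).1 =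
      u ε.1 * Complex.exp (2 * Real.pi * I * (winding f x₀ g).toAdd / N) := by
  obtain ⟨γ, rfl⟩ := Path.Homotopic.Quotient.mk_surjective g
  have hN' : (N : ℂ) ≠ 0 := Nat.cast_ne_zero.mpr hN
  have h0 : γ 0 = p ε.1 := γ.source.trans ε.2.symm
  obtain ⟨F, -, hF⟩ := exists_continuous_log (f.comp γ) (Complex.log (f (γ 0)))
    (Complex.exp_log (f (γ 0)).2)
  have root_const := eq_of_pow_eq_one hN
    (h := fun t => u (cov.liftPath γ ε.1 h0 t) * Complex.exp (-(F t / N))) (by fun_prop)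
    (fun t => by
      rw [mul_pow, hu, CoveringSpace.map_liftPath cov, ← Complex.exp_nat_mul, mul_neg,
        mul_div_cancel₀ _ hN', Complex.exp_neg, hF]
      exact mul_inv_cancel₀ (f (γ t)).2) 1 0
  rw [cov.liftPath_zero, Complex.exp_neg, Complex.exp_neg,
    mul_inv_eq_iff_eq_mul₀ (Complex.exp_ne_zero _), mul_assoc, ← Complex.exp_neg,
    ← Complex.exp_add, lift_one_eq f γ F hF] at root_const
  refine root_const.trans ?_
  congr 2
  ring

end Winding

end

noncomputable section

/-! ### The exterior of a torus knot -/

namespace TorusKnot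

open Complex CoveringSpace Winding BasedLoop

/-- The point of the unit circle with argument `t`. -/
def rot (t : ℝ) : ℂ := exp (t * I)

@[fun_prop]
lemma continuous_rot : Continuous rot := by unfold rot; fun_prop

lemma rot_zero : rot 0 = 1 := by simp [rot]

lemma rot_pi : rot Real.pi = -1 := by simp [rot]

lemma rot_add (s t : ℝ) : rot (s + t) = rot s * rot t := by
  rw [rot, rot, rot, ← exp_add]
  push_cast
  ring_nf

lemma rot_pow (t : ℝ) (n : ℕ) : rot t ^ n = rot (n * t) := by
  rw [rot, rot, ← exp_nat_mul]
  push_cast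
  ring_nf

lemma rot_ne_zero (t : ℝ) : rot t ≠ 0 := exp_ne_zero _

lemma norm_rot (t : ℝ) : ‖rot t‖ = 1 := norm_exp_ofReal_mul_I t

lemma rot_int (k : ℤ) : rot (2 * Real.pi * k) = 1 := by
  rw [rot, exp_eq_one_iff]
  exact ⟨k, by push_cast; ring⟩

lemma rot_eq_rot_iff {s t : ℝ} : rot s = rot t ↔ ∃ k : ℤ, s = t + 2 * Real.pi * k := by
  rw [rot, rot, exp_eq_exp_iff_exists_int]
  refine exists_congr fun k => ⟨fun h => ?_, fun h => by rw [h]; push_cast; ring⟩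
  have : (s : ℂ) = ((t + 2 * Real.pi * k : ℝ) : ℂ) := by
    apply mul_right_cancel₀ I_ne_zero
    rw [h]; push_cast; ring
  exact_mod_cast this

lemma conj_rot (t : ℝ) : (starRingEnd ℂ) (rot t) * rot t = 1 := by
  rw [← normSq_eq_conj_mul_self, normSq_eq_norm_sq, norm_rot]; simp

lemma norm_mul_rot_arg (z : ℂ) : ‖z‖ * rot (arg z) = z := norm_mul_exp_arg_mul_I z

lemma ofReal_mul_mem_slitPlane {r : ℝ} (hr : 0 < r) {z : ℂ} :
    r * z ∈ slitPlane ↔ z ∈ slitPlane := by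
  simp [mem_slitPlane_iff, hr, hr.ne']

/-- The exterior of the torus knot in the sphere of radius `√2`, as the complement of a curve. -/
abbrev Exterior (a b : ℕ) : Type := {x : ℂ × ℂ // ‖x.1‖ ^ 2 + ‖x.2‖ ^ 2 = 2 ∧ x.2 ^ a ≠ x.1 ^ b}

variable (a b : ℕ)

/-- The defining equation of the knot, as a function on the exterior. -/
def defect : C(Exterior a b, {z : ℂ // z ≠ 0}) where
  toFun x := ⟨x.1.2 ^ a - x.1.1 ^ b, sub_ne_zero.mpr x.2.2⟩
  continuous_toFun := by fun_prop

/-- Exchange of the coordinates. -/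
def swap : C(Exterior b a, Exterior a b) where
  toFun x := ⟨x.1.swap, (add_comm _ _).trans x.2.1, x.2.2.symm⟩
  continuous_toFun := by fun_prop

/-- The modulus of the coordinate complementary to `ω`. -/
def radius (ω : ℂ) : ℝ := √(2 - ‖ω‖ ^ 2)

@[fun_prop]
lemma continuous_radius : Continuous radius := by unfold radius; fun_prop

lemma radius_pos {ω : ℂ} (h : ‖ω‖ ^ 2 < 2) : 0 < radius ω := Real.sqrt_pos.mpr (by linarith)

lemma radius_sq {ω : ℂ} (h : ‖ω‖ ^ 2 < 2) : radius ω ^ 2 = 2 - ‖ω‖ ^ 2 := Real.sq_sqrt (by linarith)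

lemma radius_mul_rot (ω : ℂ) (t : ℝ) : radius (ω * rot t) = radius ω := by
  simp [radius, norm_rot]

/-- The universal cover of the complement of a slit neighbourhood of the core `z = 0`: the point
`(s, ω)` stands for the translate by the parameter `s` of the circle action
`(z, w) ↦ (rot (a * s) * z, rot (b * s) * w)` of the point `(radius ω, ω)`. -/
def sheet : Set (ℝ × ℂ) := {q | ‖q.2‖ ^ 2 < 2 ∧ (radius q.2 : ℂ) ^ b - q.2 ^ a ∈ slitPlane}

variable {a b}

lemma zero_mem_sheet (ha : a ≠ 0) : (0 : ℝ × ℂ) ∈ sheet a b := by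
  refine ⟨by simp, ?_⟩
  simp only [Prod.snd_zero, zero_pow ha, sub_zero, ← ofReal_pow]
  exact ofReal_mem_slitPlane.mpr (pow_pos (radius_pos (by simp)) b)

lemma starConvex_sheet (ha : a ≠ 0) : StarConvex ℝ 0 (sheet a b) := by
  rw [starConvex_zero_iff]
  rintro ⟨s, ω⟩ ⟨h1, h2⟩ t ht0 ht1
  simp only at h1 h2
  have hn : ‖(t : ℂ) * ω‖ ^ 2 ≤ ‖ω‖ ^ 2 := by
    rw [norm_mul, mul_pow, norm_real, Real.norm_eq_abs, sq_abs]
    have : t ^ 2 ≤ 1 := pow_le_one₀ ht0 ht1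
    nlinarith [sq_nonneg ‖ω‖]
  have hr : radius ω ^ b ≤ radius (t * ω) ^ b := by
    refine pow_le_pow_left₀ (Real.sqrt_nonneg _) (Real.sqrt_le_sqrt (by linarith)) b
  have hpos : 0 < radius ω ^ b := pow_pos (radius_pos h1) b
  rcases ht0.eq_or_lt with rfl | ht
  · simpa using zero_mem_sheet ha
  refine ⟨by simpa using hn.trans_lt h1, ?_⟩
  simp only [Prod.smul_mk, real_smul, mul_pow]
  simp only [mem_slitPlane_iff, ← ofReal_pow, sub_re, sub_im, ofReal_re, ofReal_im, re_ofReal_mul,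
    im_ofReal_mul, zero_sub, neg_ne_zero] at h2 ⊢
  have hta : 0 < t ^ a := pow_pos ht a
  refine h2.imp (fun hre => ?_) (mul_ne_zero hta.ne')
  have hta1 : t ^ a ≤ 1 := pow_le_one₀ ht0 ht1
  rcases le_or_gt (ω ^ a).re 0 with hω | hω <;> nlinarith [hω]

instance [NeZero a] : SimplyConnectedSpace (sheet a b) :=
  have := (starConvex_sheet (b := b) (NeZero.ne a)).contractibleSpace
    ⟨0, zero_mem_sheet (NeZero.ne a)⟩
  inferInstance

lemma isOpen_sheet : IsOpen (sheet a b) := by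
  have isOpen_disc : IsOpen {q : ℝ × ℂ | ‖q.2‖ ^ 2 < 2} := isOpen_lt (by fun_prop) (by fun_prop)
  have hc : Continuous fun q : ℝ × ℂ => (radius q.2 : ℂ) ^ b - q.2 ^ a := by fun_prop
  exact isOpen_disc.inter (isOpen_slitPlane.preimage hc)

instance : LocallyPathConnectedSpace (sheet a b) := isOpen_sheet.locallyPathConnectedSpace

lemma monomial_sub_monomial (s : ℝ) (ω : ℂ) : (ω * rot (b * s)) ^ a - (radius ω * rot (a * s)) ^ b =
    - (rot (a * b * s) * (radius ω ^ b - ω ^ a)) := by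
  rw [mul_pow, mul_pow, rot_pow, rot_pow]
  ring_nf

variable (a b) in
/-- The covering map from the sheet onto the complement of a slit neighbourhood of the core
`z = 0`. -/
def sheetMap : C(sheet a b, Exterior a b) where
  toFun q := ⟨(radius q.1.2 * rot (a * q.1.1), q.1.2 * rot (b * q.1.1)), by
    simp [norm_rot, radius_sq q.2.1], by
      rw [← sub_ne_zero, monomial_sub_monomial]
      exact neg_ne_zero.mpr (mul_ne_zero (rot_ne_zero _) (slitPlane_ne_zero q.2.2))⟩
  continuous_toFun := by fun_prop

lemma rot_deck_pow [NeZero a] (k : ℤ) : rot (-(2 * Real.pi * k * b / a)) ^ a = 1 := by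
  have ha : (a : ℝ) ≠ 0 := NeZero.ne _
  rw [rot_pow, ← rot_int (-(k * b))]
  congr 1
  push_cast
  field_simp

variable (a b) in
/-- The deck transformations of the sheet. -/
def sheetDeck [NeZero a] (k : ℤ) : C(sheet a b, sheet a b) where
  toFun q := ⟨(q.1.1 + 2 * Real.pi * k / a, q.1.2 * rot (-(2 * Real.pi * k * b / a))), by
    refine ⟨by simpa [norm_rot] using q.2.1, ?_⟩
    simpa [radius_mul_rot, mul_pow, rot_deck_pow] using q.2.2⟩
  continuous_toFun := by fun_prop

lemma sheetMap_sheetDeck [NeZero a] (k : ℤ) (q : sheet a b) :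
    sheetMap a b (sheetDeck a b k q) = sheetMap a b q := by
  have ha : (a : ℝ) ≠ 0 := NeZero.ne _
  refine Subtype.ext (Prod.ext ?_ ?_)
  · change (radius (q.1.2 * _) : ℂ) * rot (a * (q.1.1 + 2 * Real.pi * k / a)) =
        radius q.1.2 * rot (a * q.1.1)
    rw [radius_mul_rot, mul_add, mul_div_cancel₀ _ ha, rot_add, rot_int, mul_one]
  · change q.1.2 * rot _ * rot (b * (q.1.1 + 2 * Real.pi * k / a)) = q.1.2 * rot (b * q.1.1)
    rw [mul_assoc, ← rot_add]
    congr 2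
    ring

lemma sheetDeck_add [NeZero a] (k l : ℤ) (q : sheet a b) :
    sheetDeck a b (k + l) q = sheetDeck a b k (sheetDeck a b l q) := by
  refine Subtype.ext (Prod.ext ?_ ?_)
  · change _ + _ = _ + _ + _
    push_cast
    ring
  · change q.1.2 * rot _ = q.1.2 * rot _ * rot _
    rw [mul_assoc q.1.2, ← rot_add]
    congr 2
    push_cast
    ring

lemma sheetDeck_zero [NeZero a] (q : sheet a b) : sheetDeck a b 0 q = q :=
  Subtype.ext (Prod.ext (by simp [sheetDeck]) (by simp [sheetDeck, rot_zero]))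

lemma norm_sheetMap_fst (q : sheet a b) : ‖(sheetMap a b q).1.1‖ = radius q.1.2 := by
  simp [sheetMap, norm_rot, abs_of_pos (radius_pos q.2.1)]

lemma exists_sheetDeck_eq [NeZero a] {q q' : sheet a b} (h : sheetMap a b q' = sheetMap a b q) :
    ∃ k : ℤ, q' = sheetDeck a b k q := by
  have ha : (a : ℝ) ≠ 0 := NeZero.ne _
  have hr : radius q'.1.2 = radius q.1.2 := by rw [← norm_sheetMap_fst, ← norm_sheetMap_fst, h]
  have h1 : (radius q'.1.2 : ℂ) * rot (a * q'.1.1) = radius q.1.2 * rot (a * q.1.1) :=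
    congrArg (fun x => x.1.1) h
  have h2 : q'.1.2 * rot (b * q'.1.1) = q.1.2 * rot (b * q.1.1) := congrArg (fun x => x.1.2) h
  rw [hr] at h1
  obtain ⟨k, hk⟩ := rot_eq_rot_iff.mp
    (mul_left_cancel₀ (ofReal_ne_zero.mpr (radius_pos q.2.1).ne') h1)
  have hs : q'.1.1 = q.1.1 + 2 * Real.pi * k / a := by
    field_simp
    linarith
  refine ⟨k, Subtype.ext (Prod.ext hs ?_)⟩
  change q'.1.2 = q.1.2 * rot _
  apply mul_right_cancel₀ (rot_ne_zero (b * q'.1.1))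
  rw [h2, mul_assoc, ← rot_add, hs]
  congr 2
  ring

variable (a b) in
/-- The complement of a slit neighbourhood of the core `z = 0` in the exterior, which is the image
of the sheet: the slit consists of the points where `conj (z ^ b) * (z ^ b - w ^ a)` is a
nonpositive real number. -/
def slitExterior : Set (Exterior a b) :=
  {x | (starRingEnd ℂ) x.1.1 ^ b * (x.1.1 ^ b - x.1.2 ^ a) ∈ slitPlane}

lemma isOpen_slitExterior : IsOpen (slitExterior a b) := isOpen_slitPlane.preimage (by fun_prop)

lemma conj_pow_mul_sub (s r : ℝ) (ω : ℂ) :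
    (starRingEnd ℂ) (r * rot (a * s)) ^ b * ((r * rot (a * s)) ^ b - (ω * rot (b * s)) ^ a) =
      (r ^ b : ℝ) * (r ^ b - ω ^ a) := by
  have h_rot : rot (b * s) ^ a = rot (a * s) ^ b := by
    rw [rot_pow, rot_pow]
    ring_nf
  have h_conj : (starRingEnd ℂ) (rot (a * s)) ^ b * rot (a * s) ^ b = 1 := by
    rw [← mul_pow, conj_rot, one_pow]
  rw [map_mul, conj_ofReal, mul_pow, mul_pow, mul_pow, h_rot, ofReal_pow]
  linear_combination (r : ℂ) ^ b * (r ^ b - ω ^ a) * h_conj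

lemma sheetMap_mem (q : sheet a b) : sheetMap a b q ∈ slitExterior a b := by
  change (starRingEnd ℂ) (radius q.1.2 * rot (a * q.1.1)) ^ b *
    ((radius q.1.2 * rot (a * q.1.1)) ^ b - (q.1.2 * rot (b * q.1.1)) ^ a) ∈ slitPlane
  rw [conj_pow_mul_sub]
  exact (ofReal_mul_mem_slitPlane (pow_pos (radius_pos q.2.1) b)).mpr q.2.2

lemma fst_ne_zero_of_mem_slitExterior {x : Exterior a b} (hb : b ≠ 0) (hx : x ∈ slitExterior a b) :
    x.1.1 ≠ 0 := fun h => slitPlane_ne_zero hx (by simp [h, hb])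

lemma radius_mul_rot_eq_norm (x : Exterior a b) (t : ℝ) : radius (x.1.2 * rot t) = ‖x.1.1‖ := by
  rw [radius_mul_rot, radius, ← eq_sub_of_add_eq x.2.1, Real.sqrt_sq (norm_nonneg _)]

lemma mul_rot_neg_mul_rot (w : ℂ) (t : ℝ) : w * rot (-t) * rot t = w := by
  rw [mul_assoc, ← rot_add, neg_add_cancel, rot_zero, mul_one]

lemma mem_sheet_of_arg {x : Exterior a b} (hb : b ≠ 0) (hx : x ∈ slitExterior a b) {s : ℝ}
    (hs : x.1.1 = ‖x.1.1‖ * rot (a * s)) : (s, x.1.2 * rot (-(b * s))) ∈ sheet a b := by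
  have hz : 0 < ‖x.1.1‖ := norm_pos_iff.mpr (fst_ne_zero_of_mem_slitExterior hb hx)
  refine ⟨?_, ?_⟩
  · simp only [norm_mul, norm_rot, mul_one]
    nlinarith [x.2.1]
  · have h := conj_pow_mul_sub (a := a) (b := b) s ‖x.1.1‖ (x.1.2 * rot (-(b * s)))
    rw [← hs, mul_rot_neg_mul_rot] at h
    simp only [radius_mul_rot_eq_norm]
    rw [← ofReal_mul_mem_slitPlane (pow_pos hz b), ← h]
    exact hx

lemma sheetMap_of_arg {x : Exterior a b} (hb : b ≠ 0) (hx : x ∈ slitExterior a b) {s : ℝ}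
    (hs : x.1.1 = ‖x.1.1‖ * rot (a * s)) :
    sheetMap a b ⟨_, mem_sheet_of_arg hb hx hs⟩ = x := by
  refine Subtype.ext (Prod.ext ?_ (mul_rot_neg_mul_rot _ _))
  change (radius (x.1.2 * rot (-(b * s))) : ℂ) * rot (a * s) = _
  rw [radius_mul_rot_eq_norm, ← hs]

lemma range_sheetMap [NeZero a] (hb : b ≠ 0) : Set.range (sheetMap a b) = slitExterior a b := by
  refine Set.Subset.antisymm (Set.range_subset_iff.mpr sheetMap_mem) fun x hx => ?_
  have ha : (a : ℝ) ≠ 0 := NeZero.ne _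
  exact ⟨_, sheetMap_of_arg hb hx (s := arg x.1.1 / a) (by
    rw [mul_div_cancel₀ _ ha, norm_mul_rot_arg])⟩

lemma isPathConnected_slitExterior [NeZero a] (hb : b ≠ 0) :
    IsPathConnected (slitExterior a b) := by
  rw [← range_sheetMap hb]
  exact isPathConnected_range (sheetMap a b).continuous

-- The sheet coordinate `s` of a lift is a continuous logarithm of the first coordinate.
lemma exists_lift_sheetMap [NeZero a] (hb : b ≠ 0) (γ : C(unitInterval, Exterior a b))
    (hγ : ∀ t, γ t ∈ slitExterior a b) (q : sheet a b) (hq : sheetMap a b q = γ 0) :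
    ∃ Γ : C(unitInterval, sheet a b), Γ 0 = q ∧ ∀ t, sheetMap a b (Γ t) = γ t := by
  have ha : (a : ℝ) ≠ 0 := NeZero.ne _
  obtain ⟨L, hL0, hL⟩ := exists_continuous_log
    ⟨fun t => ⟨(γ t).1.1, fst_ne_zero_of_mem_slitExterior hb (hγ t)⟩, by fun_prop⟩
    (Real.log (radius q.1.2) + (a * q.1.1 : ℝ) * I) (by
      rw [exp_add, ← ofReal_exp, Real.exp_log (radius_pos q.2.1)]
      exact congrArg (fun x => x.1.1) hq)
  have hs (t) : (γ t).1.1 = ‖(γ t).1.1‖ * rot (a * ((L t).im / a)) := by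
    have h := hL t
    simp only [ContinuousMap.coe_mk] at h
    rw [mul_div_cancel₀ _ ha, ← h, norm_exp, rot, ofReal_exp, ← exp_add, re_add_im]
  refine ⟨⟨fun t => ⟨_, mem_sheet_of_arg hb (hγ t) (hs t)⟩, by fun_prop⟩, ?_, fun t =>
    sheetMap_of_arg hb (hγ t) (hs t)⟩
  have h0 : (L 0).im / a = q.1.1 := by
    rw [hL0, add_im, ofReal_im, im_ofReal_mul, I_im]
    field_simp
    ring
  refine Subtype.ext (Prod.ext h0 ?_)
  change (γ 0).1.2 * rot (-(b * ((L 0).im / a))) = q.1.2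
  rw [h0, ← hq]
  change q.1.2 * rot (b * q.1.1) * _ = _
  rw [mul_assoc, ← rot_add, add_neg_cancel, rot_zero, mul_one]

lemma exists_path_sheetDeck [NeZero a] (hb : b ≠ 0) {x₀ : Exterior a b} (γ : Path x₀ x₀)
    (hγ : ∀ t, γ t ∈ slitExterior a b) (q : sheet a b) (hq : sheetMap a b q = x₀) :
    ∃ (k : ℤ) (Γ : Path q (sheetDeck a b k q)), ∀ t, sheetMap a b (Γ t) = γ t := by
  obtain ⟨Γ, h0, hΓ⟩ := exists_lift_sheetMap hb γ.toContinuousMap hγ q (hq.trans γ.source.symm)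
  obtain ⟨k, hk⟩ := exists_sheetDeck_eq ((hΓ 1).trans (γ.target.trans hq.symm))
  exact ⟨k, ⟨Γ, h0, hk⟩, hΓ⟩

variable (a b) in
/-- A logarithm of the defining equation on the sheet. -/
def sheetLog : C(sheet a b, ℂ) where
  toFun q := (a * b * q.1.1 : ℝ) * I + Real.pi * I + log (radius q.1.2 ^ b - q.1.2 ^ a)
  continuous_toFun := by
    refine Continuous.add (by fun_prop) (Continuous.clog (by fun_prop) fun q => q.2.2)

lemma exp_sheetLog (q : sheet a b) : exp (sheetLog a b q) = defect a b (sheetMap a b q) := by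
  change exp _ = (q.1.2 * rot (b * q.1.1)) ^ a - (radius q.1.2 * rot (a * q.1.1)) ^ b
  rw [monomial_sub_monomial]
  simp only [sheetLog, ContinuousMap.coe_mk]
  rw [exp_add, exp_add, exp_pi_mul_I, exp_log (slitPlane_ne_zero q.2.2), rot]
  ring

lemma sheetLog_sheetDeck [NeZero a] (q : sheet a b) :
    sheetLog a b (sheetDeck a b 1 q) = sheetLog a b q + 2 * Real.pi * I * (b : ℤ) := by
  have ha : (a : ℂ) ≠ 0 := NeZero.ne _
  simp only [sheetLog, sheetDeck, ContinuousMap.coe_mk, radius_mul_rot, mul_pow, rot_deck_pow,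
    mul_one]
  push_cast
  field_simp
  ring

variable (a b) in
/-- The complement of a slit neighbourhood of the core `w = 0`. -/
def slitExterior' : Set (Exterior a b) := swap b a ⁻¹' slitExterior b a

lemma isOpen_slitExterior' : IsOpen (slitExterior' a b) :=
  isOpen_slitExterior.preimage (swap b a).continuous

lemma isPathConnected_slitExterior' [NeZero b] (ha : a ≠ 0) :
    IsPathConnected (slitExterior' a b) := by
  have : slitExterior' a b = swap a b '' slitExterior b a := by
    ext x
    exact ⟨fun h => ⟨_, h, rfl⟩, by rintro ⟨y, hy, rfl⟩; exact hy⟩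
  rw [this]
  exact (isPathConnected_slitExterior ha).image (swap a b).continuous

variable (a b) in
/-- The Hermitian pairing of the two monomials whose difference defines the knot. -/
def pairing (x : ℂ × ℂ) : ℂ := (starRingEnd ℂ) (x.1 ^ b) * x.2 ^ a

lemma mem_slitExterior {x : Exterior a b} :
    x ∈ slitExterior a b ↔
      (pairing a b x.1).re < normSq (x.1.1 ^ b) ∨ (pairing a b x.1).im ≠ 0 := by
  have : (starRingEnd ℂ) x.1.1 ^ b * (x.1.1 ^ b - x.1.2 ^ a) =
      normSq (x.1.1 ^ b) - pairing a b x.1 := by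
    rw [mul_sub, ← map_pow, ← normSq_eq_conj_mul_self, pairing]
  change _ ∈ slitPlane ↔ _
  rw [this, mem_slitPlane_iff]
  simp only [sub_re, sub_im, ofReal_re, ofReal_im, sub_pos, zero_sub, neg_ne_zero]

lemma mem_slitExterior' {x : Exterior a b} :
    x ∈ slitExterior' a b ↔
      (pairing a b x.1).re < normSq (x.1.2 ^ a) ∨ (pairing a b x.1).im ≠ 0 := by
  have h : pairing b a (swap b a x).1 = (starRingEnd ℂ) (pairing a b x.1) := by
    simp [pairing, swap, mul_comm]
  change swap b a x ∈ slitExterior b a ↔ _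
  rw [mem_slitExterior, h]
  simp [swap]

lemma two_mul_re_pairing_lt (x : Exterior a b) :
    2 * (pairing a b x.1).re < normSq (x.1.1 ^ b) + normSq (x.1.2 ^ a) := by
  have h := normSq_pos.mpr (sub_ne_zero.mpr x.2.2.symm)
  have e : (pairing a b x.1).re = (x.1.1 ^ b * (starRingEnd ℂ) (x.1.2 ^ a)).re := by
    rw [← conj_re]
    simp [pairing]
  rw [normSq_sub, ← e] at h
  linarith

lemma slitExterior_union : slitExterior a b ∪ slitExterior' a b = Set.univ := by
  refine Set.eq_univ_of_forall fun x => ?_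
  by_contra h
  rw [Set.mem_union, mem_slitExterior, mem_slitExterior'] at h
  push Not at h
  linarith [two_mul_re_pairing_lt x, h.1.1, h.2.1]

lemma mem_slitExterior_inter {x : Exterior a b} :
    x ∈ slitExterior a b ∩ slitExterior' a b ↔ -pairing a b x.1 ∈ slitPlane := by
  rw [Set.mem_inter_iff, mem_slitExterior, mem_slitExterior', mem_slitPlane_iff]
  have h1 := normSq_nonneg (x.1.1 ^ b)
  have h2 := normSq_nonneg (x.1.2 ^ a)
  have h3 : normSq (pairing a b x.1) = normSq (x.1.1 ^ b) * normSq (x.1.2 ^ a) := by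
    rw [pairing, normSq_mul, normSq_conj]
  rw [normSq_apply] at h3
  simp only [neg_re, neg_im, neg_ne_zero, neg_pos]
  by_cases him : (pairing a b x.1).im = 0
  · simp only [him, ne_eq, not_true_eq_false, or_false]
    refine ⟨fun h => ?_, fun h => ⟨by linarith, by linarith⟩⟩
    by_contra hre
    rw [him] at h3
    nlinarith [h.1, h.2]
  · simp [him]

lemma pow_ne_pow_of_neg_pairing_mem_slitPlane {x : ℂ × ℂ} (hx : -pairing a b x ∈ slitPlane) :
    x.2 ^ a ≠ x.1 ^ b := fun h => by
  rw [pairing, h, ← normSq_eq_conj_mul_self, ← ofReal_neg, ofReal_mem_slitPlane] at hx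
  linarith [normSq_nonneg (x.1 ^ b)]

lemma image_slitExterior_inter :
    Subtype.val '' (slitExterior a b ∩ slitExterior' a b) =
      {x : ℂ × ℂ | ‖x.1‖ ^ 2 + ‖x.2‖ ^ 2 = 2 ∧ -pairing a b x ∈ slitPlane} := by
  ext x
  constructor
  · rintro ⟨y, hy, rfl⟩
    exact ⟨y.2.1, mem_slitExterior_inter.mp hy⟩
  · exact fun hx => ⟨⟨x, hx.1, pow_ne_pow_of_neg_pairing_mem_slitPlane hx.2⟩,
      mem_slitExterior_inter.mpr hx.2, rfl⟩

lemma neg_rot_mem_slitPlane {φ : ℝ} (h : φ ∈ Set.Ioo 0 (2 * Real.pi)) : -rot φ ∈ slitPlane := by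
  have e : -rot φ = rot (φ - Real.pi) := by
    rw [← mul_left_inj' (rot_ne_zero Real.pi), ← rot_add, rot_pi]
    simp
  rw [e, rot, mem_slitPlane_iff_arg, arg_exp_mul_I,
    (toIocMod_eq_self _).mpr ⟨by linarith [h.1], by linarith [h.2]⟩]
  exact ⟨by linarith [h.2], exp_ne_zero _⟩

variable (a b) in
/-- The point with polar coordinates `d = (s, r, φ)`: here `r` is the modulus of the second
coordinate, and `φ` is the argument of the pairing of the two monomials. -/
def polarPoint (d : ℝ × ℝ × ℝ) : ℂ × ℂ :=
  (√(2 - d.2.1 ^ 2) * rot (a * d.1), d.2.1 * rot (b * d.1 + d.2.2 / a))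

/-- The polar coordinates of the points of both slit exteriors. -/
def polarDomain : Set (ℝ × ℝ × ℝ) := Set.univ ×ˢ Set.Ioo 0 √2 ×ˢ Set.Ioo 0 (2 * Real.pi)

lemma isPathConnected_polarDomain : IsPathConnected polarDomain :=
  (convex_univ.prod ((convex_Ioo _ _).prod (convex_Ioo _ _))).isPathConnected
    ⟨(0, 1, Real.pi), trivial, ⟨by simp, Real.lt_sqrt_of_sq_lt (by norm_num)⟩,
      ⟨Real.pi_pos, by linarith [Real.pi_pos]⟩⟩

lemma pairing_polarPoint [NeZero a] (s r φ : ℝ) :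
    pairing a b (polarPoint a b (s, r, φ)) = (√(2 - r ^ 2) ^ b * r ^ a : ℝ) * rot φ := by
  have ha : (a : ℝ) ≠ 0 := NeZero.ne _
  have h_pow : rot (b * s + φ / a) ^ a = rot (a * s) ^ b * rot φ := by
    rw [rot_pow, rot_pow, ← rot_add]
    congr 1
    field_simp
  have h_conj : (starRingEnd ℂ) (rot (a * s) ^ b) * rot (a * s) ^ b = 1 := by
    rw [map_pow, ← mul_pow, conj_rot, one_pow]
  simp only [pairing, polarPoint]
  rw [mul_pow, mul_pow, h_pow, map_mul, ← ofReal_pow, conj_ofReal]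
  push_cast
  linear_combination (√(2 - r ^ 2) : ℂ) ^ b * r ^ a * rot φ * h_conj

lemma polarPoint_mem [NeZero a] {d : ℝ × ℝ × ℝ} (hd : d ∈ polarDomain) :
    ‖(polarPoint a b d).1‖ ^ 2 + ‖(polarPoint a b d).2‖ ^ 2 = 2 ∧
      -pairing a b (polarPoint a b d) ∈ slitPlane := by
  obtain ⟨s, r, φ⟩ := d
  obtain ⟨-, hr, hφ⟩ := hd
  have hr2 : 0 < 2 - r ^ 2 := sub_pos.mpr ((Real.lt_sqrt hr.1.le).mp hr.2)
  constructor
  · simp only [polarPoint, norm_mul, norm_rot, norm_real, mul_one, Real.norm_eq_abs, sq_abs]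
    rw [Real.sq_sqrt hr2.le]
    ring
  · rw [pairing_polarPoint, ← mul_neg, ofReal_mul_mem_slitPlane
      (mul_pos (pow_pos (Real.sqrt_pos.mpr hr2) b) (pow_pos hr.1 a))]
    exact neg_rot_mem_slitPlane hφ

-- The angle `φ` is only determined modulo `2π`; Bézout's identity makes every representative
-- available.
lemma exists_polar_angles [NeZero a] (hab : a.Coprime b) (α β : ℝ) :
    ∃ s φ : ℝ, φ ∈ Set.Ico 0 (2 * Real.pi) ∧ rot (a * s) = rot α ∧
      rot (b * s + φ / a) = rot β := by
  have ha : (a : ℝ) ≠ 0 := NeZero.ne _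
  let ψ : ℝ := a * (β - b * (α / a))
  obtain ⟨m, hm, -⟩ := existsUnique_add_zsmul_mem_Ico Real.two_pi_pos ψ 0
  rw [zero_add, zsmul_eq_mul] at hm
  obtain ⟨k, l, hkl⟩ : ∃ k l : ℤ, m = a * l - b * k := by
    obtain ⟨i, j, hij⟩ := Nat.isCoprime_iff_coprime.mpr hab
    exact ⟨-(m * j), m * i, by linear_combination -m * hij⟩
  refine ⟨α / a + 2 * Real.pi * k / a, ψ + m * (2 * Real.pi), hm,
    rot_eq_rot_iff.mpr ⟨k, by field_simp⟩, rot_eq_rot_iff.mpr ⟨l, ?_⟩⟩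
  simp only [ψ, hkl]
  push_cast
  field_simp
  ring

lemma exists_polarPoint_eq [NeZero a] [NeZero b] (hab : a.Coprime b) {x : ℂ × ℂ}
    (hx : ‖x.1‖ ^ 2 + ‖x.2‖ ^ 2 = 2) (hx' : -pairing a b x ∈ slitPlane) :
    ∃ d ∈ polarDomain, polarPoint a b d = x := by
  have hne : pairing a b x ≠ 0 := neg_ne_zero.mp (slitPlane_ne_zero hx')
  have hz : 0 < ‖x.1‖ := norm_pos_iff.mpr fun h => hne (by simp [pairing, h, NeZero.ne b])
  have hw : 0 < ‖x.2‖ := norm_pos_iff.mpr fun h => hne (by simp [pairing, h, NeZero.ne a])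
  have hsqrt : √(2 - ‖x.2‖ ^ 2) = ‖x.1‖ := by
    rw [← eq_sub_of_add_eq hx, Real.sqrt_sq hz.le]
  obtain ⟨s, φ, hφ, h1, h2⟩ := exists_polar_angles hab (arg x.1) (arg x.2)
  have hpolar : polarPoint a b (s, ‖x.2‖, φ) = x := by
    refine Prod.ext ?_ ?_
    · simp only [polarPoint, h1, hsqrt, norm_mul_rot_arg]
    · simp only [polarPoint, h2, norm_mul_rot_arg]
  have hφ0 : φ ≠ 0 := fun h => by
    have hpair := pairing_polarPoint (a := a) (b := b) s ‖x.2‖ φ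
    rw [hpolar, h, hsqrt, rot_zero, mul_one] at hpair
    rw [hpair, ← ofReal_neg, ofReal_mem_slitPlane] at hx'
    linarith [mul_pos (pow_pos hz b) (pow_pos hw a)]
  exact ⟨_, ⟨trivial, ⟨hw, (Real.lt_sqrt hw.le).mpr (by nlinarith)⟩,
    lt_of_le_of_ne hφ.1 hφ0.symm, hφ.2⟩, hpolar⟩

lemma isPathConnected_slitExterior_inter [NeZero a] [NeZero b] (hab : a.Coprime b) :
    IsPathConnected (slitExterior a b ∩ slitExterior' a b) := by
  have h_image : polarPoint a b '' polarDomain =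
      Subtype.val '' (slitExterior a b ∩ slitExterior' a b) := by
    rw [image_slitExterior_inter]
    refine Set.Subset.antisymm (Set.image_subset_iff.mpr fun d hd => polarPoint_mem hd)
      fun x hx => exists_polarPoint_eq hab hx.1 hx.2
  have h_val : Topology.IsInducing (Subtype.val : Exterior a b → ℂ × ℂ) := .subtypeVal
  rw [h_val.isPathConnected_iff, ← h_image]
  exact isPathConnected_polarDomain.image (by unfold polarPoint; fun_prop)

lemma radius_rot (t : ℝ) : radius (rot t) = 1 := by
  rw [radius, norm_rot]
  norm_num

variable (a b) in
/-- The points of the sheet at which the two monomials of the knot equation have modulus `1` and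
are opposite to each other. -/
def sheetPoint (s : ℝ) {t : ℝ} (h : rot t ^ a = -1) : sheet a b :=
  ⟨(s, rot t), by simp [norm_rot], by
    simp only [radius_rot, h, ofReal_one, one_pow, sub_neg_eq_add]
    rw [← ofReal_one, ← ofReal_add, ofReal_mem_slitPlane]
    norm_num⟩

variable (a b) in
/-- The path in the sheet whose image in the exterior runs once through an orbit of the circle
action `(z, w) ↦ (rot (a * s) * z, rot (b * s) * w)`. -/
def orbitPath [NeZero a] (s : ℝ) {t : ℝ} (h : rot t ^ a = -1) :
    Path (sheetPoint a b s h) (sheetDeck a b a (sheetPoint a b s h)) where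
  toFun τ := sheetPoint a b (s + 2 * Real.pi * τ) h
  continuous_toFun := by unfold sheetPoint; fun_prop
  source' := by simp
  target' := by
    have ha : (a : ℝ) ≠ 0 := NeZero.ne _
    refine Subtype.ext (Prod.ext ?_ ?_)
    · simp only [sheetPoint, sheetDeck, ContinuousMap.coe_mk, Set.Icc.coe_one, mul_one,
        Int.cast_natCast, mul_div_cancel_right₀ _ ha]
    · have h1 : rot (-(2 * Real.pi * ((a : ℤ) : ℝ) * b / a)) = 1 := by
        rw [← rot_int (-b)]
        congr 1
        push_cast
        field_simp
      simp only [sheetPoint, sheetDeck, ContinuousMap.coe_mk, h1, mul_one]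

section Generators

variable (a b)

lemma rot_pi_div_pow [NeZero a] : rot (Real.pi / a) ^ a = -1 := by
  have ha : (a : ℝ) ≠ 0 := NeZero.ne _
  rw [rot_pow, mul_div_cancel₀ _ ha, rot_pi]

lemma rot_neg_pi_div_pow [NeZero a] : rot (-(Real.pi / a)) ^ a = -1 := by
  have ha : (a : ℝ) ≠ 0 := NeZero.ne _
  have h : rot (-Real.pi) = -1 := by
    rw [← mul_left_inj' (rot_ne_zero Real.pi), ← rot_add, rot_pi]
    simp [rot_zero]
  rw [rot_pow, mul_neg, mul_div_cancel₀ _ ha, h]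

/-- The base point of the exterior. -/
def basePt [NeZero a] : Exterior a b :=
  ⟨(1, rot (Real.pi / a)), by simp [norm_rot]; norm_num, by
    rw [rot_pi_div_pow, one_pow]
    norm_num⟩

/-- A preimage of the base point in the first sheet. -/
def sheetPt [NeZero a] : sheet a b := sheetPoint a b 0 (rot_pi_div_pow a)

/-- A preimage of the base point in the second sheet. -/
def sheetPt' [NeZero b] : sheet b a := sheetPoint b a (Real.pi / (a * b)) (rot_neg_pi_div_pow b)

lemma sheetMap_sheetPt [NeZero a] : sheetMap a b (sheetPt a b) = basePt a b := by
  refine Subtype.ext (Prod.ext ?_ ?_) <;>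
    simp [sheetMap, sheetPt, sheetPoint, basePt, radius_rot, rot_zero]

variable {a b} in
/-- The second sheet maps onto the complement of a slit neighbourhood of the core `w = 0`. -/
def sheetMap' : C(sheet b a, Exterior a b) := (swap a b).comp (sheetMap b a)

lemma sheetMap_orbitPath [NeZero a] [NeZero b] (τ : unitInterval) :
    sheetMap' (orbitPath b a (Real.pi / (a * b)) (rot_neg_pi_div_pow b) τ) =
      sheetMap a b (orbitPath a b 0 (rot_pi_div_pow a) τ) := by
  have ha : (a : ℝ) ≠ 0 := NeZero.ne _
  have hb : (b : ℝ) ≠ 0 := NeZero.ne _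
  refine Subtype.ext (Prod.ext ?_ ?_)
  · change rot (-(Real.pi / b)) * rot (a * (Real.pi / (a * b) + 2 * Real.pi * τ)) =
      radius (rot (Real.pi / a)) * rot (a * (0 + 2 * Real.pi * τ))
    rw [← rot_add, radius_rot, ofReal_one, one_mul]
    congr 1
    field_simp
    ring
  · change (radius (rot _) : ℂ) * rot (b * (Real.pi / (a * b) + 2 * Real.pi * τ)) =
      rot (Real.pi / a) * rot (b * (0 + 2 * Real.pi * τ))
    rw [radius_rot, ofReal_one, one_mul, ← rot_add]
    congr 1
    field_simp
    ring

lemma sheetMap'_sheetPt' [NeZero a] [NeZero b] : sheetMap' (sheetPt' a b) = basePt a b := by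
  have h := sheetMap_orbitPath a b 0
  rw [Path.source, Path.source] at h
  exact h.trans (sheetMap_sheetPt a b)

variable {a b} in
lemma sheetMap'_sheetDeck [NeZero b] (k : ℤ) (q : sheet b a) :
    sheetMap' (sheetDeck b a k q) = sheetMap' (a := a) q :=
  congrArg (swap a b) (sheetMap_sheetDeck k q)

/-- The generator given by the core of the first sheet. -/
def genX [NeZero a] : FundamentalGroup (Exterior a b) (basePt a b) :=
  imageLoop (sheetMap a b) (sheetMap_sheetPt a b)
    ((sheetMap_sheetDeck 1 (sheetPt a b)).trans (sheetMap_sheetPt a b))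

/-- The generator given by the core of the second sheet. -/
def genY [NeZero a] [NeZero b] : FundamentalGroup (Exterior a b) (basePt a b) :=
  imageLoop sheetMap' (sheetMap'_sheetPt' a b)
    ((sheetMap'_sheetDeck 1 (sheetPt' a b)).trans (sheetMap'_sheetPt' a b))

lemma imageLoop_sheetDeck [NeZero a] (k : ℤ) : imageLoop (sheetMap a b) (sheetMap_sheetPt a b)
    ((sheetMap_sheetDeck k (sheetPt a b)).trans (sheetMap_sheetPt a b)) = genX a b ^ k :=
  imageLoop_zpow _ _ (sheetDeck a b) sheetMap_sheetDeck sheetDeck_add sheetDeck_zero k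

lemma imageLoop_sheetDeck' [NeZero a] [NeZero b] (k : ℤ) :
    imageLoop sheetMap' (sheetMap'_sheetPt' a b)
      ((sheetMap'_sheetDeck k (sheetPt' a b)).trans (sheetMap'_sheetPt' a b)) = genY a b ^ k :=
  imageLoop_zpow _ _ (sheetDeck b a) sheetMap'_sheetDeck sheetDeck_add sheetDeck_zero k

lemma winding_genX [NeZero a] : (winding (defect a b) _ (genX a b)).toAdd = b :=
  winding_imageLoop _ _ _ _ (sheetLog a b) exp_sheetLog _ (sheetLog_sheetDeck _)

lemma winding_genY [NeZero a] [NeZero b] : (winding (defect a b) _ (genY a b)).toAdd = a := by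
  refine winding_imageLoop _ _ _ _ (sheetLog b a + .const _ (Real.pi * I)) (fun q => ?_) _ ?_
  · simp only [ContinuousMap.add_apply, ContinuousMap.const_apply, exp_add, exp_sheetLog,
      exp_pi_mul_I, defect, sheetMap', swap, ContinuousMap.coe_mk, ContinuousMap.comp_apply,
      Prod.fst_swap, Prod.snd_swap]
    ring
  · simp only [ContinuousMap.add_apply, ContinuousMap.const_apply, sheetLog_sheetDeck]
    ring

-- Both sides are the class of the circle orbit of the base point, which lies in both sheets.
lemma genX_pow [NeZero a] [NeZero b] : genX a b ^ a = genY a b ^ b := by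
  rw [← zpow_natCast, ← zpow_natCast, ← imageLoop_sheetDeck, ← imageLoop_sheetDeck']
  let γ : Path (basePt a b) (basePt a b) :=
    ((orbitPath a b 0 (rot_pi_div_pow a)).map (sheetMap a b).continuous).cast
      (sheetMap_sheetPt a b).symm ((sheetMap_sheetDeck a _).trans (sheetMap_sheetPt a b)).symm
  refine (imageLoop_eq _ _ _ γ (orbitPath a b 0 (rot_pi_div_pow a)) fun _ => rfl).trans ?_
  exact (imageLoop_eq sheetMap' _ _ γ (orbitPath b a _ (rot_neg_pi_div_pow b))
    (sheetMap_orbitPath a b)).symm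

lemma fromPath_mem_zpowers_genX [NeZero a] (hb : b ≠ 0) (γ : Path (basePt a b) (basePt a b))
    (hγ : ∀ t, γ t ∈ slitExterior a b) :
    FundamentalGroup.fromPath (.mk γ) ∈ Subgroup.zpowers (genX a b) := by
  obtain ⟨k, Γ, hΓ⟩ := exists_path_sheetDeck hb γ hγ _ (sheetMap_sheetPt a b)
  exact ⟨k, (imageLoop_sheetDeck a b k).symm.trans (imageLoop_eq _ _ _ γ Γ hΓ)⟩

lemma fromPath_mem_zpowers_genY [NeZero a] [NeZero b] (γ : Path (basePt a b) (basePt a b))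
    (hγ : ∀ t, γ t ∈ slitExterior' a b) :
    FundamentalGroup.fromPath (.mk γ) ∈ Subgroup.zpowers (genY a b) := by
  obtain ⟨k, Γ, hΓ⟩ := exists_path_sheetDeck (NeZero.ne a) (γ.map (swap b a).continuous) hγ
    (sheetPt' a b) (congrArg (swap b a) (sheetMap'_sheetPt' a b))
  exact ⟨k, (imageLoop_sheetDeck' a b k).symm.trans
    (imageLoop_eq _ _ _ γ Γ fun t => congrArg (swap a b) (hΓ t))⟩

theorem closure_genX_genY [NeZero a] [NeZero b] (hab : a.Coprime b) :
    Subgroup.closure {genX a b, genY a b} = ⊤ := by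
  have hx : basePt a b ∈ slitExterior a b := sheetMap_sheetPt a b ▸ sheetMap_mem _
  have hy : basePt a b ∈ slitExterior' a b :=
    sheetMap'_sheetPt' a b ▸ sheetMap_mem (sheetPt' a b)
  have hle {g} (hg : g ∈ ({genX a b, genY a b} : Set _)) :
      Subgroup.zpowers g ≤ Subgroup.closure {genX a b, genY a b} :=
    (Subgroup.zpowers_le).mpr (Subgroup.subset_closure hg)
  exact subgroup_eq_top_of_open_cover isOpen_slitExterior isOpen_slitExterior' slitExterior_union
    (isPathConnected_slitExterior (NeZero.ne b)) (isPathConnected_slitExterior' (NeZero.ne a))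
    (isPathConnected_slitExterior_inter hab) ⟨hx, hy⟩
    (fun γ hγ => hle (by simp) (fromPath_mem_zpowers_genX a b (NeZero.ne b) γ hγ))
    (fun γ hγ => hle (by simp) (fromPath_mem_zpowers_genY a b γ hγ))

end Generators

lemma pathConnectedSpace_exterior [NeZero a] [NeZero b] (hab : a.Coprime b) :
    PathConnectedSpace (Exterior a b) := by
  rw [pathConnectedSpace_iff_univ, ← slitExterior_union]
  exact (isPathConnected_slitExterior (NeZero.ne b)).union
    (isPathConnected_slitExterior' (NeZero.ne a)) (isPathConnected_slitExterior_inter hab).nonempty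

end TorusKnot

end

noncomputable section

/-! ### Covers obtained by extracting roots -/

open Complex CoveringSpace Winding

section Character

variable {m : ℕ} [NeZero m]

lemma stdAddChar_pow (k : ZMod m) : ZMod.stdAddChar k ^ m = (1 : ℂ) := by
  rw [← AddChar.map_nsmul_eq_pow]
  simp

lemma exists_stdAddChar_eq {ζ : ℂ} (h : ζ ^ m = 1) : ∃ k : ZMod m, ZMod.stdAddChar k = ζ := by
  obtain ⟨i, -, hi⟩ := (isPrimitiveRoot_exp m (NeZero.ne m)).eq_pow_of_pow_eq_one h
  refine ⟨((i : ℤ) : ZMod m), ?_⟩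
  rw [ZMod.stdAddChar_coe, ← hi, ← exp_nat_mul]
  congr 1
  push_cast
  ring

lemma exists_mul_stdAddChar_eq {u u' : ℂ} (hu : u ≠ 0) (h : u' ^ m = u ^ m) :
    ∃ k : ZMod m, u * ZMod.stdAddChar k = u' := by
  obtain ⟨k, hk⟩ := exists_stdAddChar_eq (m := m) (ζ := u' / u) (by
    rw [div_pow, h, div_self (pow_ne_zero _ hu)])
  exact ⟨k, by rw [hk, mul_div_cancel₀ _ hu]⟩

lemma eq_zero_of_mul_stdAddChar_eq_self {u : ℂ} (hu : u ≠ 0) {k : ZMod m}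
    (h : u * ZMod.stdAddChar k = u) : k = 0 :=
  ZMod.injective_stdAddChar (by rw [mul_eq_left₀ hu |>.mp h, AddChar.map_zero_eq_one])

lemma stdAddChar_mul_stdAddChar_neg (k : ZMod m) :
    ZMod.stdAddChar k * ZMod.stdAddChar (-k) = (1 : ℂ) := by
  rw [← AddChar.map_add_eq_mul, add_neg_cancel, AddChar.map_zero_eq_one]

end Character

/-- The space of `m`-th roots of a nowhere vanishing function `f : X → ℂ`: pairs `(x, u)` with
`u ^ m = f x`. It is a `ℤ/m`-cover of `X` as soon as it is connected. -/
abbrev RootCover {X : Type*} [TopologicalSpace X] (f : C(X, {z : ℂ // z ≠ 0})) (m : ℕ) : Type _ :=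
  {y : X × ℂ // y.2 ^ m = f y.1}

namespace RootCover

variable {X : Type*} [TopologicalSpace X] {f : C(X, {z : ℂ // z ≠ 0})} {m : ℕ}

/-- The projection of the root cover to its base. -/
def proj (y : RootCover f m) : X := y.1.1

/-- The tautological `m`-th root of `f` on the root cover. -/
def root (y : RootCover f m) : ℂ := y.1.2

@[fun_prop]
lemma continuous_proj : Continuous (proj : RootCover f m → X) := by unfold proj; fun_prop

@[fun_prop]
lemma continuous_root : Continuous (root : RootCover f m → ℂ) := by unfold root; fun_prop

lemma root_pow (y : RootCover f m) : y.root ^ m = f y.proj := y.2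

lemma ext_proj_root {y y' : RootCover f m} (hproj : y.proj = y'.proj) (hroot : y.root = y'.root) :
    y = y' :=
  Subtype.ext (Prod.ext hproj hroot)

variable [NeZero m]

lemma root_ne_zero (y : RootCover f m) : y.root ≠ 0 := fun h => by
  have := y.root_pow
  rw [h, zero_pow (NeZero.ne m)] at this
  exact (f y.proj).2 this.symm

instance : AddAction (ZMod m) (RootCover f m) where
  vadd k y := ⟨(y.proj, y.root * ZMod.stdAddChar k), by
    rw [mul_pow, stdAddChar_pow, mul_one, y.root_pow]⟩
  zero_vadd y := ext_proj_root rfl (by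
    change y.root * ZMod.stdAddChar 0 = _
    rw [AddChar.map_zero_eq_one, mul_one])
  add_vadd k l y := ext_proj_root rfl (by
    change y.root * ZMod.stdAddChar (k + l) = y.root * ZMod.stdAddChar l * ZMod.stdAddChar k
    rw [AddChar.map_add_eq_mul]
    ring)

lemma root_vadd (k : ZMod m) (y : RootCover f m) :
    (k +ᵥ y).root = y.root * ZMod.stdAddChar k := rfl

lemma continuous_vadd (k : ZMod m) : Continuous fun y : RootCover f m => k +ᵥ y :=
  Continuous.subtype_mk (f := fun y : RootCover f m => (y.proj, y.root * ZMod.stdAddChar k))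
    (by fun_prop) _

lemma eq_zero_of_vadd_eq_self (k : ZMod m) (y : RootCover f m) (h : k +ᵥ y = y) : k = 0 :=
  eq_zero_of_mul_stdAddChar_eq_self y.root_ne_zero (congrArg root h)

lemma proj_eq_iff (y y' : RootCover f m) : y.proj = y'.proj ↔ ∃ k : ZMod m, k +ᵥ y = y' := by
  constructor
  · intro h
    obtain ⟨k, hk⟩ := exists_mul_stdAddChar_eq (m := m) (u' := y'.root) y.root_ne_zero (by
      rw [root_pow, root_pow, h])
    exact ⟨k, ext_proj_root h hk⟩
  · rintro ⟨k, rfl⟩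
    rfl

lemma surjective_proj : Function.Surjective (proj : RootCover f m → X) := fun x => by
  obtain ⟨u, hu⟩ := IsAlgClosed.exists_pow_nat_eq (f x : ℂ) (NeZero.pos m)
  exact ⟨⟨(x, u), hu⟩, rfl⟩

lemma isClosedMap_proj : IsClosedMap (proj : RootCover f m → X) :=
  isClosedMap_fst_of_isProperMap (isProperMap_pow (NeZero.ne m)) (r := fun x => (f x : ℂ))
    (by fun_prop) (C := {y : X × ℂ | y.2 ^ m = f y.1})
    (isClosed_eq (by fun_prop) (by fun_prop)) fun _ h => h

theorem isQuotientCoveringMap [T2Space X] :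
    IsQuotientCoveringMap (proj : RootCover f m → X) (Multiplicative (ZMod m)) :=
  have : ContinuousConstSMul (Multiplicative (ZMod m)) (RootCover f m) :=
    ⟨fun k => continuous_vadd k.toAdd⟩
  isQuotientCoveringMap_of_finite (fun k y h => eq_zero_of_vadd_eq_self k.toAdd y h) (by fun_prop)
    surjective_proj isClosedMap_proj fun {y y'} => by
      rw [eq_comm, proj_eq_iff]
      rfl

lemma eq_iff_eq_of_proj_eq [T2Space X] {S : Type*} [TopologicalSpace S] [PreconnectedSpace S]
    (Φ Ψ : C(S, RootCover f m)) (h : ∀ s, (Φ s).proj = (Ψ s).proj) (s s' : S) :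
    Φ s = Ψ s ↔ Φ s' = Ψ s' := by
  have eq_of_eq (q : S) (hq : Φ q = Ψ q) : (Φ : S → RootCover f m) = Ψ :=
    isQuotientCoveringMap.isCoveringMap.eq_of_comp_eq Φ.continuous Ψ.continuous (funext h) q hq
  exact ⟨fun hs => congrFun (eq_of_eq s hs) s', fun hs => congrFun (eq_of_eq s' hs) s⟩

theorem pathConnectedSpace [T2Space X] [PathConnectedSpace X] {x₀ : X} (g : FundamentalGroup X x₀)
    (hg : IsUnit ((winding f x₀ g).toAdd : ZMod m)) : PathConnectedSpace (RootCover f m) := by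
  have cov := (isQuotientCoveringMap (f := f) (m := m)).isCoveringMap
  obtain ⟨y, hy⟩ := surjective_proj (f := f) (m := m) x₀
  refine pathConnectedSpace_of_monodromyPerm cov x₀ ⟨y, hy⟩ fun y' => ?_
  obtain ⟨k, hk⟩ := (proj_eq_iff y y'.1).mp (hy.trans y'.2.symm)
  obtain ⟨l, hl⟩ := hg.exists_left_inv
  let j : ℤ := (k * l).cast
  refine ⟨g ^ j, Subtype.ext (ext_proj_root ?_ ?_)⟩
  · exact (cov.monodromyPerm x₀ (g ^ j) ⟨y, hy⟩).2.trans y'.2.symm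
  · have h := root_monodromyPerm f cov (NeZero.ne m) ⟨root, continuous_root⟩ root_pow (g ^ j)
      ⟨y, hy⟩
    simp only [ContinuousMap.coe_mk] at h
    rw [h, ← hk, root_vadd, map_zpow, toAdd_zpow, smul_eq_mul, ← ZMod.stdAddChar_coe]
    congr 2
    push_cast
    rw [ZMod.intCast_cast, ZMod.cast_id', id_eq, mul_assoc, hl, mul_one]

end RootCover

/-- A factorization `left * right = base ^ b` of complex valued functions on `Y` whose factors have
no common zero. Compatible `b`-th roots of the two factors form a cover of `Y`, also over the zeros
of `base`. -/
structure PowerFactorization (Y : Type*) [TopologicalSpace Y] (b : ℕ) where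
  left : C(Y, ℂ)
  right : C(Y, ℂ)
  base : C(Y, ℂ)
  mul_eq (y : Y) : left y * right y = base y ^ b
  ne_zero (y : Y) : left y ≠ 0 ∨ right y ≠ 0

/-- The cover of `Y` attached to a factorization `left * right = base ^ b`: triples `(y, v, s)` with
`v ^ b = left y`, `s ^ b = right y` and `v * s = base y`. -/
abbrev SplitCover {Y : Type*} [TopologicalSpace Y] {b : ℕ} (F : PowerFactorization Y b) : Type _ :=
  {e : Y × ℂ × ℂ // (e.2.1 ^ b = F.left e.1 ∧ e.2.2 ^ b = F.right e.1) ∧ e.2.1 * e.2.2 = F.base e.1}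

namespace SplitCover

section Algebra

variable {b : ℕ} [NeZero b]

lemma exists_mul_stdAddChar_eq_and {v v' s s' : ℂ} (hv : v ≠ 0) (hpow : v' ^ b = v ^ b)
    (hmul : v' * s' = v * s) :
    ∃ k : ZMod b, v * ZMod.stdAddChar k = v' ∧ s * ZMod.stdAddChar (-k) = s' := by
  obtain ⟨k, rfl⟩ := exists_mul_stdAddChar_eq hv hpow
  refine ⟨k, rfl, mul_left_cancel₀ hv ?_⟩
  linear_combination -ZMod.stdAddChar (-k) * hmul + v * s' * stdAddChar_mul_stdAddChar_neg k

lemma exists_pow_eq_and_pow_eq {l r c : ℂ} (hl : l ≠ 0) (h : l * r = c ^ b) :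
    ∃ v s : ℂ, (v ^ b = l ∧ s ^ b = r) ∧ v * s = c := by
  obtain ⟨v, rfl⟩ := IsAlgClosed.exists_pow_nat_eq l (NeZero.pos b)
  have hv : v ≠ 0 := ne_zero_pow (NeZero.ne b) hl
  refine ⟨v, c / v, ⟨rfl, ?_⟩, mul_div_cancel₀ _ hv⟩
  rw [div_pow, ← h, mul_div_cancel_left₀ _ hl]

end Algebra

variable {Y : Type*} [TopologicalSpace Y] {b : ℕ} {F : PowerFactorization Y b}

/-- The projection of the split cover to its base. -/
def proj (e : SplitCover F) : Y := e.1.1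

/-- The tautological `b`-th root of the left factor. -/
def leftRoot (e : SplitCover F) : ℂ := e.1.2.1

/-- The tautological `b`-th root of the right factor. -/
def rightRoot (e : SplitCover F) : ℂ := e.1.2.2

@[fun_prop]
lemma continuous_proj : Continuous (proj : SplitCover F → Y) := by unfold proj; fun_prop

@[fun_prop]
lemma continuous_leftRoot : Continuous (leftRoot : SplitCover F → ℂ) := by
  unfold leftRoot; fun_prop

@[fun_prop]
lemma continuous_rightRoot : Continuous (rightRoot : SplitCover F → ℂ) := by
  unfold rightRoot; fun_prop

lemma leftRoot_pow (e : SplitCover F) : e.leftRoot ^ b = F.left e.proj := e.2.1.1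

lemma rightRoot_pow (e : SplitCover F) : e.rightRoot ^ b = F.right e.proj := e.2.1.2

lemma leftRoot_mul_rightRoot (e : SplitCover F) : e.leftRoot * e.rightRoot = F.base e.proj := e.2.2

lemma ext_proj_roots {e e' : SplitCover F} (hproj : e.proj = e'.proj)
    (hleft : e.leftRoot = e'.leftRoot) (hright : e.rightRoot = e'.rightRoot) : e = e' :=
  Subtype.ext (Prod.ext hproj (Prod.ext hleft hright))

variable [NeZero b]

lemma leftRoot_ne_zero_or_rightRoot_ne_zero (e : SplitCover F) :
    e.leftRoot ≠ 0 ∨ e.rightRoot ≠ 0 := by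
  refine (F.ne_zero e.proj).imp (fun h => ?_) fun h => ?_
  · exact ne_zero_pow (NeZero.ne b) (e.leftRoot_pow ▸ h)
  · exact ne_zero_pow (NeZero.ne b) (e.rightRoot_pow ▸ h)

instance : AddAction (ZMod b) (SplitCover F) where
  vadd k e := ⟨(e.proj, e.leftRoot * ZMod.stdAddChar k, e.rightRoot * ZMod.stdAddChar (-k)), by
    refine ⟨⟨?_, ?_⟩, ?_⟩
    · rw [mul_pow, stdAddChar_pow, mul_one, e.leftRoot_pow]
    · rw [mul_pow, stdAddChar_pow, mul_one, e.rightRoot_pow]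
    · linear_combination e.leftRoot * e.rightRoot * stdAddChar_mul_stdAddChar_neg k +
        e.leftRoot_mul_rightRoot⟩
  zero_vadd e := ext_proj_roots rfl
    (by change e.leftRoot * ZMod.stdAddChar 0 = _; simp)
    (by change e.rightRoot * ZMod.stdAddChar (-0) = _; simp)
  add_vadd k l e := ext_proj_roots rfl
    (by
      change e.leftRoot * ZMod.stdAddChar (k + l) =
        e.leftRoot * ZMod.stdAddChar l * ZMod.stdAddChar k
      rw [AddChar.map_add_eq_mul]
      ring)
    (by
      change e.rightRoot * ZMod.stdAddChar (-(k + l)) =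
        e.rightRoot * ZMod.stdAddChar (-l) * ZMod.stdAddChar (-k)
      rw [neg_add, AddChar.map_add_eq_mul]
      ring)

lemma leftRoot_vadd (k : ZMod b) (e : SplitCover F) :
    (k +ᵥ e).leftRoot = e.leftRoot * ZMod.stdAddChar k := rfl

lemma rightRoot_vadd (k : ZMod b) (e : SplitCover F) :
    (k +ᵥ e).rightRoot = e.rightRoot * ZMod.stdAddChar (-k) := rfl

variable (F) in
/-- The deck transformation of the split cover given by `k : ZMod b`. -/
def deck (k : ZMod b) : C(SplitCover F, SplitCover F) where
  toFun e := k +ᵥ e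
  continuous_toFun := Continuous.subtype_mk (f := fun e : SplitCover F =>
    (e.proj, e.leftRoot * ZMod.stdAddChar k, e.rightRoot * ZMod.stdAddChar (-k))) (by fun_prop) _

lemma eq_zero_of_vadd_eq_self (k : ZMod b) (e : SplitCover F) (h : k +ᵥ e = e) : k = 0 := by
  rcases e.leftRoot_ne_zero_or_rightRoot_ne_zero with h0 | h0
  · exact eq_zero_of_mul_stdAddChar_eq_self h0 (congrArg leftRoot h)
  · exact neg_eq_zero.mp (eq_zero_of_mul_stdAddChar_eq_self h0 (congrArg rightRoot h))

lemma proj_eq_iff (e e' : SplitCover F) : e.proj = e'.proj ↔ ∃ k : ZMod b, k +ᵥ e = e' := by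
  refine ⟨fun h => ?_, by rintro ⟨k, rfl⟩; rfl⟩
  have hmul : e'.leftRoot * e'.rightRoot = e.leftRoot * e.rightRoot := by
    rw [leftRoot_mul_rightRoot, leftRoot_mul_rightRoot, h]
  rcases e.leftRoot_ne_zero_or_rightRoot_ne_zero with h0 | h0
  · obtain ⟨k, hk, hk'⟩ := exists_mul_stdAddChar_eq_and (b := b) h0
      (by rw [leftRoot_pow, leftRoot_pow, h]) hmul
    exact ⟨k, ext_proj_roots h hk hk'⟩
  · obtain ⟨k, hk, hk'⟩ := exists_mul_stdAddChar_eq_and (b := b) (v' := e'.rightRoot)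
      (s := e.leftRoot) (s' := e'.leftRoot) h0 (by rw [rightRoot_pow, rightRoot_pow, h])
      (by rw [mul_comm, hmul, mul_comm])
    exact ⟨-k, ext_proj_roots h hk' (by rw [rightRoot_vadd, neg_neg, hk])⟩

lemma surjective_proj : Function.Surjective (proj : SplitCover F → Y) := fun y => by
  rcases F.ne_zero y with h | h
  · obtain ⟨v, s, hvs⟩ := exists_pow_eq_and_pow_eq h (F.mul_eq y)
    exact ⟨⟨(y, v, s), hvs⟩, rfl⟩
  · obtain ⟨s, v, hs, hmul⟩ := exists_pow_eq_and_pow_eq h ((mul_comm _ _).trans (F.mul_eq y))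
    exact ⟨⟨(y, v, s), hs.symm, (mul_comm v s).trans hmul⟩, rfl⟩

lemma isClosedMap_proj : IsClosedMap (proj : SplitCover F → Y) :=
  isClosedMap_fst_of_isProperMap
    ((isProperMap_pow (NeZero.ne b)).prodMap (isProperMap_pow (NeZero.ne b)))
    (r := fun y => (F.left y, F.right y)) (by fun_prop)
    (((isClosed_eq (by fun_prop) (by fun_prop)).inter
      (isClosed_eq (by fun_prop) (by fun_prop))).inter (isClosed_eq (by fun_prop) (by fun_prop)))
    fun _ h => Prod.ext h.1.1 h.1.2

theorem isQuotientCoveringMap [T2Space Y] :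
    IsQuotientCoveringMap (proj : SplitCover F → Y) (Multiplicative (ZMod b)) :=
  have : ContinuousConstSMul (Multiplicative (ZMod b)) (SplitCover F) :=
    ⟨fun k => (deck F k.toAdd).continuous⟩
  isQuotientCoveringMap_of_finite (fun k e h => eq_zero_of_vadd_eq_self k.toAdd e h) (by fun_prop)
    surjective_proj isClosedMap_proj fun {e e'} => by
      rw [eq_comm, proj_eq_iff]
      rfl

end SplitCover

end

noncomputable section

/-! ### The separating character of the torus knot group -/

lemma exists_hom_vadd_eq {G K P E : Type*} [Group G] [AddCommGroup K] [AddAction K E]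
    (hfree : ∀ (k : K) (e : E), k +ᵥ e = e → k = 0) (ρ : G →* Equiv.Perm P) (ι : P → E)
    (hcomm : ∀ (g : G) (k : K) (ε ε' : P), ι ε' = k +ᵥ ι ε → ι (ρ g ε') = k +ᵥ ι (ρ g ε))
    (H : Subgroup G) (ε : P) (hH : ∀ g ∈ H, ∃ k : K, k +ᵥ ι ε = ι (ρ g ε)) :
    ∃ φ : H →* Multiplicative K, ∀ (g : H) (k : K), ι (ρ g ε) = k +ᵥ ι ε → (φ g).toAdd = k := by
  have cancel {k l : K} (hkl : k +ᵥ ι ε = l +ᵥ ι ε) : k = l := by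
    have := hfree (-l + k) (ι ε) (by rw [add_vadd, hkl, neg_vadd_vadd])
    rw [← sub_eq_zero, sub_eq_neg_add, this]
  choose κ hκ using fun g : H => hH g.1 g.2
  refine ⟨MonoidHom.mk' (fun g => Multiplicative.ofAdd (κ g)) fun g g' => ?_,
    fun g k hk => cancel ((hκ g).trans hk)⟩
  rw [← ofAdd_add]
  refine congrArg Multiplicative.ofAdd (cancel ?_)
  rw [hκ, add_comm, add_vadd, hκ, Subgroup.coe_mul, map_mul]
  exact hcomm g.1 _ ε (ρ g'.1 ε) (hκ g').symm

namespace TorusKnot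

open Complex CoveringSpace Winding

section Cofactor

/-- The cofactor of `x - y` in `x ^ N - y ^ N`. -/
def cofactor (N : ℕ) (x y : ℂ) : ℂ := ∑ i ∈ Finset.range N, x ^ i * y ^ (N - 1 - i)

lemma sub_mul_cofactor (N : ℕ) (x y : ℂ) : (x - y) * cofactor N x y = x ^ N - y ^ N := by
  rw [mul_comm, cofactor, geom_sum₂_mul]

lemma cofactor_self (N : ℕ) (x : ℂ) : cofactor N x x = N * x ^ (N - 1) := geom_sum₂_self x N

lemma cofactor_mul_right (N : ℕ) (x y r : ℂ) :
    cofactor N (x * r) (y * r) = cofactor N x y * r ^ (N - 1) := by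
  rw [cofactor, cofactor, Finset.sum_mul]
  refine Finset.sum_congr rfl fun i hi => ?_
  have hsplit : r ^ (N - 1) = r ^ i * r ^ (N - 1 - i) := by
    rw [← pow_add, Nat.add_sub_cancel' (Nat.le_sub_one_of_lt (Finset.mem_range.mp hi))]
  rw [hsplit]
  ring

end Cofactor

variable {a b N c : ℕ}

section TwistCover

variable [NeZero N]

variable (b) in
/-- On the space of `N`-th roots `u` of the defect `w ^ (N * c) - z ^ b`, the factorization
`(w ^ c - u) * ((w ^ c) ^ (N - 1) + ⋯ + u ^ (N - 1)) = z ^ b`. -/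
def twistFactorization (h : N * c = a) :
    PowerFactorization (RootCover (defect a b) N) b where
  left := ⟨fun y => y.proj.1.2 ^ c - y.root, by fun_prop⟩
  right := ⟨fun y => cofactor N (y.proj.1.2 ^ c) y.root, by unfold cofactor; fun_prop⟩
  base := ⟨fun y => y.proj.1.1, by fun_prop⟩
  mul_eq y := by
    change (y.proj.1.2 ^ c - y.root) * cofactor N (y.proj.1.2 ^ c) y.root = y.proj.1.1 ^ b
    rw [sub_mul_cofactor, y.root_pow, ← pow_mul, mul_comm c, h]
    exact sub_sub_cancel _ _
  ne_zero y := by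
    refine or_iff_not_imp_left.mpr fun hleft => ?_
    simp only [ContinuousMap.coe_mk, ne_eq, not_not, sub_eq_zero] at hleft ⊢
    rw [hleft, cofactor_self]
    exact mul_ne_zero (Nat.cast_ne_zero.mpr (NeZero.ne N)) (pow_ne_zero _ y.root_ne_zero)

variable (b) in
/-- The cover of degree `N * b` of the exterior obtained by extracting an `N`-th root of the defect
and then splitting `z` into `b`-th roots of the factors of `z ^ b`. -/
abbrev TwistCover (h : N * c = a) : Type := SplitCover (twistFactorization b h)

namespace TwistCover

variable {h : N * c = a}

/-- The projection of the twist cover to the exterior. -/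
def toExterior (e : TwistCover b h) : Exterior a b := e.proj.proj

lemma leftRoot_pow_eq (e : TwistCover b h) :
    e.leftRoot ^ b = e.toExterior.1.2 ^ c - e.proj.root := e.leftRoot_pow

lemma rightRoot_pow_eq (e : TwistCover b h) :
    e.rightRoot ^ b = cofactor N (e.toExterior.1.2 ^ c) e.proj.root := e.rightRoot_pow

lemma leftRoot_mul_rightRoot_eq (e : TwistCover b h) :
    e.leftRoot * e.rightRoot = e.toExterior.1.1 := e.leftRoot_mul_rightRoot

lemma ext_toExterior_roots {e e' : TwistCover b h} (htoExterior : e.toExterior = e'.toExterior)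
    (hroot : e.proj.root = e'.proj.root) (hleft : e.leftRoot = e'.leftRoot)
    (hright : e.rightRoot = e'.rightRoot) : e = e' :=
  SplitCover.ext_proj_roots (RootCover.ext_proj_root htoExterior hroot) hleft hright

variable (b h) in
lemma isCoveringMap_toExterior [NeZero b] :
    IsCoveringMap (toExterior : TwistCover b h → Exterior a b) :=
  have hsplit := SplitCover.isQuotientCoveringMap (F := twistFactorization b h)
  have hroot := RootCover.isQuotientCoveringMap (f := defect a b) (m := N)
  isCoveringMap_comp hsplit.isCoveringMap.isLocalHomeomorph hroot.isCoveringMap.isLocalHomeomorph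
    SplitCover.isClosedMap_proj RootCover.isClosedMap_proj
    (finite_fiber_of_isQuotientCoveringMap hsplit) (finite_fiber_of_isQuotientCoveringMap hroot)

end TwistCover

end TwistCover

section Flow

lemma rot_mul_pow_comm (m n : ℕ) (t : ℝ) : rot (m * t) ^ n = rot (n * t) ^ m := by
  rw [rot_pow, rot_pow]
  ring_nf

/-- The circle action whose orbits are parallel to the knot. -/
def flow (t : ℝ) (x : Exterior a b) : Exterior a b :=
  ⟨(x.1.1 * rot (a * t), x.1.2 * rot (b * t)), by simpa [norm_rot] using x.2.1, by
    rw [mul_pow, mul_pow, rot_mul_pow_comm a b]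
    exact fun h => x.2.2 (mul_right_cancel₀ (pow_ne_zero _ (rot_ne_zero _)) h)⟩

lemma flow_of_fst_eq_zero [NeZero b] {x : Exterior a b} (hx : x.1.1 = 0) :
    flow (2 * Real.pi * (1 : ℤ) / b) x = x := by
  refine Subtype.ext (Prod.ext ?_ ?_)
  · simp [flow, hx]
  · change x.1.2 * rot _ = x.1.2
    rw [mul_div_cancel₀ _ (NeZero.ne (b : ℝ)), rot_int, mul_one]

variable (b) in
/-- The points of the sheet that are mapped to the core circle. -/
def corePt [NeZero a] : C(ℝ, sheet a b) where
  toFun t := ⟨(t, 0), (zero_mem_sheet (b := b) (NeZero.ne a) :)⟩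
  continuous_toFun := by fun_prop

lemma sheetDeck_corePt [NeZero a] (k : ℤ) :
    sheetDeck a b k (corePt b 0) = corePt b (2 * Real.pi * k / a) :=
  Subtype.ext (Prod.ext (by simp [sheetDeck, corePt]) (by simp [sheetDeck, corePt]))

lemma sheetMap_corePt [NeZero a] (t : ℝ) :
    sheetMap a b (corePt b t) = flow t (sheetMap a b (corePt b 0)) := by
  refine Subtype.ext (Prod.ext ?_ ?_)
  · simp [sheetMap, corePt, flow, rot_zero]
  · simp [sheetMap, corePt, flow]

lemma sheetMap'_corePt [NeZero b] (t : ℝ) :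
    sheetMap' (corePt a t) = flow t (sheetMap' (a := a) (b := b) (corePt a 0)) :=
  congrArg (swap a b) (sheetMap_corePt t)

lemma sheetMap'_corePt_fst [NeZero b] (t : ℝ) :
    (sheetMap' (a := a) (b := b) (corePt a t)).1.1 = 0 := by
  simp [sheetMap', swap, sheetMap, corePt]

lemma rot_mul_eq_rot_pow (h : N * c = a) (t : ℝ) : rot (a * t) = rot (c * t) ^ N := by
  rw [rot_pow, ← h]
  push_cast
  ring_nf

/-- The lift of the circle action to the `N`-th roots of the defect. -/
def rootFlow (h : N * c = a) (t : ℝ) (y : RootCover (defect a b) N) : RootCover (defect a b) N :=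
  ⟨(flow t y.proj, y.root * rot (c * t) ^ b), by
    have hy := y.root_pow
    simp only [defect, flow, ContinuousMap.coe_mk] at hy ⊢
    rw [mul_pow, mul_pow, mul_pow, rot_mul_pow_comm b a, rot_mul_eq_rot_pow h, hy]
    ring⟩

namespace TwistCover

variable [NeZero N] {h : N * c = a}

/-- The lift of an orbit of the circle action to the twist cover. -/
def liftOrbit (e : TwistCover b h) : C(ℝ, TwistCover b h) where
  toFun t := ⟨(rootFlow h t e.proj, e.leftRoot * rot (c * t),
      e.rightRoot * rot (c * t) ^ (N - 1)), by
    change (_ = (e.toExterior.1.2 * rot (b * t)) ^ c - e.proj.root * rot (c * t) ^ b ∧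
      _ = cofactor N ((e.toExterior.1.2 * rot (b * t)) ^ c) (e.proj.root * rot (c * t) ^ b)) ∧
      _ = e.toExterior.1.1 * rot (a * t)
    simp only
    refine ⟨⟨?_, ?_⟩, ?_⟩
    · rw [mul_pow, mul_pow, leftRoot_pow_eq, rot_mul_pow_comm b c]
      ring
    · rw [mul_pow _ _ c, rot_mul_pow_comm b c, cofactor_mul_right, mul_pow, rightRoot_pow_eq]
      ring
    · rw [← leftRoot_mul_rightRoot_eq, rot_mul_eq_rot_pow h,
        ← mul_pow_sub_one (NeZero.ne N) (rot (c * t))]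
      ring⟩
  continuous_toFun := by
    refine Continuous.subtype_mk (Continuous.prodMk (Continuous.subtype_mk (Continuous.prodMk
      (Continuous.subtype_mk ?_ _) ?_) _) ?_) _ <;> fun_prop

lemma toExterior_liftOrbit (e : TwistCover b h) (t : ℝ) :
    (e.liftOrbit t).toExterior = flow t e.toExterior := rfl

lemma root_liftOrbit (e : TwistCover b h) (t : ℝ) :
    (e.liftOrbit t).proj.root = e.proj.root * rot (c * t) ^ b := rfl

lemma leftRoot_liftOrbit (e : TwistCover b h) (t : ℝ) :
    (e.liftOrbit t).leftRoot = e.leftRoot * rot (c * t) := rfl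

lemma rightRoot_liftOrbit (e : TwistCover b h) (t : ℝ) :
    (e.liftOrbit t).rightRoot = e.rightRoot * rot (c * t) ^ (N - 1) := rfl

lemma liftOrbit_eq_self {e : TwistCover b h} {t : ℝ} (ht : rot (c * t) = 1)
    (hflow : flow t e.toExterior = e.toExterior) : e.liftOrbit t = e :=
  ext_toExterior_roots hflow (by rw [root_liftOrbit, ht, one_pow, mul_one])
    (by rw [leftRoot_liftOrbit, ht, mul_one]) (by rw [rightRoot_liftOrbit, ht, one_pow, mul_one])

variable [NeZero b]

lemma eq_liftOrbit (κ : C(ℝ, TwistCover b h))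
    (hκ : ∀ t, (κ t).toExterior = flow t (κ 0).toExterior) (t : ℝ) : κ t = (κ 0).liftOrbit t := by
  refine congrFun ((isCoveringMap_toExterior b h).eq_of_comp_eq κ.continuous
    (κ 0).liftOrbit.continuous (funext hκ) 0 (liftOrbit_eq_self ?_ ?_).symm) t
  · rw [mul_zero, rot_zero]
  · exact (hκ 0).symm

lemma leftRoot_eq_zero_iff (e : TwistCover b h) :
    e.leftRoot = 0 ↔ e.proj.root = e.toExterior.1.2 ^ c := by
  rw [← pow_eq_zero_iff (NeZero.ne b), leftRoot_pow_eq, sub_eq_zero, eq_comm]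

-- Over `z = 0` one of the two roots vanishes, and the turn acts on the other one through
-- `exp (2πi c / b)` or its `(N - 1)`-st power.
lemma liftOrbit_of_fst_eq_zero {e : TwistCover b h} (he : e.toExterior.1.1 = 0) :
    e.liftOrbit (2 * Real.pi * (1 : ℤ) / b) =
      ((c : ZMod b) - if e.leftRoot = 0 then ((N * c : ℕ) : ZMod b) else 0) +ᵥ e := by
  have hrot : rot (c * (2 * Real.pi * (1 : ℤ) / b)) = ZMod.stdAddChar (c : ZMod b) := by
    have hcoe := ZMod.stdAddChar_coe (N := b) c
    rw [Int.cast_natCast] at hcoe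
    rw [hcoe, rot]
    congr 1
    push_cast
    ring
  refine ext_toExterior_roots (flow_of_fst_eq_zero he) ?_ ?_ ?_
  · rw [root_liftOrbit, hrot, stdAddChar_pow, mul_one]
    rfl
  · rw [leftRoot_liftOrbit, SplitCover.leftRoot_vadd, hrot]
    by_cases hleft : e.leftRoot = 0
    · rw [hleft, zero_mul, zero_mul]
    · rw [if_neg hleft, sub_zero]
  · rw [rightRoot_liftOrbit, SplitCover.rightRoot_vadd, hrot]
    by_cases hleft : e.leftRoot = 0
    · rw [if_pos hleft, ← AddChar.map_nsmul_eq_pow, nsmul_eq_mul, Nat.cast_sub NeZero.one_le]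
      congr 2
      push_cast
      ring
    · have hright : e.rightRoot = 0 := by
        simpa [hleft, he] using e.leftRoot_mul_rightRoot_eq
      rw [hright, zero_mul, zero_mul]

end TwistCover

end Flow

section Monodromy

variable [NeZero b] [NeZero N]

open TwistCover

lemma exists_lift_sheetMap'_root (h : N * c = a) : ∃ Φ : C(sheet b a, RootCover (defect a b) N),
    (∀ q, (Φ q).proj = sheetMap' q) ∧
      (Φ (corePt a 0)).root = (sheetMap' (a := a) (b := b) (corePt a 0)).1.2 ^ c := by
  obtain ⟨Φ, ⟨hcore, hΦ⟩, -⟩ := RootCover.isQuotientCoveringMap (f := defect a b) (m := N)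
    |>.isCoveringMap.existsUnique_continuousMap_lifts (sheetMap' (a := a) (b := b)) (corePt a 0)
      ⟨(sheetMap' (corePt a 0), (sheetMap' (a := a) (b := b) (corePt a 0)).1.2 ^ c), by
        rw [← pow_mul, mul_comm c, h]
        simp [defect, sheetMap'_corePt_fst, NeZero.ne b]⟩ rfl
  exact ⟨Φ, congrFun hΦ, congrArg RootCover.root hcore⟩

variable [NeZero a] (h : N * c = a)

theorem monodromyPerm_genX_pow (ε : (toExterior : TwistCover b h → _) ⁻¹' {basePt a b}) :
    (isCoveringMap_toExterior b h).monodromyPerm (basePt a b) (genX a b ^ N) ε = ε := by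
  have cov := isCoveringMap_toExterior b h
  obtain ⟨Θ, ⟨hε, hΘ⟩, -⟩ := cov.existsUnique_continuousMap_lifts (sheetMap a b) (sheetPt a b) ε.1
    (ε.2.trans (sheetMap_sheetPt a b).symm)
  have toExterior_lift (q) : (Θ q).toExterior = sheetMap a b q := congrFun hΘ q
  have lift_core (t : ℝ) : Θ (corePt b t) = (Θ (corePt b 0)).liftOrbit t :=
    eq_liftOrbit (Θ.comp (corePt b)) (fun t => by simp [toExterior_lift, sheetMap_corePt t]) t
  have lift_deck : Θ (sheetDeck a b N (corePt b 0)) = Θ (corePt b 0) := by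
    rw [sheetDeck_corePt, lift_core]
    refine liftOrbit_eq_self ?_ ?_
    · have hNc : (N : ℝ) * c ≠ 0 := by exact_mod_cast h ▸ NeZero.ne a
      have hN := left_ne_zero_of_mul hNc
      have hc := right_ne_zero_of_mul hNc
      rw [← rot_int 1, ← h]
      congr 1
      push_cast
      field_simp
    · rw [← toExterior_liftOrbit, ← lift_core, ← sheetDeck_corePt, toExterior_lift,
        toExterior_lift, sheetMap_sheetDeck]
  refine Subtype.ext ?_
  rw [← zpow_natCast, ← imageLoop_sheetDeck]
  exact monodromyPerm_imageLoop_deck (sheetMap a b) cov (sheetMap_sheetPt a b) (sheetDeck a b N)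
    (sheetMap_sheetDeck N) (.id _) (fun _ => rfl) Θ toExterior_lift hε lift_deck

theorem exists_monodromyPerm_genY : ∃ y₀ : RootCover (defect a b) N, y₀.proj = basePt a b ∧
    ∀ ε : (toExterior : TwistCover b h → _) ⁻¹' {basePt a b},
      ((isCoveringMap_toExterior b h).monodromyPerm (basePt a b) (genY a b) ε).1 =
        ((c : ZMod b) - if ε.1.proj = y₀ then ((N * c : ℕ) : ZMod b) else 0) +ᵥ ε.1 := by
  have cov := isCoveringMap_toExterior b h
  obtain ⟨Φ, hΦ, hΦ_core⟩ := exists_lift_sheetMap'_root (b := b) h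
  refine ⟨Φ (sheetPt' a b), (hΦ _).trans (sheetMap'_sheetPt' a b), fun ε => ?_⟩
  obtain ⟨Θ, ⟨hε, hΘ⟩, -⟩ := cov.existsUnique_continuousMap_lifts (sheetMap' (a := a))
    (sheetPt' a b) ε.1 (ε.2.trans (sheetMap'_sheetPt' a b).symm)
  have toExterior_lift (q) : (Θ q).toExterior = sheetMap' q := congrFun hΘ q
  have lift_core (t : ℝ) : Θ (corePt a t) = (Θ (corePt a 0)).liftOrbit t :=
    eq_liftOrbit (Θ.comp (corePt a)) (fun t => by simp [toExterior_lift, sheetMap'_corePt t]) t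
  have leftRoot_core : (Θ (corePt a 0)).leftRoot = 0 ↔ ε.1.proj = Φ (sheetPt' a b) := by
    have proj_eq (q) : (Θ q).proj.proj = (Φ q).proj := (toExterior_lift q).trans (hΦ q).symm
    rw [leftRoot_eq_zero_iff, toExterior_lift, ← hΦ_core, ← hε]
    refine Iff.trans ⟨fun hroot => RootCover.ext_proj_root (proj_eq _) hroot,
      congrArg RootCover.root⟩ ?_
    exact RootCover.eq_iff_eq_of_proj_eq ⟨fun q => (Θ q).proj, by fun_prop⟩ Φ proj_eq _ _
  have lift_deck : Θ (sheetDeck b a 1 (corePt a 0)) = SplitCover.deck (twistFactorization b h)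
      ((c : ZMod b) - if ε.1.proj = Φ (sheetPt' a b) then ((N * c : ℕ) : ZMod b) else 0)
        (Θ (corePt a 0)) := by
    rw [sheetDeck_corePt, lift_core, liftOrbit_of_fst_eq_zero (by
      rw [toExterior_lift, sheetMap'_corePt_fst])]
    simp only [leftRoot_core]
    rfl
  exact monodromyPerm_imageLoop_deck sheetMap' cov (sheetMap'_sheetPt' a b) (sheetDeck b a 1)
    (sheetMap'_sheetDeck 1) _ (fun _ => rfl) Θ toExterior_lift hε lift_deck

end Monodromy

section Character

variable [NeZero a] [NeZero b]

/-- The fundamental group of the exterior, generated by the cores of the two sheets and weighted by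
the winding number of the defect. -/
def torusGenerators (hab : a.Coprime b) :
    TorusGenerators (FundamentalGroup (Exterior a b) (basePt a b)) a b where
  x := genX a b
  y := genY a b
  closure_eq_top := closure_genX_genY a b hab
  pow_eq_pow := genX_pow a b
  weight := winding (defect a b) (basePt a b)
  weight_x := winding_genX a b
  weight_y := winding_genY a b

variable [NeZero N] (h : N * c = a)

open TwistCover

lemma exp_eq_one_iff_dvd {k : ℤ} : exp (2 * Real.pi * I * k / N) = 1 ↔ (N : ℤ) ∣ k := by
  rw [← ZMod.stdAddChar_coe, ← ZMod.intCast_zmod_eq_zero_iff_dvd]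
  refine ⟨fun hk => eq_zero_of_mul_stdAddChar_eq_self one_ne_zero ((one_mul _).trans hk),
    fun hk => ?_⟩
  rw [hk, AddChar.map_zero_eq_one]

lemma proj_monodromyPerm_eq_iff (g : FundamentalGroup (Exterior a b) (basePt a b))
    (ε : (toExterior : TwistCover b h → _) ⁻¹' {basePt a b}) :
    ((isCoveringMap_toExterior b h).monodromyPerm (basePt a b) g ε).1.proj = ε.1.proj ↔
      (N : ℤ) ∣ (winding (defect a b) (basePt a b) g).toAdd := by
  have hroot := root_monodromyPerm (defect a b) (isCoveringMap_toExterior b h) (NeZero.ne N)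
    ⟨fun e => e.proj.root, by fun_prop⟩ (fun e => e.proj.root_pow) g ε
  rw [← exp_eq_one_iff_dvd, ← mul_eq_left₀ ε.1.proj.root_ne_zero]
  refine ⟨fun hproj => hroot.symm.trans (congrArg RootCover.root hproj), fun hexp => ?_⟩
  exact RootCover.ext_proj_root (((isCoveringMap_toExterior b h).monodromyPerm _ g ε).2.trans
    ε.2.symm) (hroot.trans hexp)

theorem nonempty_separatingCharacter (hab : a.Coprime b) (h : N * c = a) :
    Nonempty ((torusGenerators hab).SeparatingCharacter N) := by
  let ρ := (isCoveringMap_toExterior b h).monodromyPerm (basePt a b)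
  obtain ⟨y₀, hy₀, hgenY⟩ := exists_monodromyPerm_genY (b := b) h
  obtain ⟨e, rfl⟩ := SplitCover.surjective_proj (F := twistFactorization b h) y₀
  let ε : (toExterior : TwistCover b h → _) ⁻¹' {basePt a b} := ⟨e, hy₀⟩
  have deck_comm (g) (k : ZMod b) (ε₁ ε₂ : (toExterior : TwistCover b h → _) ⁻¹' {basePt a b})
      (hk : ε₂.1 = k +ᵥ ε₁.1) : (ρ g ε₂).1 = k +ᵥ (ρ g ε₁).1 :=
    monodromyPerm_map (isCoveringMap_toExterior b h) (SplitCover.deck _ k) (fun _ => rfl) g ε₁ ε₂ hk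
  obtain ⟨φ, hφ⟩ := exists_hom_vadd_eq SplitCover.eq_zero_of_vadd_eq_self ρ Subtype.val deck_comm
    ((torusGenerators hab).divKer N) ε fun g hg => (SplitCover.proj_eq_iff _ _).mp
      ((proj_monodromyPerm_eq_iff h g ε).mpr ((torusGenerators hab).mem_divKer.mp hg)).symm
  refine ⟨φ, c, (N * c : ℕ), h ▸ (ZMod.isUnit_iff_coprime a b).mpr hab, fun g hg => ?_,
    fun i g hg => hφ g _ ?_⟩
  · refine hφ g 0 ?_
    rw [hg, zero_vadd]
    exact congrArg Subtype.val (monodromyPerm_genX_pow h ε)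
  · let ε' := ρ (genX a b ^ (-i)) ε
    have hdvd : ε'.1.proj = e.proj ↔ (N : ℤ) ∣ i := by
      have hco : IsCoprime (N : ℤ) b :=
        Nat.isCoprime_iff_coprime.mpr (hab.coprime_dvd_left (Dvd.intro c h))
      rw [proj_monodromyPerm_eq_iff h _ ε, map_zpow, toAdd_zpow, winding_genX, smul_eq_mul, neg_mul,
        Int.dvd_neg]
      exact ⟨hco.dvd_of_dvd_mul_right, fun hi => hi.mul_right _⟩
    have hinv : ρ (genX a b ^ i) ε' = ε := by
      rw [← Equiv.Perm.mul_apply, ← map_mul, ← zpow_add, add_neg_cancel, zpow_zero, map_one,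
        Equiv.Perm.one_apply]
    have hconj := deck_comm (genX a b ^ i) _ ε' (ρ (genY a b) ε') (hgenY ε')
    simp only [hdvd, hinv] at hconj
    rw [hg, map_mul, map_mul]
    exact hconj

end Character

end TorusKnot

end

noncomputable section

/-! ### Comparison with the knot in the unit sphere -/

namespace TorusKnot

open Complex

section SignedConj

/-- Complex conjugation if the exponent `a` is negative, and the identity otherwise. It reduces
torus knots to those with positive exponents. -/
def signedConj (a : ℤ) (z : ℂ) : ℂ := if a < 0 then starRingEnd ℂ z else z

@[fun_prop]
lemma continuous_signedConj (a : ℤ) : Continuous (signedConj a) := by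
  unfold signedConj
  split_ifs
  exacts [continuous_conj, continuous_id]

lemma signedConj_involutive (a : ℤ) : Function.Involutive (signedConj a) := fun z => by
  unfold signedConj
  split_ifs <;> simp

lemma norm_signedConj (a : ℤ) (z : ℂ) : ‖signedConj a z‖ = ‖z‖ := by
  unfold signedConj
  split_ifs <;> simp

lemma signedConj_ofReal_mul (a : ℤ) (r : ℝ) (z : ℂ) :
    signedConj a (r * z) = r * signedConj a z := by
  unfold signedConj
  split_ifs <;> simp

lemma signedConj_rot (a : ℤ) (t : ℝ) : signedConj a (rot (a * t)) = rot (a.natAbs * t) := by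
  rw [Nat.cast_natAbs, Int.cast_abs, signedConj]
  split_ifs with ha
  · rw [abs_of_neg (Int.cast_lt_zero.mpr ha), rot, ← exp_conj, rot]
    congr 1
    simp
  · rw [abs_of_nonneg (Int.cast_nonneg (not_lt.mp ha))]

lemma ofReal_sqrt_two_ne_zero : ((√2 : ℝ) : ℂ) ≠ 0 := ofReal_ne_zero.mpr (by positivity)

lemma sqrt_two_mul_signedConj_inv (a : ℤ) (z : ℂ) :
    (√2 : ℝ) * signedConj a (((√2)⁻¹ : ℝ) * signedConj a z) = z := by
  rw [signedConj_ofReal_mul, signedConj_involutive, ofReal_inv,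
    mul_inv_cancel_left₀ ofReal_sqrt_two_ne_zero]

lemma norm_sq_sqrt_two_mul_signedConj (a : ℤ) (z : ℂ) :
    ‖(√2 : ℝ) * signedConj a z‖ ^ 2 = 2 * ‖z‖ ^ 2 := by
  rw [norm_mul, norm_signedConj, mul_pow, norm_real, Real.norm_eq_abs, sq_abs,
    Real.sq_sqrt zero_le_two]

end SignedConj

lemma norm_eq_one_of_pow_eq_pow {a b : ℕ} [NeZero a] [NeZero b] {z w : ℂ}
    (hzw : ‖z‖ ^ 2 + ‖w‖ ^ 2 = 2) (h : w ^ a = z ^ b) : ‖z‖ = 1 ∧ ‖w‖ = 1 := by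
  have hnorm : ‖w‖ ^ a = ‖z‖ ^ b := by rw [← norm_pow, h, norm_pow]
  have hz : ‖z‖ = 1 := by
    rcases lt_trichotomy ‖z‖ 1 with hlt | heq | hgt
    · have hw : 1 < ‖w‖ := by nlinarith [norm_nonneg z, norm_nonneg w]
      have := one_lt_pow₀ hw (NeZero.ne a)
      have := pow_lt_one₀ (norm_nonneg z) hlt (NeZero.ne b)
      linarith
    · exact heq
    · have hw : ‖w‖ < 1 := by nlinarith [norm_nonneg z, norm_nonneg w]
      have := one_lt_pow₀ hgt (NeZero.ne b)
      have := pow_lt_one₀ (norm_nonneg w) hw (NeZero.ne a)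
      linarith
  exact ⟨hz, by nlinarith [norm_nonneg w]⟩

lemma pow_eq_pow_iff_exists_rot {a b : ℕ} [NeZero a] [NeZero b] (hab : a.Coprime b) {z w : ℂ}
    (hzw : ‖z‖ ^ 2 + ‖w‖ ^ 2 = 2) :
    w ^ a = z ^ b ↔ ∃ t : ℝ, z = rot (a * t) ∧ w = rot (b * t) := by
  constructor
  · intro h
    obtain ⟨hz, hw⟩ := norm_eq_one_of_pow_eq_pow hzw h
    obtain ⟨α, rfl⟩ : ∃ α, z = rot α := ⟨arg z, by simpa [hz] using (norm_mul_rot_arg z).symm⟩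
    obtain ⟨β, rfl⟩ : ∃ β, w = rot β := ⟨arg w, by simpa [hw] using (norm_mul_rot_arg w).symm⟩
    rw [rot_pow, rot_pow, rot_eq_rot_iff] at h
    obtain ⟨k, hk⟩ := h
    obtain ⟨i, j, hij⟩ := Nat.isCoprime_iff_coprime.mpr hab
    have hij' : (i : ℝ) * a + j * b = 1 := by exact_mod_cast hij
    have ha : (a : ℝ) ≠ 0 := NeZero.ne _
    refine ⟨(α + 2 * Real.pi * (k * j : ℤ)) / a, rot_eq_rot_iff.mpr ⟨-(k * j), ?_⟩,
      rot_eq_rot_iff.mpr ⟨k * i, ?_⟩⟩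
    · push_cast
      field_simp
      ring
    · push_cast
      field_simp
      linear_combination hk - 2 * Real.pi * k * hij'
  · rintro ⟨t, rfl, rfl⟩
    exact rot_mul_pow_comm b a t

lemma norm_sq_add_norm_sq (x : ThreeSphere) : ‖x.1 0‖ ^ 2 + ‖x.1 1‖ ^ 2 = 1 := by
  rw [← Fin.sum_univ_two fun i => ‖x.1 i‖ ^ 2, ← EuclideanSpace.norm_sq_eq, norm_eq_of_mem_sphere,
    one_pow]

section Comparison

variable {a b : ℤ} [NeZero a.natAbs] [NeZero b.natAbs]

lemma mem_torusKnot_iff (hab : a.natAbs.Coprime b.natAbs) (x : ThreeSphere) :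
    x ∈ torusKnot a b ↔ ((√2 : ℝ) * signedConj b (x.1 1)) ^ a.natAbs =
      ((√2 : ℝ) * signedConj a (x.1 0)) ^ b.natAbs := by
  have hx : ‖(√2 : ℝ) * signedConj a (x.1 0)‖ ^ 2 + ‖(√2 : ℝ) * signedConj b (x.1 1)‖ ^ 2 = 2 := by
    rw [norm_sq_sqrt_two_mul_signedConj, norm_sq_sqrt_two_mul_signedConj, ← mul_add,
      norm_sq_add_norm_sq, mul_one]
  have eq_exp_iff (a : ℤ) (z : ℂ) (t : ℝ) : z = exp (a * t * I) / (√2 : ℝ) ↔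
      (√2 : ℝ) * signedConj a z = rot (a.natAbs * t) := by
    rw [← signedConj_rot, ← signedConj_ofReal_mul, (signedConj_involutive a).injective.eq_iff,
      eq_div_iff ofReal_sqrt_two_ne_zero, mul_comm, rot]
    push_cast
    rfl
  rw [pow_eq_pow_iff_exists_rot hab hx]
  exact exists_congr fun t => and_congr (eq_exp_iff a _ t) (eq_exp_iff b _ t)

lemma isClosed_torusKnot (hab : a.natAbs.Coprime b.natAbs) : IsClosed (torusKnot a b) := by
  rw [show torusKnot a b = {x | _} from Set.ext (mem_torusKnot_iff hab)]
  exact isClosed_eq (by fun_prop) (by fun_prop)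

/-- The exterior of a torus knot is homeomorphic to the model with positive exponents. -/
def exteriorHomeomorph (hab : a.natAbs.Coprime b.natAbs) :
    TorusKnotExterior a b ≃ₜ Exterior a.natAbs b.natAbs where
  toFun x := ⟨((√2 : ℝ) * signedConj a (x.1.1 0), (√2 : ℝ) * signedConj b (x.1.1 1)), by
    rw [norm_sq_sqrt_two_mul_signedConj, norm_sq_sqrt_two_mul_signedConj, ← mul_add,
      norm_sq_add_norm_sq, mul_one], fun h => x.2 ((mem_torusKnot_iff hab x.1).mpr h)⟩
  invFun y := ⟨⟨!₂[((√2)⁻¹ : ℝ) * signedConj a y.1.1, ((√2)⁻¹ : ℝ) * signedConj b y.1.2], by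
      rw [mem_sphere_zero_iff_norm, ← sq_eq_sq₀ (norm_nonneg _) zero_le_one,
        EuclideanSpace.norm_sq_eq, Fin.sum_univ_two]
      simp only [Matrix.cons_val_zero, Matrix.cons_val_one]
      rw [← mul_right_inj' two_ne_zero, mul_add, ← norm_sq_sqrt_two_mul_signedConj a,
        ← norm_sq_sqrt_two_mul_signedConj b, sqrt_two_mul_signedConj_inv,
        sqrt_two_mul_signedConj_inv, y.2.1]
      norm_num⟩, fun h => y.2.2 (by
        simpa only [Matrix.cons_val_zero, Matrix.cons_val_one, sqrt_two_mul_signedConj_inv]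
          using (mem_torusKnot_iff hab _).mp h)⟩
  left_inv x := by
    refine Subtype.ext (Subtype.ext ?_)
    ext i
    fin_cases i <;> simp [signedConj_ofReal_mul, signedConj_involutive _ _]
  right_inv y := Subtype.ext
    (Prod.ext (sqrt_two_mul_signedConj_inv a y.1.1) (sqrt_two_mul_signedConj_inv b y.1.2))
  continuous_toFun := by fun_prop
  continuous_invFun := by
    refine Continuous.subtype_mk (Continuous.subtype_mk ?_ _) _
    fun_prop

end Comparison

instance locallyPathConnectedSpace_threeSphere : LocallyPathConnectedSpace ThreeSphere :=
  have : Fact (Module.finrank ℝ (EuclideanSpace ℂ (Fin 2)) = 3 + 1) :=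
    ⟨by rw [finrank_real_of_complex, finrank_euclideanSpace_fin]⟩
  ChartedSpace.locallyPathConnectedSpace (EuclideanSpace ℝ (Fin 3)) ThreeSphere

end TorusKnot

/-! ### Towers of cyclic covers -/

section Towers

variable {X X' : Type} [TopologicalSpace X] [TopologicalSpace X']

/-- Transport of a cyclic cover along a homeomorphism of the bases. -/
def CyclicCover.map {m : ℕ} (C : CyclicCover m X) (h : X ≃ₜ X') : CyclicCover m X' where
  space := C.space
  proj := h ∘ C.proj
  isCoveringMap := C.isCoveringMap.homeomorph_comp h
  surjective := h.surjective.comp C.surjective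
  continuous_vadd := C.continuous_vadd
  proj_eq_iff x y := h.injective.eq_iff.trans (C.proj_eq_iff x y)
  free := C.free

/-- Transport of a `ℤ_p`-cover along a homeomorphism of the bases. -/
def ZpCover.map {p : ℕ} (C : ZpCover p X) (h : X ≃ₜ X') : ZpCover p X' where
  layer n := (C.layer n).map h
  trans := C.trans
  continuous_trans := C.continuous_trans
  proj_trans n x := congrArg h (C.proj_trans n x)
  trans_vadd := C.trans_vadd

lemma stdAddChar_pow_castHom (p n : ℕ) [NeZero p] (k : ZMod (p ^ (n + 1))) :
    (ZMod.stdAddChar k : ℂ) ^ p =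
      ZMod.stdAddChar (ZMod.castHom (pow_dvd_pow p n.le_succ) (ZMod (p ^ n)) k) := by
  obtain ⟨j, rfl⟩ := ZMod.intCast_surjective k
  have hp : (p : ℂ) ≠ 0 := NeZero.ne _
  rw [map_intCast (ZMod.castHom (pow_dvd_pow p n.le_succ) (ZMod (p ^ n))), ZMod.stdAddChar_coe,
    ZMod.stdAddChar_coe, ← Complex.exp_nat_mul]
  congr 1
  push_cast
  field_simp
  ring

namespace RootCover

variable {f : C(X, {z : ℂ // z ≠ 0})}

/-- The `k`-th power map from the `k * m`-th roots to the `m`-th roots. -/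
def powMap {k m m' : ℕ} (h : k * m = m') (y : RootCover f m') : RootCover f m :=
  ⟨(y.proj, y.root ^ k), by rw [← pow_mul, h, y.root_pow]⟩

lemma continuous_powMap {k m m' : ℕ} (h : k * m = m') :
    Continuous (powMap (f := f) h) :=
  Continuous.subtype_mk (f := fun y : RootCover f m' => (y.proj, y.root ^ k)) (by fun_prop) _

variable [T2Space X]

variable (f) in
/-- The root cover, if connected, as a cyclic cover. -/
def cyclicCover (m : ℕ) [NeZero m] [ConnectedSpace (RootCover f m)] : CyclicCover m X where
  space := RootCover f m
  proj := proj
  isCoveringMap := isQuotientCoveringMap.isCoveringMap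
  surjective := surjective_proj
  continuous_vadd := continuous_vadd
  proj_eq_iff := proj_eq_iff
  free := eq_zero_of_vadd_eq_self

variable (f) in
/-- The `ℤ_p`-cover formed by the `pⁿ`-th roots of a function. -/
def zpCover (p : ℕ) [NeZero p] [∀ n, ConnectedSpace (RootCover f (p ^ n))] : ZpCover p X where
  layer n := cyclicCover f (p ^ n)
  trans n := powMap (pow_succ' p n).symm
  continuous_trans n := continuous_powMap _
  proj_trans _ _ := rfl
  trans_vadd n k y := ext_proj_root rfl (by
    change (root y * ZMod.stdAddChar k) ^ p = root y ^ p * ZMod.stdAddChar _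
    rw [mul_pow, stdAddChar_pow_castHom])

end RootCover

end Towers

namespace TorusKnot

open Winding

variable {a b m : ℕ} [NeZero a] [NeZero b] [NeZero m]

lemma connectedSpace_rootCover_defect (hab : a.Coprime b) (hmb : m.Coprime b) :
    ConnectedSpace (RootCover (defect a b) m) :=
  have := pathConnectedSpace_exterior hab
  have := RootCover.pathConnectedSpace (f := defect a b) (m := m) (genX a b) (by
    rw [winding_genX, Int.cast_natCast]
    exact (ZMod.isUnit_iff_coprime b m).mpr hmb.symm)
  inferInstance

theorem cardTorsionH₁_eq_pow [LocallyPathConnectedSpace (Exterior a b)] (hab : a.Coprime b)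
    (hmb : m.Coprime b) (C : CyclicCover m (Exterior a b)) :
    cardTorsionH₁ C.space = b ^ (a.gcd m - 1) := by
  have : NeZero (a.gcd m) := ⟨Nat.gcd_ne_zero_left (NeZero.ne a)⟩
  obtain ⟨φ, hφ, hC⟩ := C.exists_surjective_cardTorsionH₁_eq (basePt a b)
  obtain ⟨c⟩ := nonempty_separatingCharacter hab (Nat.mul_div_cancel' (a.gcd_dvd_left m))
  rw [hC, (torusGenerators hab).ker_eq_divKer hmb hφ]
  exact (torusGenerators hab).card_torsion_abelianization_divKer (NeZero.ne b) hab (NeZero.ne m)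
    hmb c

end TorusKnot

end

lemma gcd_pow_mul_pow {p k : ℕ} (hpk : p.Coprime k) (r n : ℕ) :
    (p ^ r * k).gcd (p ^ n) = p ^ min n r := by
  rw [(hpk.symm.pow_right n).gcd_mul_right_cancel]
  rcases le_total n r with h | h
  · rw [min_eq_left h, Nat.gcd_eq_right (pow_dvd_pow p h)]
  · rw [min_eq_right h, Nat.gcd_eq_left (pow_dvd_pow p h)]

theorem mainTheorem6_general (m : ℕ) [NeZero m] (a b : ℤ) (hab : IsCoprime a b) (ha : a ≠ 0)
    (hb : b ≠ 0) (hmb : m.Coprime b.natAbs) :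
    Nonempty (ZpCover m (TorusKnotExterior a b)) ∧
    ∀ C : CyclicCover m (TorusKnotExterior a b),
      cardTorsionH₁ C.space = b.natAbs ^ (a.natAbs.gcd m - 1) := by
  have : NeZero a.natAbs := ⟨Int.natAbs_ne_zero.mpr ha⟩
  have : NeZero b.natAbs := ⟨Int.natAbs_ne_zero.mpr hb⟩
  have hab' : a.natAbs.Coprime b.natAbs := Int.isCoprime_iff_gcd_eq_one.mp hab
  let e := TorusKnot.exteriorHomeomorph hab'
  have := (TorusKnot.isClosed_torusKnot hab').isOpen_compl.locallyPathConnectedSpace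
  have := e.symm.isOpenEmbedding.locallyPathConnectedSpace
  have (n : ℕ) := TorusKnot.connectedSpace_rootCover_defect hab' (hmb.pow_left n)
  exact ⟨⟨(RootCover.zpCover (TorusKnot.defect _ _) m).map e.symm⟩,
    fun C => TorusKnot.cardTorsionH₁_eq_pow hab' hmb (C.map e)⟩

theorem mainTheorem6 (p : ℕ) [Fact p.Prime] (a b : ℤ) (hab : IsCoprime a b)
    (hb : ¬ (p : ℤ) ∣ b) (r : ℕ) (a' : ℤ) (ha : a = (p : ℤ) ^ r * a') (ha' : ¬ (p : ℤ) ∣ a') :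
    Nonempty (ZpCover p (TorusKnotExterior a b)) ∧
    ∀ C : ZpCover p (TorusKnotExterior a b),
      (∀ n : ℕ, cardTorsionH₁ (C.layer n).space = b.natAbs ^ (p ^ min n r - 1)) ∧
      Filter.Tendsto (fun n : ℕ => (cardTorsionH₁ (C.layer n).space : ℤ_[p])) Filter.atTop
        (𝓝 ((b.natAbs : ℤ_[p]) ^ (p ^ r - 1))) := by
  have hp : p.Prime := Fact.out
  have hb0 : b ≠ 0 := fun h => hb (h ▸ dvd_zero _)
  have ha0 : a ≠ 0 := ha ▸ mul_ne_zero (pow_ne_zero r (Int.natCast_ne_zero.mpr hp.ne_zero))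
    fun h => ha' (h ▸ dvd_zero _)
  have hpb : p.Coprime b.natAbs := hp.coprime_iff_not_dvd.mpr (hb ∘ Int.natCast_dvd.mpr)
  have hpa : p.Coprime a'.natAbs := hp.coprime_iff_not_dvd.mpr (ha' ∘ Int.natCast_dvd.mpr)
  refine ⟨(mainTheorem6_general p a b hab ha0 hb0 hpb).1, fun C => ?_⟩
  have hcard (n : ℕ) : cardTorsionH₁ (C.layer n).space = b.natAbs ^ (p ^ min n r - 1) := by
    rw [(mainTheorem6_general (p ^ n) a b hab ha0 hb0 (hpb.pow_left n)).2 (C.layer n), ha,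
      Int.natAbs_mul, Int.natAbs_pow, Int.natAbs_natCast, gcd_pow_mul_pow hpa]
  refine ⟨hcard, tendsto_const_nhds.congr' ?_⟩
  filter_upwards [Filter.eventually_ge_atTop r] with n hn
  rw [hcard, min_eq_right hn, Nat.cast_pow]
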